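/- Conventions. Let $k$ be a field. A toric variety $X$ over $k$ is a normal toric variety given by a character lattice $M$, with dual $N=\operatorname{Hom}(M,\mathbb Z)$, and a finite fan $\Delta$ of strictly convex rational polyhedral cones in $N_{\mathbb R}=\operatorname{Hom}(M,\mathbb R)$; it is glued from the charts $U_\sigma=\operatorname{Spec}k[\sigma^\vee\cap M]$, and it is affine when $\Delta$ consists of the faces of one cone $\sigma$. Morphisms of toric varieties are the toric (equivariant) ones, given by maps of fans. For $\kappa\in\Delta$ write $O_\kappa\cong\operatorname{Spec}k[\kappa^\perp\cap M]$ for the corresponding torus orbit. For faces $\kappa\subset\sigma$, the extended cone of $\sigma$ is $\overline\sigma=\operatorname{Hom}(\sigma^\vee\cap M,\mathbb R_{\ge0}\cup\{\infty\})$, the point $\infty_\kappa\in\overline\sigma$ is $0$ on $\kappa^\perp$ and $\infty$ elsewhere, and the asymptotic cone of $\overline\sigma$ at $\kappa=\infty$ is $\infty_\kappa+\sigma=\sigma/\mathbb R\kappa$, a cone in $N_{\mathbb R}/\mathbb R\kappa$ with lattice $N/(\mathbb R\kappa\cap N)$. Let $(f_i\colon X_i\to B)_{1\le i\le n}$, $n\ge1$,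 be morphisms of toric varieties over $k$, with fans $\Delta_i$ and $\Delta_B$, and let $F=X_1\times_B\cdots\times_BX_n$ be the fiber product in the category of schemes. By a torus orbit of $F$ we mean a nonempty intersection of $F$ with an orbit of the product of the dense tori of the $X_i$ on the product of the $X_i$. Theorem. Let $Y^\circ\subset F$ be a torus orbit. Then there are orbits $Y_i^\circ=O_{\kappa_i}$ of $X_i$ and $Y_B^\circ=O_{\kappa_B}$ of $B$ such that $f_i$ maps $Y_i^\circ$ to $Y_B^\circ$ and $Y^\circ=Y_1^\circ\times_{Y_B^\circ}\cdots\times_{Y_B^\circ}Y_n^\circ$ as a locally closed subscheme of $F$ (the scheme-theoretic intersection of $F$ with the product of the $Y_i^\circ$). Let $G$ be the amalgamated sum of the character lattices $\kappa_i^\perp\cap M_i$ of the $Y_i^\circ$ over the character lattice $\kappa_B^\perp\cap M_B$ of $Y_B^\circ$. Let $Y$ be the normalization of an irreducible component of the closure of $Y^\circ$, with its reduced structure. Then $Y$ is a toric variety over a finite extension $L$ of $k$; its cocharacter lattice is the fiber product of the lattices $N_i/(\mathbb R\kappa_i\cap N_i)$ over $N_B/(\mathbb R\kappa_B\cap N_B)$;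 its dense torus maps isomorphically onto the corresponding component of $Y^\circ$ (reduced); and the projections from this torus to the $Y_i^\circ$ are given by the projections of lattices, up to constants in $L^\times$. If $G$ is torsion-free (that is, if $Y^\circ$ is a torus), then $Y^\circ$ is irreducible, $L=k$, and all the constants are $1$. If the $X_i$ and $B$ are affine, with cones $\sigma_i$ and $\sigma_B$, then $Y$ is the affine toric variety whose cone is the fiber product of the asymptotic cones $\infty_{\kappa_i}+\sigma_i=\sigma_i/\mathbb R\kappa_i$ of the $\overline\sigma_i$ over the asymptotic cone $\infty_{\kappa_B}+\sigma_B=\sigma_B/\mathbb R\kappa_B$ of $\overline\sigma_B$. In general, the fan of $Y$ is the fiber product of the fans $\Sigma_i=\{\sigma/\mathbb R\kappa_i:\kappa_i\subset\sigma\in\Delta_i\}$ over the fan $\Sigma_B=\{\sigma/\mathbb R\kappa_B:\kappa_B\subset\sigma\in\Delta_B\}$, that is, the set of fiber products of cones of the $\Sigma_i$ that map to a common cone of $\Sigma_B$. Corollary. Let $Z$ be an irreducible component of $F$, with normalization $Y$. Let $\overline{O_{\kappa_i}}$ (respectively $\overline{O_{\kappa_B}}$) be the smallest closure of a torus orbit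 of $X_i$ (respectively $B$) that contains the image of $Z$. Then the asymptotic cones at $\kappa_i=\infty$ form a fan $\Sigma_i$, those at $\kappa_B=\infty$ form a fan $\Sigma_B$, and $Y$ is a toric variety, in the sense described above (over a finite extension $L$ of $k$, equal to $k$ when the group $G$ attached to the $\kappa_i$ and $\kappa_B$ is torsion-free), with fan $\Sigma_1\times_{\Sigma_B}\cdots\times_{\Sigma_B}\Sigma_n$. -/

import Mathlib

open CategoryTheory Limits AlgebraicGeometry
open scoped NNReal ENNReal

universe u

namespace ToricFiber

/-! ### Cones in the real cocharacter space

A torus is given by its character lattice `M`. Its cocharacter lattice is `N = M →+ ℤ`, and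
`N_ℝ = M →+ ℝ`. -/

/-- Cones in `N_ℝ = Hom(M, ℝ)`. -/
abbrev RealCone (M : Type u) [AddCommGroup M] := PointedCone ℝ (M →+ ℝ)

section Cones

variable {M M' : Type u} [AddCommGroup M] [AddCommGroup M']

/-- The linear map `Hom(M', ℝ) → Hom(M, ℝ)` of cocharacter spaces attached to a homomorphism
`M → M'` of character lattices. -/
def pull (φ : M →+ M') : (M' →+ ℝ) →ₗ[ℝ] (M →+ ℝ) where
  toFun v := v.comp φ
  map_add' _ _ := rfl
  map_smul' _ _ := rfl

/-- The monoid `σ^∨ ∩ M` of characters that are nonnegative on `σ`. -/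
def dualMonoid (σ : RealCone M) : AddSubmonoid M where
  carrier := {m | ∀ v ∈ σ, 0 ≤ v m}
  zero_mem' v _ := by simp
  add_mem' ha hb v hv := by
    rw [map_add]
    exact add_nonneg (ha v hv) (hb v hv)

/-- The lattice `κ^⊥ ∩ M`. It is the character lattice of the torus orbit attached to `κ`, and it
is dual to the quotient lattice `N / (ℝκ ∩ N)`. -/
def perp (κ : RealCone M) : AddSubgroup M where
  carrier := {m | ∀ v ∈ κ, v m = 0}
  zero_mem' v _ := by simp
  add_mem' ha hb v hv := by rw [map_add, ha v hv, hb v hv, add_zero]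
  neg_mem' ha v hv := by rw [map_neg, ha v hv, neg_zero]

lemma add_mem_perp_iff {σ κ : RealCone M} (h : κ ≤ σ) {a b : M} (ha : a ∈ dualMonoid σ)
    (hb : b ∈ dualMonoid σ) : a + b ∈ perp κ ↔ a ∈ perp κ ∧ b ∈ perp κ := by
  refine ⟨fun hab => ⟨fun v hv => ?_, fun v hv => ?_⟩, fun hab => add_mem hab.1 hab.2⟩ <;>
  · have h1 := hab v hv
    rw [map_add] at h1
    have h2 := ha v (h hv)
    have h3 := hb v (h hv)
    linarith

/-- Rational polyhedral cones: generated by finitely many elements of `N = Hom(M, ℤ)`. -/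
def IsRationalPolyhedral (σ : RealCone M) : Prop :=
  ∃ s : Finset (M →+ ℤ),
    σ = PointedCone.hull ℝ ((fun n : M →+ ℤ => (Int.castAddHom ℝ).comp n) '' (s : Set (M →+ ℤ)))

/-- A (finite, nonempty) fan of strictly convex rational polyhedral cones. -/
structure IsFan (Δ : Set (RealCone M)) : Prop where
  finite : Δ.Finite
  bot_mem : ⊥ ∈ Δ
  polyhedral : ∀ σ ∈ Δ, IsRationalPolyhedral σ
  strictlyConvex : ∀ σ ∈ Δ, ∀ v ∈ σ, -v ∈ σ → v = 0
  face_mem : ∀ σ ∈ Δ, ∀ τ : RealCone M, τ.IsFaceOf σ → τ ∈ Δ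
  inter_face : ∀ σ ∈ Δ, ∀ τ ∈ Δ, (σ ⊓ τ).IsFaceOf σ

/-- The fan consisting of the faces of `σ`. -/
def faces (σ : RealCone M) : Set (RealCone M) := {τ | τ.IsFaceOf σ}

/-- The asymptotic cone `σ / ℝκ` in `N_ℝ / ℝκ = Hom(κ^⊥ ∩ M, ℝ)`: the image of `σ` under the
restriction of functionals to `κ^⊥ ∩ M`. -/
def asymptoticCone (σ κ : RealCone M) : RealCone (perp κ) := PointedCone.map (pull (perp κ).subtype) σ

/-- The asymptotic cones at `κ = ∞` of the cones `σ ∈ Δ` that contain `κ`. -/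
def asymptoticFan (Δ : Set (RealCone M)) (κ : RealCone M) : Set (RealCone (perp κ)) :=
  {C | ∃ σ ∈ Δ, κ ≤ σ ∧ C = asymptoticCone σ κ}

/-! ### Extended cones -/

/-- The extended cone `Hom(σ^∨ ∩ M, ℝ_{≥0} ∪ {∞})`. -/
abbrev ExtendedCone (σ : RealCone M) := dualMonoid σ →+ ℝ≥0∞

/-- The inclusion of a cone into its extended cone. -/
noncomputable def toExtended (σ : RealCone M) (v : M →+ ℝ) (hv : v ∈ σ) : ExtendedCone σ where
  toFun m := ENNReal.ofReal (v m)
  map_zero' := by simp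
  map_add' a b := by
    rw [AddSubmonoid.coe_add, map_add, ENNReal.ofReal_add (a.2 v hv) (b.2 v hv)]

open Classical in
/-- The origin `∞_κ` at `κ = ∞`: it is `0` on `κ^⊥` and `∞` elsewhere. -/
noncomputable def originAtInfinity {σ κ : RealCone M} (h : κ ≤ σ) : ExtendedCone σ where
  toFun m := if (m : M) ∈ perp κ then 0 else ⊤
  map_zero' := by simp [zero_mem]
  map_add' a b := by
    by_cases h1 : (a : M) ∈ perp κ <;> by_cases h2 : (b : M) ∈ perp κ <;>
      simp [add_mem_perp_iff h a.2 b.2, h1, h2]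

/-- The asymptotic cone `∞_κ + σ` as a subset of the extended cone of `σ`. -/
def asymptoticPart {σ κ : RealCone M} (h : κ ≤ σ) : Set (ExtendedCone σ) :=
  {p | ∃ (v : M →+ ℝ) (hv : v ∈ σ), p = originAtInfinity h + toExtended σ v hv}

/-- The monoid map `τ^∨ ∩ M → σ^∨ ∩ M'` dual to a map of cones `σ → τ`. -/
def dualMonoidMap (φ : M →+ M') {σ : RealCone M'} {τ : RealCone M} (h : ∀ v ∈ σ, pull φ v ∈ τ) :
    dualMonoid τ →+ dualMonoid σ where
  toFun m := ⟨φ m, fun v hv => m.2 _ (h v hv)⟩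
  map_zero' := by ext; simp
  map_add' a b := by ext; simp

/-- The map of extended cones induced by a map of cones `σ → τ`. -/
def extendedMap (φ : M →+ M') {σ : RealCone M'} {τ : RealCone M} (h : ∀ v ∈ σ, pull φ v ∈ τ)
    (p : ExtendedCone σ) : ExtendedCone τ :=
  p.comp (dualMonoidMap φ h)

/-- The map of lattices `κ'^⊥ → κ^⊥` induced by a map of cones `κ → κ'`. -/
def perpMap (φ : M →+ M') {κ : RealCone M'} {κ' : RealCone M} (h : ∀ v ∈ κ, pull φ v ∈ κ') :
    perp κ' →+ perp κ where
  toFun m := ⟨φ m, fun v hv => m.2 _ (h v hv)⟩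
  map_zero' := by ext; simp
  map_add' a b := by ext; simp

end Cones

/-! ### Fiber products of lattices, cones and fans -/

section FiberProducts

variable {ι : Type} {M : ι → Type u} {MB : Type u} [∀ i, AddCommGroup (M i)] [AddCommGroup MB]

open Classical in
/-- The group `⨁_{MB} M i` (amalgamated sum), for `ι` finite. It is the character group of the
fiber product of the tori with character lattices `M i` over the torus with character lattice
`MB`; it can have torsion. -/
abbrev FiberGroup (φ : ∀ i, MB →+ M i) : Type u :=
  (∀ i, M i) ⧸ AddSubgroup.closure
    {x : ∀ i, M i | ∃ (i j : ι) (m : MB), x = Pi.single i (φ i m) - Pi.single j (φ j m)}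

/-- The amalgamated sum modulo torsion. Homomorphisms from it to `ℤ` (or to `ℝ`) are the families
of homomorphisms `M i → ℤ` with the same restriction to `MB`, so that its dual is the fiber
product of the cocharacter lattices. -/
abbrev FiberLattice (φ : ∀ i, MB →+ M i) : Type u :=
  FiberGroup φ ⧸ AddCommGroup.torsion (FiberGroup φ)

open Classical in
/-- The map of character lattices dual to the `i`-th projection of the fiber product. -/
noncomputable def fiberIncl (φ : ∀ i, MB →+ M i) (i : ι) : M i →+ FiberLattice φ :=
  ((QuotientAddGroup.mk' (AddCommGroup.torsion (FiberGroup φ))).comp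
    (QuotientAddGroup.mk' _)).comp (AddMonoidHom.single M i)

/-- The fiber product of the cones `σ i`, in the fiber product of the spaces `Hom(M i, ℝ)` over
`Hom(MB, ℝ)`. If all `σ i` map to a cone `τ`, then this is the fiber product over `τ`. -/
noncomputable def fiberCone (φ : ∀ i, MB →+ M i) (σ : ∀ i, RealCone (M i)) : RealCone (FiberLattice φ) :=
  ⨅ i, PointedCone.comap (pull (fiberIncl φ i)) (σ i)

/-- The fiber product of the fans `Δ i` over `ΔB`: the fiber products of cones `σ i ∈ Δ i` over
cones `τ ∈ ΔB`. -/
def fiberFan (φ : ∀ i, MB →+ M i) (Δ : ∀ i, Set (RealCone (M i))) (ΔB : Set (RealCone MB)) :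
    Set (RealCone (FiberLattice φ)) :=
  {C | ∃ σ : ∀ i, RealCone (M i), (∀ i, σ i ∈ Δ i) ∧
    (∃ τ ∈ ΔB, ∀ i, ∀ v ∈ σ i, pull (φ i) v ∈ τ) ∧ C = fiberCone φ σ}

end FiberProducts

/-! ### Toric varieties -/

/-- `Spec k[P]`. -/
noncomputable abbrev specMonoid (k P : Type u) [Field k] [AddCommMonoid P] : Scheme.{u} :=
  Spec (.of (AddMonoidAlgebra k P))

/-- `Spec k[Q] → Spec k[P]`, for a homomorphism `P → Q`. -/
noncomputable def specMap (k : Type u) [Field k] {P Q : Type u} [AddCommMonoid P] [AddCommMonoid Q]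
    (φ : P →+ Q) : specMonoid k Q ⟶ specMonoid k P :=
  Spec.map (CommRingCat.ofHom (AddMonoidAlgebra.mapDomainRingHom k φ))

open Classical in
/-- The surjection `k[κ^∨ ∩ M] → k[κ^⊥ ∩ M]` that kills the monomials outside `κ^⊥`. -/
noncomputable def orbitRingHom (k : Type u) [Field k] {M : Type u} [AddCommGroup M] (κ : RealCone M) :
    AddMonoidAlgebra k (dualMonoid κ) →ₐ[k] AddMonoidAlgebra k (perp κ) :=
  AddMonoidAlgebra.lift k (AddMonoidAlgebra k (perp κ)) (dualMonoid κ)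
    { toFun := fun m =>
        if h : (m.toAdd : M) ∈ perp κ then AddMonoidAlgebra.single ⟨(m.toAdd : M), h⟩ 1 else 0
      map_one' := by
        simp only [toAdd_one, ZeroMemClass.coe_zero, zero_mem, dite_true]
        rfl
      map_mul' := fun a b => by
        have key := add_mem_perp_iff (le_refl κ) a.toAdd.2 b.toAdd.2
        simp only [toAdd_mul, AddSubmonoid.coe_add]
        by_cases h1 : (a.toAdd : M) ∈ perp κ <;> by_cases h2 : (b.toAdd : M) ∈ perp κ
        · rw [dif_pos (key.2 ⟨h1, h2⟩), dif_pos h1, dif_pos h2,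
            AddMonoidAlgebra.single_mul_single, one_mul]
          rfl
        · rw [dif_neg (fun h => h2 (key.1 h).2), dif_neg h2, mul_zero]
        · rw [dif_neg (fun h => h1 (key.1 h).1), dif_neg h1, zero_mul]
        · rw [dif_neg (fun h => h1 (key.1 h).1), dif_neg h1, zero_mul] }

/-- The (normal) toric variety over `k` with character lattice `M` and fan `Δ`: a `k`-scheme glued
from the affine charts `U_σ = Spec k[σ^∨ ∩ M]`, `σ ∈ Δ`, along `U_σ ∩ U_τ = U_{σ ∩ τ}`. -/
structure ToricVariety (k : Type u) [Field k] (M : Type u) [AddCommGroup M]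
    (Δ : Set (RealCone M)) where
  /-- the underlying scheme -/
  X : Scheme.{u}
  /-- the structure morphism -/
  str : X ⟶ Spec (.of k)
  /-- the charts -/
  chart : ∀ σ ∈ Δ, (specMonoid k (dualMonoid σ) ⟶ X)
  free : Module.Free ℤ M
  fg : Module.Finite ℤ M
  isFan : IsFan Δ
  chart_open : ∀ σ hσ, IsOpenImmersion (chart σ hσ)
  chart_str : ∀ σ hσ, chart σ hσ ≫ str =
    Spec.map (CommRingCat.ofHom (algebraMap k (AddMonoidAlgebra k (dualMonoid σ))))
  chart_face : ∀ σ hσ τ hτ (h : ∀ v ∈ τ, pull (AddMonoidHom.id M) v ∈ σ),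
    specMap k (dualMonoidMap (AddMonoidHom.id M) h) ≫ chart σ hσ = chart τ hτ
  chart_cover : ∀ x : X, ∃ σ hσ, x ∈ Set.range (chart σ hσ)
  chart_inter : ∀ σ hσ τ hτ (h : σ ⊓ τ ∈ Δ),
    Set.range (chart σ hσ) ∩ Set.range (chart τ hτ) ⊆ Set.range (chart (σ ⊓ τ) h)

section Toric

variable {k : Type u} [Field k] {M : Type u} [AddCommGroup M] {Δ : Set (RealCone M)}

/-- The dense torus. -/
noncomputable def ToricVariety.torus (V : ToricVariety k M Δ) : specMonoid k M ⟶ V.X :=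
  specMap k (dualMonoid (⊥ : RealCone M)).subtype ≫ V.chart ⊥ V.isFan.bot_mem

/-- The torus orbit of a point. The torus `T = Spec k[M]` acts on each chart by a morphism
`act : T × U_σ → U_σ`, dual to `χ^m ↦ χ^m ⊗ χ^m`; the orbit of `x` consists of the points `act z`,
where `z ∈ T × U_σ` is a point with second projection `x`. -/
def ToricVariety.orbit (V : ToricVariety k M Δ) (x : V.X) : Set V.X :=
  {y | ∃ (σ : RealCone M) (hσ : σ ∈ Δ) (z : specMonoid k (M × dualMonoid σ)),
    (specMap k (AddMonoidHom.inr M (dualMonoid σ)) ≫ V.chart σ hσ) z = x ∧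
    (specMap k ((dualMonoid σ).subtype.prod (AddMonoidHom.id (dualMonoid σ))) ≫
      V.chart σ hσ) z = y}

/-- The torus orbit attached to the cone `κ`, as an immersion: it is the torus
`Spec k[κ^⊥ ∩ M]`, embedded as the closed orbit of the chart `U_κ`. -/
noncomputable def ToricVariety.orbitMap (V : ToricVariety k M Δ) (κ : RealCone M) (hκ : κ ∈ Δ) :
    specMonoid k (perp κ) ⟶ V.X :=
  Spec.map (CommRingCat.ofHom (orbitRingHom k κ).toRingHom) ≫ V.chart κ hκ

/-- Toric morphisms: morphisms given on charts by a map of fans, where `φ` is the induced map of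
character lattices. -/
def IsToricMorphism {MB : Type u} [AddCommGroup MB] {ΔB : Set (RealCone MB)} (V : ToricVariety k M Δ)
    (B : ToricVariety k MB ΔB) (φ : MB →+ M) (f : V.X ⟶ B.X) : Prop :=
  ∀ σ hσ, ∃ (τ : RealCone MB) (hτ : τ ∈ ΔB) (h : ∀ v ∈ σ, pull φ v ∈ τ),
    V.chart σ hσ ≫ f = specMap k (dualMonoidMap φ h) ≫ B.chart τ hτ

end Toric

/-- `ν : Y → F` is the normalization of the irreducible closed subset `Z` of `F` (with its reduced
structure): `Y` is integral and normal, and `ν` is integral with image `Z` and birational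
onto `Z`. -/
structure IsNormalizationOf {Y F : Scheme.{u}} (ν : Y ⟶ F) (Z : Set F) : Prop where
  integral : IsIntegral Y
  normal : ∀ y : Y, IsIntegrallyClosed (Y.presheaf.stalk y)
  integralHom : IsIntegralHom ν
  range_eq : Set.range ν = Z
  birational : Function.Bijective (ν.residueFieldMap (genericPoint Y)).hom

/-- The `k`-algebra map `k[P] → L[Q]`, `χ^m ↦ c(m) χ^{q(m)}`. -/
noncomputable def twistedMonomialHom {k L P Q : Type u} [Field k] [Field L] [Algebra k L]
    [AddCommGroup P] [AddCommGroup Q] (q : P →+ Q) (c : Multiplicative P →* L) :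
    AddMonoidAlgebra k P →ₐ[k] AddMonoidAlgebra L Q :=
  AddMonoidAlgebra.lift k (AddMonoidAlgebra L Q) P
    { toFun := fun m => AddMonoidAlgebra.single (q m.toAdd) (c m)
      map_one' := by simp [AddMonoidAlgebra.one_def]
      map_mul' := fun a b => by simp [AddMonoidAlgebra.single_mul_single] }

/-! ### Torus orbits of the fiber product -/

section Orbits

variable {k : Type u} [Field k] {ι : Type} [Finite ι] {M : ι → Type u} {MB : Type u}
  [∀ i, AddCommGroup (M i)] [AddCommGroup MB] {Δ : ∀ i, Set (RealCone (M i))} {ΔB : Set (RealCone MB)}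

/-- The scheme-theoretic fiber product of the `X i` over `B`. -/
noncomputable abbrev FiberProduct (X : ∀ i, ToricVariety k (M i) (Δ i)) (B : ToricVariety k MB ΔB)
    (f : ∀ i, (X i).X ⟶ B.X) : Scheme.{u} :=
  widePullback B.X (fun i => (X i).X) f

/-- The torus orbit of a point of the fiber product: the intersection of the fiber product with an
orbit of the product of the tori of the `X i` in the product of the `X i`. -/
def fiberOrbit (X : ∀ i, ToricVariety k (M i) (Δ i)) (B : ToricVariety k MB ΔB)
    (f : ∀ i, (X i).X ⟶ B.X) (x : FiberProduct X B f) : Set (FiberProduct X B f) :=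
  {y | ∀ i, (WidePullback.π f i) y ∈ (X i).orbit ((WidePullback.π f i) x)}

/-- Cones `κ i ∈ Δ i` (that is, torus orbits of the `X i`), which map to a cone `κB ∈ ΔB`. -/
structure OrbitFamily (φ : ∀ i, MB →+ M i) (Δ : ∀ i, Set (RealCone (M i))) (ΔB : Set (RealCone MB)) where
  κ : ∀ i, RealCone (M i)
  mem : ∀ i, κ i ∈ Δ i
  κB : RealCone MB
  memB : κB ∈ ΔB
  maps : ∀ i, ∀ v ∈ κ i, pull (φ i) v ∈ κB

namespace OrbitFamily

variable {φ : ∀ i, MB →+ M i} (D : OrbitFamily φ Δ ΔB)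

/-- The maps of character lattices of the orbits. -/
def map (i : ι) : perp D.κB →+ perp (D.κ i) := perpMap (φ i) (D.maps i)

/-- The lattice dual to the fiber product of the cocharacter lattices `N_i / (ℝκ_i ∩ N_i)` of the
orbits. -/
abbrev Lattice : Type u := FiberLattice D.map

/-- The fiber product of the fans of asymptotic cones at the orbits. -/
def fan : Set (RealCone D.Lattice) :=
  fiberFan D.map (fun i => asymptoticFan (Δ i) (D.κ i)) (asymptoticFan ΔB D.κB)

/-- The fiber product of the asymptotic cones of `σ i` at `κ i`. -/
noncomputable def cone (σ : ∀ i, RealCone (M i)) : RealCone D.Lattice :=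
  fiberCone D.map (fun i => asymptoticCone (σ i) (D.κ i))

/-- The fiber product of the asymptotic cones `∞_{κ i} + σ i` over `∞_{κB} + σB`, inside the
product of the extended cones. -/
def extendedFiberProduct {σ : ∀ i, RealCone (M i)} {σB : RealCone MB}
    (hσ : ∀ i, ∀ v ∈ σ i, pull (φ i) v ∈ σB) (hκ : ∀ i, D.κ i ≤ σ i) (hκB : D.κB ≤ σB) :
    Set (∀ i, ExtendedCone (σ i)) :=
  {p | (∀ i, p i ∈ asymptoticPart (hκ i)) ∧
    ∃ q ∈ asymptoticPart hκB, ∀ i, extendedMap (φ i) (hσ i) (p i) = q}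

open Classical in
/-- `w` is the finite part of the family `p` of points of the extended cones: `p i` agrees with
the `i`-th component of `w` on `κ i ^⊥`, and is infinite elsewhere. -/
def IsFinitePart {σ : ∀ i, RealCone (M i)} (w : D.Lattice →+ ℝ) (p : ∀ i, ExtendedCone (σ i)) : Prop :=
  ∀ (i : ι) (m : dualMonoid (σ i)),
    p i m = if h : (m : M i) ∈ perp (D.κ i) then ENNReal.ofReal (w (fiberIncl D.map i ⟨m, h⟩))
      else ⊤

variable {X : ∀ i, ToricVariety k (M i) (Δ i)} {B : ToricVariety k MB ΔB}
  {f : ∀ i, (X i).X ⟶ B.X}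

/-- The map to the fiber product of the `X i` over `B` from the fiber product of the orbits
attached to the `κ i` over the orbit attached to `κB`. -/
noncomputable def orbitToFiber
    (h : ∀ i, (X i).orbitMap (D.κ i) (D.mem i) ≫ f i =
      specMap k (D.map i) ≫ B.orbitMap D.κB D.memB) :
    widePullback (specMonoid k (perp D.κB)) (fun i => specMonoid k (perp (D.κ i)))
      (fun i => specMap k (D.map i)) ⟶ FiberProduct X B f :=
  WidePullback.lift (WidePullback.base _ ≫ B.orbitMap D.κB D.memB)
    (fun i => WidePullback.π _ i ≫ (X i).orbitMap (D.κ i) (D.mem i))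
    (fun i => by rw [Category.assoc, h i, WidePullback.π_arrow_assoc])

/-- `ν : Y → F` is the normalization of `Z`, where `Y` is a variety over a finite extension `L` of
`k` with dense torus `t : Spec L[D.Lattice] → Y`, which is a component of the fiber product of the
orbits. On the torus, the projections to the orbits of the `X i` are given by the maps of
lattices, up to constants in `L`. If the fiber product of the orbits is a torus, then `L = k` and
there are no constants. -/
structure IsToricNormalization {Z : Set (FiberProduct X B f)} {L : Type u} [Field L] [Algebra k L]
    {Y : Scheme.{u}} (t : specMonoid L D.Lattice ⟶ Y) (ν : Y ⟶ FiberProduct X B f) : Prop where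
  finite : Module.Finite k L
  normalization : IsNormalizationOf ν Z
  immersion : IsImmersion (t ≫ ν)
  range_torus : Set.range (t ≫ ν) = Z ∩ ⋂ i,
    (WidePullback.π f i) ⁻¹' Set.range ((X i).orbitMap (D.κ i) (D.mem i))
  monomial : ∃ c : ∀ i, Multiplicative (perp (D.κ i)) →* L,
    (∀ i, t ≫ ν ≫ WidePullback.π f i =
      Spec.map (CommRingCat.ofHom
        (twistedMonomialHom (k := k) (fiberIncl D.map i) (c i)).toRingHom) ≫
      (X i).orbitMap (D.κ i) (D.mem i)) ∧
    (IsAddTorsionFree (FiberGroup D.map) →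
      Function.Bijective (algebraMap k L) ∧ ∀ i m, c i m = 1)

/-- The normalization of `Z` is the toric variety with fan `D.fan`. -/
def HasToricNormalization (Z : Set (FiberProduct X B f)) : Prop :=
  ∃ (L : Type u) (_ : Field L) (_ : Algebra k L) (V : ToricVariety L D.Lattice D.fan)
    (ν : V.X ⟶ FiberProduct X B f), D.IsToricNormalization (Z := Z) V.torus ν

/-- The normalization of `Z` is the affine toric variety with cone `C`. -/
def HasAffineToricNormalization (Z : Set (FiberProduct X B f)) (C : RealCone D.Lattice) : Prop :=
  ∃ (L : Type u) (_ : Field L) (_ : Algebra k L)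
    (ν : specMonoid L (dualMonoid C) ⟶ FiberProduct X B f),
    D.IsToricNormalization (Z := Z) (specMap L (dualMonoid C).subtype) ν

end OrbitFamily

end Orbits

end ToricFiber

open ToricFiber

/-!
The orbits of a toric variety are the locally closed tori `O_κ = Spec k[κ^⊥ ∩ M]`; in a chart, the orbit
of a point is determined by the monomials that vanish there. A toric morphism maps `O_κ` to the orbit of
the smallest cone that contains the image of `κ`. Hence the orbit of a point `x` of the fiber
product `F` is the scheme-theoretic intersection of `F` with the product of the orbits
`O_{κ i}` of its projections, and it is the fiber product of the `O_{κ i}` over an orbit `O_{κB}` of `B`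
(`exists_orbitFamily`, `widePullback_map_of_mono`).

This fiber product of tori is `Spec k[G]`, where `G` is the amalgamated sum of the character lattices
(`isIso_specFiberGroup`). A splitting `G = T ⊕ Λ`, with `T` finite and `Λ` free, gives
`k[G] = k[T] ⊗ k[Λ]`, and `k[T]` is a finite `k`-algebra. So the components, with their reduced
structure, are tori `Spec L[Λ]`, where `L` is a residue field of `k[T]`; the constants in `L` are the
images of the elements of `T` (`exists_component`).

Let `p : Spec L[Λ] → F` be the immersion of such a torus. The normalization of the closure of its image is
the normalization of `F` in `Spec L[Λ]`. It can be computed on the affine open subschemes of `F` given by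
cones `σ i ⊇ κ i` that map to a common cone `τ` of `B`. Let `C` be the fiber product of the asymptotic
cones `σ i / ℝ(κ i)`. The coordinate rings of the charts `U_{σ i}` map to `L[C^∨ ∩ Λ]`: a monomial
`χ^m` goes to a multiple of a monomial if `m ∈ (κ i)^⊥`, and to zero otherwise. The ring
`L[C^∨ ∩ Λ]` is integral over the image, because by Farkas' lemma an element of `C^∨ ∩ Λ` has a
multiple which is a sum of elements of the `(σ i)^∨ ∩ (κ i)^⊥`
(`exists_nsmul_mem_closure_of_mem_dualMonoid_fiberCone`), and it is integrally closed in
`L[Λ]`, because it is an intersection of subrings where a grading is nonnegative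
(`mem_range_of_isIntegralElem`). Therefore the affine toric variety with cone `C` is the preimage of
the chart of `F` in the normalization (`exists_normalization_chart`). These charts cover the
closure, and intersections of charts correspond to intersections of cones, so that the
charts glue to the toric variety with fan the fiber product of the fans of asymptotic cones
(`exists_toricVariety_isNormalizationOf`). The combinatorial input is that both constructions give
fans (`IsFan.asymptoticFan`, `isFan_fiberFan`). In the affine case, this fan has a largest cone.

An irreducible component of `F` is a component of the closure of the orbit of its generic point, which
gives the statement on irreducible components.
-/

namespace ToricFiber

/-! ### Duality for rational polyhedral cones -/

section Duality

variable {K : Type*} [Field K] [LinearOrder K] [IsStrictOrderedRing K]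

/-- One step of Fourier–Motzkin elimination: a system of inequalities `l * b t ≤ a t` in one
unknown `l ≥ 0` is solvable as soon as each lower bound for `l` is at most each upper bound. -/
lemma exists_nonneg_forall_mul_le {α : Type*} (T : Finset α) (a b : α → K)
    (h1 : ∀ t ∈ T, 0 ≤ b t → 0 ≤ a t)
    (h2 : ∀ t ∈ T, ∀ t' ∈ T, 0 < b t → b t' < 0 → 0 ≤ b t * a t' - b t' * a t) :
    ∃ l : K, 0 ≤ l ∧ ∀ t ∈ T, l * b t ≤ a t := by
  classical
  let E : Finset K := insert 0 ((T.filter (fun t => b t < 0)).image (fun t => a t / b t))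
  have hE : E.Nonempty := ⟨0, Finset.mem_insert_self _ _⟩
  obtain ⟨l, hl, hmax⟩ := Finset.exists_max_image E id hE
  have h0 : 0 ≤ l := hmax 0 (Finset.mem_insert_self _ _)
  refine ⟨l, h0, fun t ht => ?_⟩
  rcases lt_trichotomy (b t) 0 with hb | hb | hb
  · have h3 : a t / b t ≤ l := hmax _ (Finset.mem_insert_of_mem
      (Finset.mem_image_of_mem _ (Finset.mem_filter.2 ⟨ht, hb⟩)))
    rwa [div_le_iff_of_neg hb] at h3
  · rw [hb, mul_zero]
    exact h1 t ht hb.ge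
  · rcases Finset.mem_insert.1 hl with hl | hl
    · rw [hl, zero_mul]
      exact h1 t ht hb.le
    · obtain ⟨t', ht', rfl⟩ := Finset.mem_image.1 hl
      obtain ⟨ht', hb'⟩ := Finset.mem_filter.1 ht'
      have h3 := h2 t ht t' ht' hb hb'
      rw [div_mul_eq_mul_div, div_le_iff_of_neg hb']
      linarith

variable {B : Type*} [AddCommGroup B]

/-- The functional with values in `K` given by an integral functional. -/
def castHom (K : Type*) [Ring K] (n : B →+ ℤ) : B →+ K := (Int.castAddHom K).comp n

@[simp] lemma castHom_apply {K : Type*} [Ring K] (n : B →+ ℤ) (b : B) : castHom K n b = (n b : K) := rfl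

/-- Minkowski–Weyl with integral data: a cone generated by finitely many integral functionals is
cut out by finitely many integral inequalities. -/
lemma exists_finset_mem_hull_iff [Module.Finite ℤ B] (S : Finset (B →+ ℤ)) :
    ∃ T : Finset B, ∀ v : B →+ K,
      v ∈ PointedCone.hull K (castHom K '' (S : Set (B →+ ℤ))) ↔ ∀ t ∈ T, 0 ≤ v t := by
  classical
  induction S using Finset.induction_on with
  | empty =>
    obtain ⟨G, hG⟩ := Module.Finite.fg_top (R := ℤ) (M := B)
    refine ⟨G ∪ G.image (fun g => -g), fun v => ?_⟩
    simp only [Finset.coe_empty, Set.image_empty, PointedCone.hull, Submodule.span_empty,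
      Submodule.mem_bot]
    refine ⟨fun h => by simp [h], fun h => ?_⟩
    have h1 : ∀ g ∈ G, v g = 0 := fun g hg => le_antisymm
      (by simpa using h (-g) (Finset.mem_union_right _ (Finset.mem_image_of_mem _ hg)))
      (h g (Finset.mem_union_left _ hg))
    ext b
    have hb : b ∈ Submodule.span ℤ (G : Set B) := hG ▸ Submodule.mem_top
    induction hb using Submodule.span_induction with
    | mem x hx => exact h1 x hx
    | zero => simp
    | add x y _ _ hx hy => simp [map_add, hx, hy]
    | smul a x _ hx => simp [map_zsmul, hx]
  | insert s S _ ih =>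
    obtain ⟨T, hT⟩ := ih
    refine ⟨T.filter (fun t => 0 ≤ s t) ∪ (T ×ˢ T).image
      (fun p => if 0 < s p.1 ∧ s p.2 < 0 then s p.1 • p.2 - s p.2 • p.1 else 0), fun v => ?_⟩
    have key : v ∈ PointedCone.hull K (castHom K '' ((insert s S : Finset _) : Set (B →+ ℤ))) ↔
        ∃ l : K, 0 ≤ l ∧ ∀ t ∈ T, l * (s t : K) ≤ v t := by
      rw [Finset.coe_insert, Set.image_insert_eq, PointedCone.hull, Submodule.mem_span_insert]
      constructor
      · rintro ⟨l, z, hz, rfl⟩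
        refine ⟨l.1, l.2, fun t ht => ?_⟩
        have := (hT z).1 hz t ht
        change l.1 * (s t : K) ≤ l.1 * (s t : K) + z t
        linarith
      · rintro ⟨l, hl, h⟩
        refine ⟨⟨l, hl⟩, v - l • castHom K s, (hT _).2 fun t ht => ?_, ?_⟩
        · have := h t ht
          change 0 ≤ v t - l * (s t : K)
          linarith
        · exact (add_sub_cancel (l • castHom K s) v).symm
    rw [key]
    constructor
    · rintro ⟨l, hl, h⟩ t ht
      rcases Finset.mem_union.1 ht with ht | ht
      · obtain ⟨ht, hs⟩ := Finset.mem_filter.1 ht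
        exact (mul_nonneg hl (by exact_mod_cast hs)).trans (h t ht)
      · obtain ⟨⟨t1, t2⟩, hp, rfl⟩ := Finset.mem_image.1 ht
        obtain ⟨h1, h2⟩ := Finset.mem_product.1 hp
        dsimp only at h1 h2 ⊢
        split_ifs with hc
        · have e1 := h t1 h1
          have e2 := h t2 h2
          have c1 : (0 : K) < s t1 := by exact_mod_cast hc.1
          have c2 : (s t2 : K) < 0 := by exact_mod_cast hc.2
          rw [map_sub, map_zsmul, map_zsmul, zsmul_eq_mul, zsmul_eq_mul]
          nlinarith [mul_le_mul_of_nonneg_left e2 c1.le, mul_le_mul_of_nonpos_left e1 c2.le]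
        · simp
    · intro h
      refine exists_nonneg_forall_mul_le T _ _ (fun t ht hs => h t (Finset.mem_union_left _
        (Finset.mem_filter.2 ⟨ht, by exact_mod_cast hs⟩))) fun t ht t' ht' hs hs' => ?_
      have h3 := h _ (Finset.mem_union_right _ (Finset.mem_image_of_mem _
        (Finset.mem_product.2 (⟨ht, ht'⟩ : (t, t').1 ∈ T ∧ (t, t').2 ∈ T))))
      dsimp only at h3
      rw [if_pos ⟨by exact_mod_cast hs, by exact_mod_cast hs'⟩, map_sub, map_zsmul, map_zsmul,
        zsmul_eq_mul, zsmul_eq_mul] at h3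
      exact h3

end Duality

section Rational

variable {M : Type u} [AddCommGroup M]

/-- The evaluation map of a group into its double dual. -/
def evalHom (M : Type u) [AddCommGroup M] : M →+ ((M →+ ℤ) →+ ℤ) where
  toFun m := AddMonoidHom.eval m
  map_zero' := by ext; simp
  map_add' a b := by ext; simp

@[simp] lemma evalHom_apply (m : M) (n : M →+ ℤ) : evalHom M m n = n m := rfl

lemma eq_of_forall_hom_int [Module.Free ℤ M] {a b : M} (h : ∀ n : M →+ ℤ, n a = n b) : a = b := by
  let β := Module.Free.chooseBasis ℤ M
  refine β.ext_elem fun i => ?_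
  exact h (β.coord i).toAddMonoidHom

instance finite_hom_int [Module.Free ℤ M] [Module.Finite ℤ M] : Module.Finite ℤ (M →+ ℤ) :=
  Module.Finite.equiv (addMonoidHomLequivInt (A := M) (B := ℤ) ℤ).symm

/-- Farkas' lemma for lattices, with integral functionals: if `m` is nonnegative on all integral
functionals that are nonnegative on `T`, then a positive multiple of `m` is in the monoid
generated by `T`. -/
lemma exists_nsmul_mem_closure_of_int [Module.Free ℤ M] [Module.Finite ℤ M] (T : Finset M) (m : M)
    (h : ∀ n : M →+ ℤ, (∀ t ∈ T, 0 ≤ n t) → 0 ≤ n m) :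
    ∃ N : ℕ, 0 < N ∧ N • m ∈ AddSubmonoid.closure (T : Set M) := by
  classical
  obtain ⟨S, hS⟩ := exists_finset_mem_hull_iff (K := ℚ) (T.image (evalHom M))
  have h1 : castHom ℚ (evalHom M m) ∈ PointedCone.hull ℚ
      (castHom ℚ '' ((T.image (evalHom M) : Finset _) : Set ((M →+ ℤ) →+ ℤ))) := by
    refine (hS _).2 fun n hn => ?_
    have h2 : 0 ≤ n m := h n fun t ht => by
      have := (hS (castHom ℚ (evalHom M t))).1 (Submodule.subset_span
        ⟨_, Finset.mem_coe.2 (Finset.mem_image_of_mem _ ht), rfl⟩) n hn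
      simpa using this
    simpa using h2
  -- clear the denominators of the coefficients
  suffices H : ∀ u : (M →+ ℤ) →+ ℚ, u ∈ PointedCone.hull ℚ
      (castHom ℚ '' ((T.image (evalHom M) : Finset _) : Set ((M →+ ℤ) →+ ℤ))) →
      ∃ N : ℕ, 0 < N ∧ ∃ x ∈ AddSubmonoid.closure (T : Set M),
        (N : ℚ) • u = castHom ℚ (evalHom M x) by
    obtain ⟨N, hN, x, hx, hu⟩ := H _ h1
    refine ⟨N, hN, ?_⟩
    convert hx
    refine eq_of_forall_hom_int fun n => ?_
    have := DFunLike.congr_fun hu n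
    simp only [AddMonoidHom.smul_apply, castHom_apply, evalHom_apply, smul_eq_mul] at this
    rw [map_nsmul, nsmul_eq_mul]
    exact_mod_cast this
  intro u hu
  induction hu using Submodule.span_induction with
  | mem x hx =>
    obtain ⟨_, hy, rfl⟩ := hx
    obtain ⟨t, ht, rfl⟩ := Finset.mem_image.1 (Finset.mem_coe.1 hy)
    exact ⟨1, one_pos, t, AddSubmonoid.subset_closure ht, by simp⟩
  | zero => exact ⟨1, one_pos, 0, zero_mem _, by ext; simp⟩
  | add x y _ _ hx hy =>
    obtain ⟨N, hN, a, ha, hu⟩ := hx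
    obtain ⟨N', hN', b, hb, hv⟩ := hy
    refine ⟨N * N', Nat.mul_pos hN hN', N' • a + N • b,
      add_mem (nsmul_mem ha _) (nsmul_mem hb _), ?_⟩
    ext n
    have e1 := DFunLike.congr_fun hu n
    have e2 := DFunLike.congr_fun hv n
    simp only [AddMonoidHom.smul_apply, castHom_apply, evalHom_apply, smul_eq_mul,
      AddMonoidHom.add_apply, map_add, map_nsmul, nsmul_eq_mul] at e1 e2 ⊢
    push_cast
    rw [← e1, ← e2]
    ring
  | smul a x _ hx =>
    obtain ⟨N, hN, y, hy, hu⟩ := hx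
    refine ⟨N * a.1.den, Nat.mul_pos hN a.1.den_pos, a.1.num.toNat • y, nsmul_mem hy _, ?_⟩
    ext n
    have e1 := DFunLike.congr_fun hu n
    have e2 : (a.1.num.toNat : ℤ) = a.1.num := Int.toNat_of_nonneg (Rat.num_nonneg.2 a.2)
    have e3 : (a.1.den : ℚ) * a.1 = a.1.num := Rat.den_mul_eq_num a.1
    change ((N * a.1.den : ℕ) : ℚ) * (a.1 * x n) = ((n (a.1.num.toNat • y) : ℤ) : ℚ)
    simp only [AddMonoidHom.smul_apply, castHom_apply, evalHom_apply, smul_eq_mul] at e1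
    rw [map_nsmul, nsmul_eq_mul, e2]
    push_cast
    rw [← e1, ← e3]
    ring

/-- The cone cut out by the inequalities `t ≥ 0` for `t ∈ T`. -/
def ineqCone (T : Set M) : RealCone M where
  carrier := {v | ∀ t ∈ T, 0 ≤ v t}
  zero_mem' t _ := by simp
  add_mem' ha hb t ht := add_nonneg (ha t ht) (hb t ht)
  smul_mem' c v hv t ht := mul_nonneg c.2 (hv t ht)

lemma mem_ineqCone {T : Set M} {v : M →+ ℝ} : v ∈ ineqCone T ↔ ∀ t ∈ T, 0 ≤ v t := Iff.rfl

lemma IsRationalPolyhedral.exists_eq_ineqCone [Module.Finite ℤ M] {σ : RealCone M}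
    (hσ : IsRationalPolyhedral σ) : ∃ T : Finset M, σ = ineqCone (T : Set M) := by
  obtain ⟨S, rfl⟩ := hσ
  obtain ⟨T, hT⟩ := exists_finset_mem_hull_iff (K := ℝ) S
  exact ⟨T, SetLike.ext hT⟩

variable [Module.Free ℤ M] [Module.Finite ℤ M]

/-- Farkas' lemma for lattices: a character that is nonnegative on the cone `{T ≥ 0}` has a
positive multiple in the monoid generated by `T`. -/
lemma exists_nsmul_mem_closure (T : Finset M) (m : M)
    (h : ∀ v ∈ ineqCone (T : Set M), 0 ≤ v m) :
    ∃ N : ℕ, 0 < N ∧ N • m ∈ AddSubmonoid.closure (T : Set M) := by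
  refine exists_nsmul_mem_closure_of_int T m fun n hn => ?_
  have := h (castHom ℝ n) fun t ht => by simpa using hn t ht
  simpa using this

/-- A cone cut out by finitely many inequalities is rational polyhedral. It is generated by the
finitely many integral functionals that cut out the cone generated by the inequalities. -/
lemma isRationalPolyhedral_ineqCone (T : Finset M) : IsRationalPolyhedral (ineqCone (T : Set M)) := by
  classical
  obtain ⟨S, hS⟩ := exists_finset_mem_hull_iff (K := ℝ) (T.image (evalHom M))
  refine ⟨S, le_antisymm ?_ ?_⟩
  · obtain ⟨T', hT'⟩ := exists_finset_mem_hull_iff (K := ℝ) S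
    intro v hv
    refine (hT' v).2 fun t' ht' => ?_
    have hF : ∀ n : M →+ ℤ, (∀ t ∈ T, 0 ≤ n t) → 0 ≤ n t' := by
      intro n hn
      have h1 : castHom ℝ (evalHom M t') ∈ PointedCone.hull ℝ
          (castHom ℝ '' ((T.image (evalHom M) : Finset _) : Set ((M →+ ℤ) →+ ℤ))) := by
        refine (hS _).2 fun s hs => ?_
        exact (hT' (castHom ℝ s)).1 (Submodule.subset_span ⟨s, hs, rfl⟩) t' ht'
      have h2 : PointedCone.hull ℝ (castHom ℝ '' ((T.image (evalHom M) : Finset _) :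
          Set ((M →+ ℤ) →+ ℤ))) ≤ ineqCone {n} := by
        refine Submodule.span_le.2 ?_
        rintro _ ⟨_, hy, rfl⟩ _ rfl
        obtain ⟨t, ht, rfl⟩ := Finset.mem_image.1 (Finset.mem_coe.1 hy)
        simpa using hn t ht
      simpa using h2 h1 n rfl
    obtain ⟨N, hN, hm⟩ := exists_nsmul_mem_closure_of_int T t' hF
    have h1 : 0 ≤ v (N • t') := by
      generalize N • t' = x at hm
      induction hm using AddSubmonoid.closure_induction with
      | mem x hx => exact hv x hx
      | zero => simp
      | add x y _ _ hx hy => rw [map_add]; exact add_nonneg hx hy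
    rw [map_nsmul, nsmul_eq_mul] at h1
    exact nonneg_of_mul_nonneg_right h1 (by exact_mod_cast hN)
  · refine Submodule.span_le.2 ?_
    rintro _ ⟨s, hs, rfl⟩ t ht
    have := (hS (castHom ℝ (evalHom M t))).1 (Submodule.subset_span
      ⟨_, Finset.mem_coe.2 (Finset.mem_image_of_mem _ ht), rfl⟩) s hs
    simpa using this

end Rational

/-! ### Faces of rational polyhedral cones -/

section Faces

variable {M : Type u} [AddCommGroup M]

lemma mem_perp {κ : RealCone M} {m : M} : m ∈ perp κ ↔ ∀ v ∈ κ, v m = 0 := Iff.rfl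

lemma dualMonoid_mono {σ τ : RealCone M} (h : τ ≤ σ) : dualMonoid σ ≤ dualMonoid τ :=
  fun _ hm v hv => hm v (h hv)

lemma perp_anti {σ τ : RealCone M} (h : τ ≤ σ) : perp σ ≤ perp τ := fun _ hm v hv => hm v (h hv)

lemma perp_le_dualMonoid {σ : RealCone M} {m : M} (hm : m ∈ perp σ) : m ∈ dualMonoid σ :=
  fun v hv => (hm v hv).ge

lemma mem_dualMonoid_hull {S : Set (M →+ ℤ)} {m : M} :
    m ∈ dualMonoid (PointedCone.hull ℝ ((fun n : M →+ ℤ => (Int.castAddHom ℝ).comp n) '' S)) ↔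
      ∀ s ∈ S, 0 ≤ s m := by
  constructor
  · intro h s hs
    have : (0 : ℝ) ≤ (s m : ℝ) := h _ (Submodule.subset_span ⟨s, hs, rfl⟩)
    exact_mod_cast this
  · intro h
    have : PointedCone.hull ℝ ((fun n : M →+ ℤ => (Int.castAddHom ℝ).comp n) '' S) ≤
        ineqCone {m} := by
      refine Submodule.span_le.2 ?_
      rintro _ ⟨s, hs, rfl⟩ _ rfl
      exact Int.cast_nonneg (h s hs)
    exact fun v hv => this hv m rfl

variable [Module.Finite ℤ M]

omit [Module.Finite ℤ M] in
/-- The sum of the generators is in the relative interior. -/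
lemma IsRationalPolyhedral.exists_relInterior {σ : RealCone M} (hσ : IsRationalPolyhedral σ) :
    ∃ v ∈ σ, ∀ m ∈ dualMonoid σ, v m = 0 → m ∈ perp σ := by
  obtain ⟨S, rfl⟩ := hσ
  refine ⟨∑ s ∈ S, castHom ℝ s, sum_mem fun s hs => Submodule.subset_span ⟨s, hs, rfl⟩,
    fun m hm h0 => ?_⟩
  have h1 : ∀ s ∈ S, 0 ≤ castHom ℝ s m := fun s hs =>
    hm _ (Submodule.subset_span ⟨s, hs, rfl⟩)
  rw [AddMonoidHom.finsetSum_apply, Finset.sum_eq_zero_iff_of_nonneg h1] at h0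
  intro v hv
  refine le_antisymm ?_ (hm v hv)
  have h2 : -m ∈ dualMonoid (PointedCone.hull ℝ
      ((fun n : M →+ ℤ => (Int.castAddHom ℝ).comp n) '' (S : Set (M →+ ℤ)))) := by
    refine mem_dualMonoid_hull.2 fun s hs => ?_
    have := h0 s hs
    rw [castHom_apply, Int.cast_eq_zero] at this
    simp [this]
  simpa using h2 v hv

/-- For a point `w` in the relative interior of `κ`, a functional `v` that vanishes on `κ^⊥`
can be moved into `κ` by a multiple of `w`. -/
lemma IsRationalPolyhedral.exists_add_nsmul_mem {κ : RealCone M} (hκ : IsRationalPolyhedral κ)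
    {w : M →+ ℝ} (hw : w ∈ κ) (hw' : ∀ m ∈ dualMonoid κ, w m = 0 → m ∈ perp κ)
    {v : M →+ ℝ} (hv : ∀ m ∈ perp κ, v m = 0) : ∃ N : ℕ, v + N • w ∈ κ := by
  obtain ⟨T, rfl⟩ := hκ.exists_eq_ineqCone
  have h1 : ∀ t ∈ T, ∀ᶠ N : ℕ in Filter.atTop, 0 ≤ (v + N • w) t := by
    intro t ht
    have ht' : t ∈ dualMonoid (ineqCone (T : Set M)) := fun v hv => hv t ht
    by_cases h0 : w t = 0
    · refine Filter.Eventually.of_forall fun N => ?_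
      simp [h0, hv t (hw' t ht' h0)]
    · have hpos : 0 < w t := lt_of_le_of_ne (ht' w hw) (Ne.symm h0)
      filter_upwards [Filter.eventually_ge_atTop ⌈-v t / w t⌉₊] with N hN
      have h2 : -v t / w t ≤ N := (Nat.le_ceil _).trans (by exact_mod_cast hN)
      rw [div_le_iff₀ hpos] at h2
      simp only [AddMonoidHom.add_apply, AddMonoidHom.nsmul_apply, nsmul_eq_mul]
      linarith
  obtain ⟨N, hN⟩ := ((Finset.eventually_all T).2 h1).exists
  exact ⟨N, hN⟩

/-- A functional that vanishes on `κ^⊥` is in the linear span of `κ`. -/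
lemma IsRationalPolyhedral.exists_sub_eq {κ : RealCone M} (hκ : IsRationalPolyhedral κ)
    {v : M →+ ℝ} (hv : ∀ m ∈ perp κ, v m = 0) : ∃ a ∈ κ, ∃ b ∈ κ, v = a - b := by
  obtain ⟨w, hw, hw'⟩ := hκ.exists_relInterior
  obtain ⟨N, hN⟩ := hκ.exists_add_nsmul_mem hw hw' hv
  exact ⟨_, hN, N • w, nsmul_mem hw N, by abel⟩

/-- Faces are exposed by characters: a face `τ` of `σ` is cut out by the equation `m = 0`,
for some `m` in `σ^∨ ∩ τ^⊥`. -/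
lemma IsRationalPolyhedral.exists_exposing {σ τ : RealCone M} (hσ : IsRationalPolyhedral σ)
    (h : τ.IsFaceOf σ) :
    ∃ m ∈ dualMonoid σ, m ∈ perp τ ∧ ∀ v ∈ σ, v m = 0 → v ∈ τ := by
  classical
  obtain ⟨T, rfl⟩ := hσ.exists_eq_ineqCone
  have hT : ∀ t ∈ T, t ∈ dualMonoid (ineqCone (T : Set M)) := fun t ht v hv => hv t ht
  have h1 : ∀ t : M, ∃ v ∈ τ, t ∉ perp τ → v t ≠ 0 := by
    intro t
    by_cases ht : t ∈ perp τ
    · exact ⟨0, zero_mem _, fun h => absurd ht h⟩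
    · simp only [mem_perp, not_forall] at ht
      obtain ⟨v, hv, hvt⟩ := ht
      exact ⟨v, hv, fun _ => hvt⟩
  choose w hw hw' using h1
  refine ⟨∑ t ∈ T.filter (· ∈ perp τ), t, sum_mem fun t ht => hT t (Finset.mem_filter.1 ht).1,
    sum_mem fun t ht => (Finset.mem_filter.1 ht).2, fun v hv h0 => ?_⟩
  rw [map_sum, Finset.sum_eq_zero_iff_of_nonneg
    (fun t ht => hT t (Finset.mem_filter.1 ht).1 v hv)] at h0
  have hW : ∑ t ∈ T, w t ∈ τ := sum_mem fun t _ => hw t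
  have h2 : ∀ t ∈ T, ∀ᶠ N : ℕ in Filter.atTop, 0 ≤ (N • (∑ t ∈ T, w t) - v) t := by
    intro t ht
    by_cases htp : t ∈ perp τ
    · refine Filter.Eventually.of_forall fun N => ?_
      have e1 : v t = 0 := h0 t (Finset.mem_filter.2 ⟨ht, htp⟩)
      have e2 := htp _ hW
      simp [e1, e2]
    · have hpos : 0 < (∑ t ∈ T, w t) t := by
        rw [AddMonoidHom.finsetSum_apply]
        exact Finset.sum_pos' (fun s _ => hT t ht _ (h.le (hw s)))
          ⟨t, ht, lt_of_le_of_ne (hT t ht _ (h.le (hw t))) (Ne.symm (hw' t htp))⟩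
      filter_upwards [Filter.eventually_ge_atTop ⌈v t / (∑ t ∈ T, w t) t⌉₊] with N hN
      have h2 : v t / (∑ t ∈ T, w t) t ≤ N := (Nat.le_ceil _).trans (by exact_mod_cast hN)
      rw [div_le_iff₀ hpos] at h2
      rw [AddMonoidHom.sub_apply, AddMonoidHom.nsmul_apply, nsmul_eq_mul]
      linarith
  obtain ⟨N, hN⟩ := ((Finset.eventually_all T).2 h2).exists
  refine h.mem_of_add_mem_right (x := N • (∑ t ∈ T, w t) - v) hN hv ?_
  rw [sub_add_cancel]
  exact nsmul_mem hW N

omit [Module.Finite ℤ M] in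
/-- If `m₀ ≥ 0` exposes the face `τ` of `σ`, then the characters that are nonnegative on `τ` become
nonnegative on `σ` after adding a multiple of `m₀`. -/
lemma IsRationalPolyhedral.exists_add_nsmul_mem_dualMonoid {σ τ : RealCone M}
    (hσ : IsRationalPolyhedral σ) {m₀ : M} (h0 : m₀ ∈ dualMonoid σ)
    (hm₀ : ∀ v ∈ σ, v m₀ = 0 → v ∈ τ) {m : M} (hm : m ∈ dualMonoid τ) :
    ∃ N : ℕ, m + N • m₀ ∈ dualMonoid σ := by
  obtain ⟨S, rfl⟩ := hσ
  have h1 : ∀ s ∈ S, ∀ᶠ N : ℕ in Filter.atTop, 0 ≤ s (m + N • m₀) := by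
    intro s hs
    have hs' : castHom ℝ s ∈ PointedCone.hull ℝ
        ((fun n : M →+ ℤ => (Int.castAddHom ℝ).comp n) '' (S : Set (M →+ ℤ))) :=
      Submodule.subset_span ⟨s, hs, rfl⟩
    by_cases h2 : s m₀ = 0
    · refine Filter.Eventually.of_forall fun N => ?_
      have : (0 : ℝ) ≤ (s m : ℝ) := hm _ (hm₀ _ hs' (by simp [h2]))
      have : 0 ≤ s m := by exact_mod_cast this
      simpa [h2] using this
    · have h3 : 0 ≤ s m₀ := mem_dualMonoid_hull.1 h0 s hs
      filter_upwards [Filter.eventually_ge_atTop (s m).natAbs] with N hN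
      have h4 : 1 ≤ s m₀ := by omega
      rw [map_add, map_nsmul, nsmul_eq_mul]
      have h5 : (N : ℤ) ≤ N * s m₀ := by nlinarith
      omega
  obtain ⟨N, hN⟩ := ((Finset.eventually_all S).2 h1).exists
  exact ⟨N, mem_dualMonoid_hull.2 hN⟩

lemma IsRationalPolyhedral.exists_add_nsmul_mem_dualMonoid_of_isFaceOf {σ τ : RealCone M}
    (hσ : IsRationalPolyhedral σ) (h : τ.IsFaceOf σ) :
    ∃ m₀ ∈ dualMonoid σ, m₀ ∈ perp τ ∧ (∀ v ∈ σ, v m₀ = 0 → v ∈ τ) ∧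
      ∀ m ∈ dualMonoid τ, ∃ N : ℕ, m + N • m₀ ∈ dualMonoid σ := by
  obtain ⟨m₀, h1, h2, h3⟩ := hσ.exists_exposing h
  exact ⟨m₀, h1, h2, h3, fun m hm => hσ.exists_add_nsmul_mem_dualMonoid h1 h3 hm⟩

omit [Module.Finite ℤ M] in
/-- The subset of a cone where a set of nonnegative characters vanishes is a face. -/
lemma exists_isFaceOf_mem_iff {σ : RealCone M} {A : Set M} (hA : A ⊆ dualMonoid σ) :
    ∃ τ : RealCone M, τ.IsFaceOf σ ∧ ∀ v, v ∈ τ ↔ v ∈ σ ∧ ∀ m ∈ A, v m = 0 := by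
  refine ⟨{ carrier := {v | v ∈ σ ∧ ∀ m ∈ A, v m = 0}
            zero_mem' := ⟨zero_mem _, fun m _ => by simp⟩
            add_mem' := fun ha hb => ⟨add_mem ha.1 hb.1, fun m hm => by
              rw [AddMonoidHom.add_apply, ha.2 m hm, hb.2 m hm, add_zero]⟩
            smul_mem' := fun c v hv => ⟨Submodule.smul_mem _ c hv.1, fun m hm => by
              change c.1 * v m = 0
              rw [hv.2 m hm, mul_zero]⟩ }, ?_, fun v => Iff.rfl⟩
  refine PointedCone.IsFaceOf.of_mem_of_add_mem_left (fun v hv => hv.1) ?_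
  intro x y hx hy hxy
  refine ⟨hx, fun m hm => ?_⟩
  have h1 := hxy.2 m hm
  have h2 := hA hm x hx
  have h3 := hA hm y hy
  rw [AddMonoidHom.add_apply] at h1
  linarith

omit [Module.Finite ℤ M] in
/-- Faces of the monoid `σ^∨ ∩ M` correspond to faces of `σ`. -/
lemma IsRationalPolyhedral.exists_isFaceOf_of_addSubmonoid {σ : RealCone M}
    (hσ : IsRationalPolyhedral σ) (A : Set M) (hA : A ⊆ dualMonoid σ) (h0 : (0 : M) ∈ A)
    (hadd : ∀ a ∈ dualMonoid σ, ∀ b ∈ dualMonoid σ, a + b ∈ A ↔ a ∈ A ∧ b ∈ A) :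
    ∃ τ : RealCone M, τ.IsFaceOf σ ∧ ∀ m ∈ dualMonoid σ, m ∈ perp τ ↔ m ∈ A := by
  classical
  obtain ⟨τ, hτ, hmem⟩ := exists_isFaceOf_mem_iff hA
  refine ⟨τ, hτ, fun m hm => ⟨fun hmτ => ?_, fun hmA v hv => ((hmem v).1 hv).2 m hmA⟩⟩
  obtain ⟨S, rfl⟩ := hσ
  have hsum : ∀ (I : Finset (M →+ ℤ)) (f : (M →+ ℤ) → M), (∀ i, f i ∈ A) →
      ∑ i ∈ I, f i ∈ A := by
    intro I f hf
    induction I using Finset.induction_on with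
    | empty => simpa using h0
    | insert i I hi ih =>
      rw [Finset.sum_insert hi]
      exact (hadd _ (hA (hf i)) _ (hA ih)).2 ⟨hf i, ih⟩
  have h1 : ∀ s : M →+ ℤ, ∃ a ∈ A, (∃ a ∈ A, s a ≠ 0) → s a ≠ 0 := by
    intro s
    by_cases hs : ∃ a ∈ A, s a ≠ 0
    · obtain ⟨a, ha, hsa⟩ := hs
      exact ⟨a, ha, fun _ => hsa⟩
    · exact ⟨0, h0, fun h => absurd h hs⟩
  choose a ha ha' using h1
  set a₀ := ∑ s ∈ S, a s with ha₀
  have ha₀A : a₀ ∈ A := hsum S a ha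
  have hpos : ∀ s ∈ S, ∀ b ∈ A, 0 ≤ s b := fun s hs b hb => mem_dualMonoid_hull.1 (hA hb) s hs
  have h2 : ∀ s ∈ S, ∀ᶠ N : ℕ in Filter.atTop, 0 ≤ s (N • a₀ - m) := by
    intro s hs
    by_cases h3 : ∃ b ∈ A, s b ≠ 0
    · have h4 : 0 < s a₀ := by
        rw [ha₀, map_sum]
        exact Finset.sum_pos' (fun i _ => hpos s hs _ (ha i))
          ⟨s, hs, lt_of_le_of_ne (hpos s hs _ (ha s)) (Ne.symm (ha' s h3))⟩
      filter_upwards [Filter.eventually_ge_atTop (s m).natAbs] with N hN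
      rw [map_sub, map_nsmul, nsmul_eq_mul]
      have h5 : (N : ℤ) ≤ N * s a₀ := by nlinarith
      omega
    · push Not at h3
      have h4 : castHom ℝ s ∈ τ := (hmem _).2 ⟨Submodule.subset_span ⟨s, hs, rfl⟩,
        fun b hb => by simp [h3 b hb]⟩
      have h5 := hmτ _ h4
      rw [castHom_apply, Int.cast_eq_zero] at h5
      refine Filter.Eventually.of_forall fun N => ?_
      simp [h3 a₀ ha₀A, h5]
  obtain ⟨N, hN⟩ := ((Finset.eventually_all S).2 h2).exists
  have h3 : N • a₀ ∈ A := by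
    clear hN
    induction N with
    | zero => simpa using h0
    | succ N ih => rw [succ_nsmul]; exact (hadd _ (hA ih) _ (hA ha₀A)).2 ⟨ih, ha₀A⟩
  have h4 := (hadd m hm (N • a₀ - m) (mem_dualMonoid_hull.2 hN)).1 (by
    rw [add_sub_cancel]; exact h3)
  exact h4.1

end Faces

/-! ### Operations on rational polyhedral cones -/

section Operations

variable {M M' : Type u} [AddCommGroup M] [AddCommGroup M']

lemma IsRationalPolyhedral.map {σ : RealCone M'} (hσ : IsRationalPolyhedral σ) (φ : M →+ M') :
    IsRationalPolyhedral (PointedCone.map (pull φ) σ) := by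
  classical
  obtain ⟨S, rfl⟩ := hσ
  refine ⟨S.image (fun s => s.comp φ), ?_⟩
  rw [PointedCone.map, PointedCone.hull, Submodule.map_span, Finset.coe_image, Set.image_image,
    Set.image_image]
  rfl

variable [Module.Free ℤ M] [Module.Finite ℤ M]

lemma IsRationalPolyhedral.iInf_comap {ι : Type*} [Finite ι] {N : ι → Type u}
    [∀ i, AddCommGroup (N i)] [∀ i, Module.Finite ℤ (N i)] {σ : ∀ i, RealCone (N i)}
    (hσ : ∀ i, IsRationalPolyhedral (σ i)) (ψ : ∀ i, N i →+ M) :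
    IsRationalPolyhedral (⨅ i, PointedCone.comap (pull (ψ i)) (σ i)) := by
  classical
  have := Fintype.ofFinite ι
  choose T hT using fun i => (hσ i).exists_eq_ineqCone
  have h1 : (⨅ i, PointedCone.comap (pull (ψ i)) (σ i)) =
      ineqCone ((Finset.univ.biUnion fun i => (T i).image (ψ i) : Finset M) : Set M) := by
    ext v
    simp only [Submodule.mem_iInf, PointedCone.mem_comap, mem_ineqCone, Finset.coe_biUnion,
      Finset.coe_image, Set.mem_iUnion, Set.mem_image]
    constructor
    · rintro h _ ⟨i, _, t, ht, rfl⟩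
      have := h i
      rw [hT i] at this
      exact this t ht
    · intro h i
      rw [hT i]
      exact fun t ht => h _ ⟨i, Finset.mem_coe.2 (Finset.mem_univ i), t, ht, rfl⟩
  rw [h1]
  exact isRationalPolyhedral_ineqCone _

end Operations

/-! ### Lattices -/

section Lattices

variable {M : Type u} [AddCommGroup M]

instance perp_finite [Module.Finite ℤ M] (κ : RealCone M) : Module.Finite ℤ (perp κ) :=
  inferInstanceAs (Module.Finite ℤ (AddSubgroup.toIntSubmodule (perp κ)))

/-- The lattice `κ^⊥` is a direct summand. -/
lemma exists_retraction_perp [Module.Finite ℤ M] (κ : RealCone M) :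
    ∃ r : M →+ perp κ, ∀ m : perp κ, r m = m := by
  let P := AddSubgroup.toIntSubmodule (perp κ)
  have : IsAddTorsionFree (M ⧸ P) := by
    refine ⟨fun n hn x y hxy => ?_⟩
    obtain ⟨x, rfl⟩ := Submodule.mkQ_surjective P x
    obtain ⟨y, rfl⟩ := Submodule.mkQ_surjective P y
    have h1 : P.mkQ (n • (x - y)) = 0 := by
      rw [map_nsmul, map_sub, nsmul_sub, sub_eq_zero]
      exact hxy
    have h2 : n • (x - y) ∈ perp κ := (Submodule.Quotient.mk_eq_zero P).1 h1
    rw [← sub_eq_zero, ← map_sub]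
    refine (Submodule.Quotient.mk_eq_zero P).2 fun v hv => ?_
    have := h2 v hv
    rw [map_nsmul, nsmul_eq_mul, mul_eq_zero] at this
    exact this.resolve_left (by exact_mod_cast hn)
  have : Module.Free ℤ (M ⧸ P) := inferInstance
  obtain ⟨s, hs⟩ := Module.projective_lifting_property P.mkQ LinearMap.id
    (Submodule.mkQ_surjective P)
  let r : M →+ M := AddMonoidHom.id M - (s ∘ₗ P.mkQ).toAddMonoidHom
  have hr : ∀ m, r m = m - s (P.mkQ m) := fun m => rfl
  refine ⟨r.codRestrict (perp κ) fun m => ?_, fun m => Subtype.ext ?_⟩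
  · have h1 := LinearMap.congr_fun hs (P.mkQ m)
    simp only [LinearMap.comp_apply, LinearMap.id_apply] at h1
    refine (Submodule.Quotient.mk_eq_zero P).1 ?_
    rw [← Submodule.mkQ_apply, hr, map_sub, h1, sub_self]
  · have h1 : P.mkQ (m : M) = 0 := (Submodule.Quotient.mk_eq_zero P).2 m.2
    change r m = m
    rw [hr, h1, map_zero, sub_zero]

variable {ι : Type} {N : ι → Type u} {MB : Type u} [∀ i, AddCommGroup (N i)] [AddCommGroup MB]
  (φ : ∀ i, MB →+ N i)

instance fiberGroup_finite [Finite ι] [∀ i, Module.Finite ℤ (N i)] :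
    Module.Finite ℤ (FiberGroup φ) :=
  Module.Finite.of_surjective
    ((QuotientAddGroup.mk' _ : (∀ i, N i) →+ FiberGroup φ).toIntLinearMap)
    (QuotientAddGroup.mk'_surjective _ : Function.Surjective (QuotientAddGroup.mk' _))

instance fiberLattice_finite [Finite ι] [∀ i, Module.Finite ℤ (N i)] :
    Module.Finite ℤ (FiberLattice φ) :=
  Module.Finite.of_surjective (((QuotientAddGroup.mk' (AddCommGroup.torsion (FiberGroup φ))).comp
    (QuotientAddGroup.mk' _)).toIntLinearMap)
    ((QuotientAddGroup.mk'_surjective _).comp (QuotientAddGroup.mk'_surjective _))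

instance fiberLattice_free [Finite ι] [∀ i, Module.Finite ℤ (N i)] :
    Module.Free ℤ (FiberLattice φ) := by
  have : IsAddTorsionFree (FiberLattice φ) := inferInstance
  infer_instance

open Classical in
/-- The map from the `i`-th group to the amalgamated sum. -/
noncomputable def fiberSingle (i : ι) : N i →+ FiberGroup φ :=
  (QuotientAddGroup.mk' _).comp (AddMonoidHom.single N i)

lemma fiberIncl_apply (i : ι) (m : N i) :
    fiberIncl φ i m = QuotientAddGroup.mk' (AddCommGroup.torsion (FiberGroup φ))
      (fiberSingle φ i m) := rfl

lemma fiberSingle_comp (i j : ι) (m : MB) :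
    fiberSingle φ i (φ i m) = fiberSingle φ j (φ j m) := by
  classical
  refine (QuotientAddGroup.eq_iff_sub_mem).2 (AddSubgroup.subset_closure ⟨i, j, m, ?_⟩)
  simp only [AddMonoidHom.single_apply]

lemma fiberIncl_comp (i j : ι) (m : MB) :
    fiberIncl φ i (φ i m) = fiberIncl φ j (φ j m) := by
  rw [fiberIncl_apply, fiberIncl_apply, fiberSingle_comp φ i j]

variable [Finite ι]

lemma fiberGroup_induction {p : FiberGroup φ → Prop} (h : ∀ i m, p (fiberSingle φ i m))
    (hadd : ∀ a b, p a → p b → p (a + b)) (h0 : p 0) (g : FiberGroup φ) : p g := by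
  classical
  have := Fintype.ofFinite ι
  obtain ⟨x, rfl⟩ := QuotientAddGroup.mk'_surjective _ g
  rw [← Finset.univ_sum_single x, map_sum]
  refine Finset.sum_induction _ p hadd h0 fun i _ => ?_
  convert h i (x i)
  simp only [fiberSingle, AddMonoidHom.comp_apply, AddMonoidHom.single_apply]

lemma fiberGroup_hom_ext {A : Type*} [AddMonoid A] {f g : FiberGroup φ →+ A}
    (h : ∀ i m, f (fiberSingle φ i m) = g (fiberSingle φ i m)) : f = g := by
  refine DFunLike.ext _ _ fun x => ?_
  induction x using fiberGroup_induction φ with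
  | h i m => exact h i m
  | hadd a b ha hb => rw [map_add, map_add, ha, hb]
  | h0 => rw [map_zero, map_zero]

lemma fiberLattice_hom_ext {A : Type*} [AddMonoid A] {f g : FiberLattice φ →+ A}
    (h : ∀ i m, f (fiberIncl φ i m) = g (fiberIncl φ i m)) : f = g := by
  have h1 : f.comp (QuotientAddGroup.mk' _) = g.comp (QuotientAddGroup.mk' _) :=
    fiberGroup_hom_ext φ h
  refine DFunLike.ext _ _ fun x => ?_
  obtain ⟨x, rfl⟩ := QuotientAddGroup.mk'_surjective _ x
  exact DFunLike.congr_fun h1 x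

/-- A compatible family of homomorphisms extends to the amalgamated sum. -/
lemma exists_fiberGroup_hom {A : Type*} [AddCommGroup A] (v : ∀ i, N i →+ A)
    (h : ∀ i j m, v i (φ i m) = v j (φ j m)) :
    ∃ w : FiberGroup φ →+ A, ∀ i m, w (fiberSingle φ i m) = v i m := by
  classical
  have := Fintype.ofFinite ι
  have key : ∀ i (m : N i), ∑ j, v j (Pi.single (M := N) i m j) = v i m := by
    intro i m
    rw [Finset.sum_eq_single i]
    · simp
    · intro j _ hj
      simp [Pi.single_eq_of_ne hj]
    · simp
  let W : (∀ i, N i) →+ A := ∑ i, (v i).comp (Pi.evalAddMonoidHom N i)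
  have hW : ∀ i (m : N i), W (Pi.single i m) = v i m := by
    intro i m
    simp only [W, AddMonoidHom.finsetSum_apply, AddMonoidHom.comp_apply, Pi.evalAddMonoidHom_apply]
    exact key i m
  refine ⟨QuotientAddGroup.lift _ W ?_, fun i m => ?_⟩
  · rw [AddSubgroup.closure_le]
    rintro _ ⟨i, j, m, rfl⟩
    change W _ = 0
    rw [map_sub, sub_eq_zero]
    convert h i j m using 1
    · rw [← hW]
    · rw [← hW]
  · change W _ = _
    rw [← hW]
    simp only [AddMonoidHom.single_apply]

/-- A compatible family of homomorphisms to a torsion-free group extends to the amalgamated sum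
modulo torsion. -/
lemma exists_fiberLattice_hom {A : Type*} [AddCommGroup A] [IsAddTorsionFree A] (v : ∀ i, N i →+ A)
    (h : ∀ i j m, v i (φ i m) = v j (φ j m)) :
    ∃ w : FiberLattice φ →+ A, ∀ i m, w (fiberIncl φ i m) = v i m := by
  obtain ⟨w, hw⟩ := exists_fiberGroup_hom φ v h
  refine ⟨QuotientAddGroup.lift _ w fun x hx => ?_, fun i m => hw i m⟩
  obtain ⟨n, hn, hx⟩ := isOfFinAddOrder_iff_nsmul_eq_zero.1 hx
  have := congrArg w hx
  rw [map_nsmul, map_zero] at this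
  exact (nsmul_eq_zero_iff.1 this).resolve_right hn.ne'

end Lattices

/-! ### Fans of asymptotic cones and fiber products of fans -/

section Fans

variable {M : Type u} [AddCommGroup M] {Δ : Set (RealCone M)}

lemma IsFan.isFaceOf (hΔ : IsFan Δ) {σ τ : RealCone M} (hσ : σ ∈ Δ) (hτ : τ ∈ Δ) (h : τ ≤ σ) :
    τ.IsFaceOf σ := by
  have := hΔ.inter_face σ hσ τ hτ
  rwa [inf_eq_right.2 h] at this

lemma IsFan.inf_mem (hΔ : IsFan Δ) {σ τ : RealCone M} (hσ : σ ∈ Δ) (hτ : τ ∈ Δ) : σ ⊓ τ ∈ Δ :=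
  hΔ.face_mem σ hσ _ (hΔ.inter_face σ hσ τ hτ)

lemma mem_asymptoticCone {σ κ : RealCone M} {u : perp κ →+ ℝ} :
    u ∈ asymptoticCone σ κ ↔ ∃ v ∈ σ, ∀ m : perp κ, v m = u m := by
  constructor
  · rintro ⟨v, hv, rfl⟩
    exact ⟨v, hv, fun m => rfl⟩
  · rintro ⟨v, hv, h⟩
    exact ⟨v, hv, by ext m; exact h m⟩

lemma mem_dualMonoid_asymptoticCone {σ κ : RealCone M} {m : perp κ} :
    m ∈ dualMonoid (asymptoticCone σ κ) ↔ (m : M) ∈ dualMonoid σ := by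
  constructor
  · intro h v hv
    exact h _ ⟨v, hv, rfl⟩
  · rintro h _ ⟨v, hv, rfl⟩
    exact h v hv

lemma asymptoticCone_mono {σ τ κ : RealCone M} (h : σ ≤ τ) :
    asymptoticCone σ κ ≤ asymptoticCone τ κ := Submodule.map_mono h

variable [Module.Finite ℤ M]

lemma asymptoticCone_inf {σ τ κ : RealCone M} (hκ : IsRationalPolyhedral κ) (h1 : κ ≤ σ)
    (h2 : κ ≤ τ) : asymptoticCone σ κ ⊓ asymptoticCone τ κ = asymptoticCone (σ ⊓ τ) κ := by
  refine le_antisymm ?_ (le_inf (asymptoticCone_mono inf_le_left) (asymptoticCone_mono inf_le_right))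
  rintro u ⟨hu1, hu2⟩
  obtain ⟨v, hv, hvu⟩ := mem_asymptoticCone.1 hu1
  obtain ⟨w, hw, hwu⟩ := mem_asymptoticCone.1 hu2
  obtain ⟨a, ha, b, hb, hab⟩ := hκ.exists_sub_eq (v := v - w) fun m hm => by
    rw [AddMonoidHom.sub_apply, hvu ⟨m, hm⟩, hwu ⟨m, hm⟩, sub_self]
  refine mem_asymptoticCone.2 ⟨v + b, ⟨add_mem hv (h1 hb), ?_⟩, fun m => ?_⟩
  · have : v + b = w + a := by
      rw [sub_eq_sub_iff_add_eq_add] at hab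
      rw [hab, add_comm]
    rw [this]
    exact add_mem hw (h2 ha)
  · rw [AddMonoidHom.add_apply, m.2 b hb, add_zero, hvu]

lemma isFaceOf_asymptoticCone {σ τ κ : RealCone M} (hκ : IsRationalPolyhedral κ) (h1 : κ ≤ τ)
    (h2 : τ.IsFaceOf σ) : (asymptoticCone τ κ).IsFaceOf (asymptoticCone σ κ) := by
  refine PointedCone.IsFaceOf.of_mem_of_add_mem_left (asymptoticCone_mono h2.le) ?_
  intro x y hx hy hxy
  obtain ⟨v, hv, hvx⟩ := mem_asymptoticCone.1 hx
  obtain ⟨w, hw, hwy⟩ := mem_asymptoticCone.1 hy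
  obtain ⟨z, hz, hzz⟩ := mem_asymptoticCone.1 hxy
  obtain ⟨a, ha, b, hb, hab⟩ := hκ.exists_sub_eq (v := v + w - z) fun m hm => by
    rw [AddMonoidHom.sub_apply, AddMonoidHom.add_apply, hvx ⟨m, hm⟩, hwy ⟨m, hm⟩, hzz ⟨m, hm⟩,
      AddMonoidHom.add_apply, sub_self]
  refine mem_asymptoticCone.2 ⟨v, ?_, hvx⟩
  refine h2.mem_of_add_mem_left hv (add_mem hw (h2.le (h1 hb))) ?_
  have : v + (w + b) = z + a := by
    rw [sub_eq_sub_iff_add_eq_add] at hab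
    rw [← add_assoc, hab, add_comm]
  rw [this]
  exact add_mem hz (h1 ha)

lemma asymptoticCone_pointed {σ κ : RealCone M} (hσ : IsRationalPolyhedral σ)
    (h : κ.IsFaceOf σ) {u : perp κ →+ ℝ} (hu : u ∈ asymptoticCone σ κ)
    (hu' : -u ∈ asymptoticCone σ κ) : u = 0 := by
  obtain ⟨v, hv, hvu⟩ := mem_asymptoticCone.1 hu
  obtain ⟨w, hw, hwu⟩ := mem_asymptoticCone.1 hu'
  obtain ⟨m₀, -, h0, hm₀⟩ := hσ.exists_exposing h
  have h1 : v + w ∈ κ := hm₀ _ (add_mem hv hw) (by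
    rw [AddMonoidHom.add_apply, hvu ⟨m₀, h0⟩, hwu ⟨m₀, h0⟩, AddMonoidHom.neg_apply,
      add_neg_cancel])
  have h2 := h.mem_of_add_mem_left hv hw h1
  ext m
  rw [← hvu, m.2 v h2, AddMonoidHom.zero_apply]

/-- The cones `σ / ℝκ`, for `κ ≤ σ ∈ Δ`, form a fan. -/
lemma IsFan.asymptoticFan (hΔ : IsFan Δ) {κ : RealCone M} (hκ : κ ∈ Δ) :
    IsFan (asymptoticFan Δ κ) where
  finite := by
    refine (hΔ.finite.image (fun σ => asymptoticCone σ κ)).subset ?_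
    rintro _ ⟨σ, hσ, _, rfl⟩
    exact ⟨σ, hσ, rfl⟩
  bot_mem := by
    refine ⟨κ, hκ, le_rfl, ?_⟩
    refine (eq_bot_iff.2 ?_).symm
    rintro _ ⟨v, hv, rfl⟩
    refine (Submodule.mem_bot _).2 ?_
    ext m
    exact m.2 v hv
  polyhedral := by
    rintro _ ⟨σ, hσ, _, rfl⟩
    exact (hΔ.polyhedral σ hσ).map _
  strictlyConvex := by
    rintro _ ⟨σ, hσ, h, rfl⟩ v hv hv'
    exact asymptoticCone_pointed (hΔ.polyhedral σ hσ) (hΔ.isFaceOf hσ hκ h) hv hv'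
  face_mem := by
    rintro _ ⟨σ, hσ, h, rfl⟩ τ hτ
    have hface : (σ ⊓ PointedCone.comap (pull (perp κ).subtype) τ).IsFaceOf σ := by
      refine PointedCone.IsFaceOf.of_mem_of_add_mem_left inf_le_left ?_
      rintro x y hx hy ⟨-, hxy⟩
      rw [SetLike.mem_coe, PointedCone.mem_comap, map_add] at hxy
      exact ⟨hx, hτ.mem_of_add_mem_left ⟨x, hx, rfl⟩ ⟨y, hy, rfl⟩ hxy⟩
    refine ⟨_, hΔ.face_mem σ hσ _ hface, le_inf h ?_, ?_⟩
    · intro v hv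
      have : pull (perp κ).subtype v = 0 := by
        ext m
        exact m.2 v hv
      rw [PointedCone.mem_comap, this]
      exact zero_mem _
    · refine le_antisymm ?_ ?_
      · intro u hu
        obtain ⟨v, hv, rfl⟩ := hτ.le hu
        exact ⟨v, ⟨hv, hu⟩, rfl⟩
      · rintro _ ⟨v, hv, rfl⟩
        exact hv.2
  inter_face := by
    rintro _ ⟨σ, hσ, h, rfl⟩ _ ⟨τ, hτ, h', rfl⟩
    rw [asymptoticCone_inf (hΔ.polyhedral κ hκ) h h']
    exact isFaceOf_asymptoticCone (hΔ.polyhedral κ hκ) (le_inf h h') (hΔ.inter_face σ hσ τ hτ)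

variable {ι : Type} {N : ι → Type u} {MB : Type u} [∀ i, AddCommGroup (N i)] [AddCommGroup MB]
  {φ : ∀ i, MB →+ N i} {Φ : ∀ i, Set (RealCone (N i))} {ΦB : Set (RealCone MB)}

lemma mem_fiberCone {σ : ∀ i, RealCone (N i)} {w : FiberLattice φ →+ ℝ} :
    w ∈ fiberCone φ σ ↔ ∀ i, pull (fiberIncl φ i) w ∈ σ i := by
  simp [fiberCone, Submodule.mem_iInf]

lemma fiberCone_inf (σ τ : ∀ i, RealCone (N i)) :
    fiberCone φ σ ⊓ fiberCone φ τ = fiberCone φ (fun i => σ i ⊓ τ i) := by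
  ext w
  simp only [Submodule.mem_inf, mem_fiberCone]
  exact forall_and.symm

lemma isFaceOf_fiberCone {σ τ : ∀ i, RealCone (N i)} (h : ∀ i, (τ i).IsFaceOf (σ i)) :
    (fiberCone φ τ).IsFaceOf (fiberCone φ σ) := by
  refine PointedCone.IsFaceOf.of_mem_of_add_mem_left
    (fun w hw => mem_fiberCone.2 fun i => (h i).le (mem_fiberCone.1 hw i)) ?_
  intro x y hx hy hxy
  refine mem_fiberCone.2 fun i => (h i).mem_of_add_mem_left (mem_fiberCone.1 hx i)
    (mem_fiberCone.1 hy i) ?_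
  rw [← map_add]
  exact mem_fiberCone.1 hxy i

variable [Finite ι] [∀ i, Module.Finite ℤ (N i)]

lemma isRationalPolyhedral_fiberCone {σ : ∀ i, RealCone (N i)}
    (h : ∀ i, IsRationalPolyhedral (σ i)) : IsRationalPolyhedral (fiberCone φ σ) :=
  IsRationalPolyhedral.iInf_comap h _

/-- Characters that are nonnegative on a fiber product of cones are, up to a multiple, sums of
characters that are nonnegative on the factors. -/
lemma exists_nsmul_mem_closure_of_mem_dualMonoid_fiberCone {σ : ∀ i, RealCone (N i)}
    (h : ∀ i, IsRationalPolyhedral (σ i)) {m : FiberLattice φ}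
    (hm : m ∈ dualMonoid (fiberCone φ σ)) :
    ∃ n : ℕ, 0 < n ∧ n • m ∈ AddSubmonoid.closure
      {x | ∃ i, ∃ a ∈ dualMonoid (σ i), x = fiberIncl φ i a} := by
  classical
  have := Fintype.ofFinite ι
  choose T hT using fun i => (h i).exists_eq_ineqCone
  obtain ⟨n, hn, hm⟩ := exists_nsmul_mem_closure
    (Finset.univ.biUnion fun i => (T i).image (fiberIncl φ i)) m fun w hw => hm w (by
      refine mem_fiberCone.2 fun i => ?_
      rw [hT i]
      intro t ht
      exact hw _ (Finset.mem_coe.2 (Finset.mem_biUnion.2 ⟨i, Finset.mem_univ i,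
        Finset.mem_image_of_mem _ ht⟩)))
  refine ⟨n, hn, AddSubmonoid.closure_mono ?_ hm⟩
  intro x hx
  obtain ⟨i, -, hx⟩ := Finset.mem_biUnion.1 (Finset.mem_coe.1 hx)
  obtain ⟨t, ht, rfl⟩ := Finset.mem_image.1 hx
  refine ⟨i, t, ?_, rfl⟩
  rw [hT i]
  exact fun v hv => hv t ht

/-- The faces of a fiber product of cones are the fiber products of faces. -/
lemma exists_eq_fiberCone_of_isFaceOf {σ : ∀ i, RealCone (N i)}
    (h : ∀ i, IsRationalPolyhedral (σ i)) {F : RealCone (FiberLattice φ)}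
    (hF : F.IsFaceOf (fiberCone φ σ)) :
    ∃ τ : ∀ i, RealCone (N i), (∀ i, (τ i).IsFaceOf (σ i)) ∧ F = fiberCone φ τ := by
  -- the smallest faces that contain the projections of `F`
  choose τ hτ hmem using fun i => exists_isFaceOf_mem_iff (σ := σ i)
    (A := {m | m ∈ dualMonoid (σ i) ∧ ∀ w ∈ F, w (fiberIncl φ i m) = 0}) fun m hm => hm.1
  refine ⟨τ, hτ, le_antisymm (fun w hw => mem_fiberCone.2 fun i => (hmem i _).2
    ⟨mem_fiberCone.1 (hF.le hw) i, fun m hm => hm.2 w hw⟩) fun w hw => ?_⟩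
  obtain ⟨m₀, h1, h2, h3⟩ := (isRationalPolyhedral_fiberCone h).exists_exposing hF
  refine h3 w ((isFaceOf_fiberCone hτ).le hw) ?_
  obtain ⟨n, hn, hcl⟩ := exists_nsmul_mem_closure_of_mem_dualMonoid_fiberCone h h1
  have h4 : ∀ x ∈ AddSubmonoid.closure {x | ∃ i, ∃ a ∈ dualMonoid (σ i), x = fiberIncl φ i a},
      x ∈ dualMonoid (fiberCone φ σ) ∧ (x ∈ perp F → w x = 0) := by
    intro x hx
    induction hx using AddSubmonoid.closure_induction with
    | mem x hx =>
      obtain ⟨i, a, ha, rfl⟩ := hx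
      refine ⟨fun w hw => ha _ (mem_fiberCone.1 hw i), fun hx => ?_⟩
      exact ((hmem i _).1 (mem_fiberCone.1 hw i)).2 a ⟨ha, hx⟩
    | zero => exact ⟨zero_mem _, fun _ => map_zero w⟩
    | add x y _ _ hx hy =>
      refine ⟨add_mem hx.1 hy.1, fun hxy => ?_⟩
      obtain ⟨h5, h6⟩ := (add_mem_perp_iff hF.le hx.1 hy.1).1 hxy
      rw [map_add, hx.2 h5, hy.2 h6, add_zero]
  have h5 := (h4 _ hcl).2 (nsmul_mem h2 n)
  rw [map_nsmul, nsmul_eq_mul, mul_eq_zero] at h5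
  exact h5.resolve_left (by exact_mod_cast hn.ne')

/-- The fiber product of fans is a fan. -/
lemma isFan_fiberFan (hΦ : ∀ i, IsFan (Φ i)) (hΦB : ⊥ ∈ ΦB) : IsFan (fiberFan φ Φ ΦB) where
  finite := by
    refine ((Set.Finite.pi' fun i => (hΦ i).finite).image (fiberCone φ)).subset ?_
    rintro _ ⟨σ, hσ, -, rfl⟩
    exact ⟨σ, hσ, rfl⟩
  bot_mem := by
    refine ⟨fun _ => ⊥, fun i => (hΦ i).bot_mem, ⟨⊥, hΦB, fun i v hv => ?_⟩, ?_⟩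
    · rw [(Submodule.mem_bot _).1 hv, map_zero]
      exact zero_mem _
    · refine (eq_bot_iff.2 fun w hw => (Submodule.mem_bot _).2 ?_).symm
      refine fiberLattice_hom_ext φ fun i m => ?_
      exact DFunLike.congr_fun ((Submodule.mem_bot _).1 (mem_fiberCone.1 hw i)) m
  polyhedral := by
    rintro _ ⟨σ, hσ, -, rfl⟩
    exact isRationalPolyhedral_fiberCone fun i => (hΦ i).polyhedral _ (hσ i)
  strictlyConvex := by
    rintro _ ⟨σ, hσ, -, rfl⟩ w hw hw'
    refine fiberLattice_hom_ext φ fun i m => ?_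
    have := (hΦ i).strictlyConvex _ (hσ i) _ (mem_fiberCone.1 hw i) (by
      rw [← map_neg]
      exact mem_fiberCone.1 hw' i)
    exact DFunLike.congr_fun this m
  face_mem := by
    rintro _ ⟨σ, hσ, ⟨τ, hτ, h⟩, rfl⟩ F hF
    obtain ⟨σ', hσ', rfl⟩ := exists_eq_fiberCone_of_isFaceOf
      (fun i => (hΦ i).polyhedral _ (hσ i)) hF
    exact ⟨σ', fun i => (hΦ i).face_mem _ (hσ i) _ (hσ' i),
      ⟨τ, hτ, fun i v hv => h i v ((hσ' i).le hv)⟩, rfl⟩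
  inter_face := by
    rintro _ ⟨σ, hσ, -, rfl⟩ _ ⟨τ, hτ, -, rfl⟩
    rw [fiberCone_inf]
    exact isFaceOf_fiberCone fun i => (hΦ i).inter_face _ (hσ i) _ (hτ i)

end Fans

/-! ### Monoid algebras -/

section MonoidAlgebras

variable {k P Q : Type u} [Field k] [AddCommMonoid P] [AddCommMonoid Q]

@[simp] lemma mapDomainRingHom_single (φ : P →+ Q) (m : P) (a : k) :
    AddMonoidAlgebra.mapDomainRingHom k φ (AddMonoidAlgebra.single m a) =
      AddMonoidAlgebra.single (φ m) a := by
  simp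

lemma mapDomainRingHom_injective {φ : P →+ Q} (h : Function.Injective φ) :
    Function.Injective (AddMonoidAlgebra.mapDomainRingHom k φ) :=
  AddMonoidAlgebra.mapDomain_injective h

lemma monoidAlgebra_induction {p : AddMonoidAlgebra k P → Prop}
    (h : ∀ m a, p (AddMonoidAlgebra.single m a)) (hadd : ∀ x y, p x → p y → p (x + y))
    (x : AddMonoidAlgebra k P) : p x := by
  induction x using AddMonoidAlgebra.induction_linear with
  | zero => simpa using h 0 0
  | add x y hx hy => exact hadd x y hx hy
  | single m a => exact h m a

/-- Inverting the monomial `χ^{m₀}` inverts `m₀` in the monoid. -/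
lemma isLocalization_away_mapDomainRingHom {φ : P →+ Q} (hφ : Function.Injective φ) (m₀ : P)
    (h0 : IsAddUnit (φ m₀)) (h : ∀ q : Q, ∃ (N : ℕ) (p : P), q + N • φ m₀ = φ p) :
    letI := (AddMonoidAlgebra.mapDomainRingHom k φ).toAlgebra
    IsLocalization.Away (AddMonoidAlgebra.single m₀ (1 : k)) (AddMonoidAlgebra k Q) := by
  let := (AddMonoidAlgebra.mapDomainRingHom k φ).toAlgebra
  have halg : ∀ x, algebraMap (AddMonoidAlgebra k P) (AddMonoidAlgebra k Q) x =
    AddMonoidAlgebra.mapDomainRingHom k φ x := fun x => rfl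
  have hunit : IsUnit (algebraMap (AddMonoidAlgebra k P) (AddMonoidAlgebra k Q)
      (AddMonoidAlgebra.single m₀ (1 : k))) := by
    obtain ⟨n, hn⟩ := h0.exists_neg
    rw [halg, mapDomainRingHom_single]
    refine IsUnit.of_mul_eq_one (AddMonoidAlgebra.single n 1) ?_
    rw [AddMonoidAlgebra.single_mul_single, hn, mul_one, AddMonoidAlgebra.one_def]
  refine ⟨⟨?_, ?_, ?_⟩⟩
  · rintro ⟨_, n, rfl⟩
    dsimp only
    rw [map_pow]
    exact hunit.pow n
  · intro z
    suffices H : ∃ (N : ℕ) (x : AddMonoidAlgebra k P),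
        z * algebraMap _ _ (AddMonoidAlgebra.single m₀ (1 : k)) ^ N = algebraMap _ _ x by
      obtain ⟨N, x, hx⟩ := H
      exact ⟨(x, ⟨_, N, rfl⟩), by rw [← hx, map_pow]⟩
    induction z using monoidAlgebra_induction with
    | h m a =>
      obtain ⟨N, p, hp⟩ := h m
      refine ⟨N, AddMonoidAlgebra.single p a, ?_⟩
      rw [halg, halg, mapDomainRingHom_single, mapDomainRingHom_single,
        AddMonoidAlgebra.single_pow, AddMonoidAlgebra.single_mul_single, hp, one_pow, mul_one]
    | hadd x y hx hy =>
      obtain ⟨N, x', hx⟩ := hx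
      obtain ⟨N', y', hy⟩ := hy
      refine ⟨N + N', x' * AddMonoidAlgebra.single m₀ (1 : k) ^ N' +
        y' * AddMonoidAlgebra.single m₀ (1 : k) ^ N, ?_⟩
      rw [map_add, map_mul, map_mul, ← hx, ← hy, map_pow, map_pow, pow_add]
      ring
  · intro x y hxy
    exact ⟨1, by rw [mapDomainRingHom_injective hφ hxy]⟩

end MonoidAlgebras

/-! ### Normality of monoid algebras -/

section Normal

variable {L Λ : Type u} [Field L] [AddCommGroup Λ]

instance addMonoid_fg_of_finite [Module.Finite ℤ Λ] : AddMonoid.FG Λ :=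
  AddGroup.fg_iff_addMonoid_fg.1 (Module.Finite.iff_addGroup_fg.1 inferInstance)

instance isNoetherianRing_monoidAlgebra [Module.Finite ℤ Λ] :
    IsNoetherianRing (AddMonoidAlgebra L Λ) :=
  Algebra.FiniteType.isNoetherianRing L _

variable [Module.Free ℤ Λ] [Module.Finite ℤ Λ]

instance isDomain_monoidAlgebra : IsDomain (AddMonoidAlgebra L Λ) := by
  have : IsAddTorsionFree Λ := .of_isTorsionFree ℤ Λ
  have : NoZeroDivisors (AddMonoidAlgebra L Λ) := inferInstance
  exact NoZeroDivisors.to_isDomain _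

/-- The ring of Laurent polynomials is a localization of a polynomial ring. -/
instance isIntegrallyClosed_monoidAlgebra : IsIntegrallyClosed (AddMonoidAlgebra L Λ) := by
  classical
  let β := Module.Free.chooseBasis ℤ Λ
  set I := Module.Free.ChooseBasisIndex ℤ Λ
  let j : (I →₀ ℕ) →+ Λ :=
    β.repr.symm.toAddMonoidHom.comp (Finsupp.mapRange.addMonoidHom (Nat.castAddMonoidHom ℤ))
  have hj : ∀ p i, β.repr (j p) i = (p i : ℤ) := by
    intro p i
    simp [j]
  have hinj : Function.Injective j := by
    intro p q hpq
    ext i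
    have := hj p i
    rw [hpq, hj q i] at this
    exact_mod_cast this.symm
  let m₀ : I →₀ ℕ := Finsupp.equivFunOnFinite.symm fun _ => 1
  have hm₀ : ∀ i, m₀ i = 1 := fun i => rfl
  have h : ∀ q : Λ, ∃ (N : ℕ) (p : I →₀ ℕ), q + N • j m₀ = j p := by
    intro q
    let N : ℕ := ∑ i, (β.repr q i).natAbs
    have hN : ∀ i, (β.repr q i).natAbs ≤ N := fun i =>
      Finset.single_le_sum (f := fun i => (β.repr q i).natAbs) (fun _ _ => Nat.zero_le _)
        (Finset.mem_univ i)
    refine ⟨N, Finsupp.equivFunOnFinite.symm fun i => (β.repr q i + N).toNat,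
      β.ext_elem fun i => ?_⟩
    rw [hj, map_add, map_nsmul, Finsupp.add_apply, Finsupp.smul_apply, hj, hm₀]
    have := hN i
    simp only [Finsupp.equivFunOnFinite_symm_apply_apply, nsmul_eq_mul]
    omega
  let _ : Algebra (MvPolynomial I L) (AddMonoidAlgebra L Λ) :=
    (AddMonoidAlgebra.mapDomainRingHom L j).toAlgebra
  have hloc : IsLocalization.Away (MvPolynomial.monomial m₀ (1 : L)) (AddMonoidAlgebra L Λ) :=
    isLocalization_away_mapDomainRingHom hinj m₀ (AddGroup.isAddUnit _) h
  refine isIntegrallyClosed_of_isLocalization (R := MvPolynomial I L) (AddMonoidAlgebra L Λ)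
    (Submonoid.powers (MvPolynomial.monomial m₀ (1 : L))) ?_
  rw [Submonoid.powers_le, mem_nonZeroDivisors_iff_ne_zero]
  simp

/-- The map `L[Λ] → L[Λ]((T))`, `χ^m ↦ χ^m T^{n(m)}`, which relates the grading of `L[Λ]` by the
integral functional `n` to the `T`-adic valuation. -/
noncomputable def gradingHom (L : Type u) {Λ : Type u} [Field L] [AddCommGroup Λ] (n : Λ →+ ℤ) :
    AddMonoidAlgebra L Λ →+* HahnSeries ℤ (AddMonoidAlgebra L Λ) :=
  AddMonoidAlgebra.liftNCRingHom (HahnSeries.C.comp (algebraMap L (AddMonoidAlgebra L Λ)))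
    { toFun := fun m => HahnSeries.single (n m.toAdd) (AddMonoidAlgebra.single m.toAdd 1)
      map_one' := by
        simp only [toAdd_one, map_zero]
        rfl
      map_mul' := fun a b => by
        rw [HahnSeries.single_mul_single, AddMonoidAlgebra.single_mul_single, one_mul, toAdd_mul,
          map_add] } fun _ _ => Commute.all _ _

omit [Module.Free ℤ Λ] [Module.Finite ℤ Λ] in
lemma gradingHom_single (n : Λ →+ ℤ) (m : Λ) (a : L) :
    gradingHom L n (AddMonoidAlgebra.single m a) =
      HahnSeries.single (n m) (AddMonoidAlgebra.single m a) := by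
  refine (AddMonoidAlgebra.liftNC_single _ _ _ _).trans ?_
  change HahnSeries.single 0 (AddMonoidAlgebra.single 0 a) *
    HahnSeries.single (n m) (AddMonoidAlgebra.single m 1) = _
  rw [HahnSeries.single_mul_single, AddMonoidAlgebra.single_mul_single, zero_add, zero_add, mul_one]

omit [Module.Free ℤ Λ] [Module.Finite ℤ Λ] in
lemma gradingHom_coeff (n : Λ →+ ℤ) (f : AddMonoidAlgebra L Λ) (j : ℤ) (m : Λ) :
    ((gradingHom L n f).coeff j).coeff m = if n m = j then f.coeff m else 0 := by
  induction f using monoidAlgebra_induction with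
  | h m' a =>
    rw [gradingHom_single, HahnSeries.coeff_single, AddMonoidAlgebra.coeff_single]
    by_cases h : m' = m
    · subst h
      simp only [eq_comm (a := j)]
      split_ifs <;> simp
    · split_ifs <;> simp [Ne.symm h]
  | hadd x y hx hy =>
    rw [map_add, HahnSeries.coeff_add, AddMonoidAlgebra.coeff_add, AddMonoidAlgebra.coeff_add,
      Finsupp.add_apply, Finsupp.add_apply, hx, hy]
    split_ifs <;> simp

omit [Module.Free ℤ Λ] [Module.Finite ℤ Λ] in
lemma gradingHom_orderTop_nonneg (n : Λ →+ ℤ) {f : AddMonoidAlgebra L Λ}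
    (hf : ∀ m, f.coeff m ≠ 0 → 0 ≤ n m) : 0 ≤ (gradingHom L n f).orderTop := by
  refine HahnSeries.le_orderTop_iff_forall.2 fun j hj => ?_
  refine AddMonoidAlgebra.ext (Finsupp.ext fun m => ?_)
  rw [gradingHom_coeff]
  split_ifs with h
  · by_contra h0
    have h1 := hf m h0
    have h2 : j < 0 := by exact_mod_cast hj
    omega
  · rfl

/-- The monomials with nonnegative degree span an integrally closed subring. -/
lemma nonneg_of_isIntegral {R : Type*} [CommRing R] (ψ : R →+* AddMonoidAlgebra L Λ) (n : Λ →+ ℤ)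
    (hψ : ∀ r m, (ψ r).coeff m ≠ 0 → 0 ≤ n m) {f : AddMonoidAlgebra L Λ} (hf : ψ.IsIntegralElem f)
    {m : Λ} (hm : f.coeff m ≠ 0) : 0 ≤ n m := by
  let v := (HahnSeries.addVal ℤ (AddMonoidAlgebra L Λ)).toValuation
  have h1 : gradingHom L n f ∈ v.integer := by
    refine (Valuation.integer.integers v).mem_of_integral ?_
    obtain ⟨p, hp, hp0⟩ := hf
    let ψ' : R →+* v.integer := ((gradingHom L n).comp ψ).codRestrict v.integer
      fun r => gradingHom_orderTop_nonneg n (hψ r)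
    refine ⟨p.map ψ', hp.map _, ?_⟩
    rw [Polynomial.eval₂_map]
    have := congrArg (gradingHom L n) hp0
    rw [map_zero, Polynomial.hom_eval₂] at this
    exact this
  have h2 : (0 : WithTop ℤ) ≤ (gradingHom L n f).orderTop := h1
  by_contra h
  have h3 : (gradingHom L n f).coeff (n m) ≠ 0 := by
    intro h3
    have := gradingHom_coeff n f (n m) m
    rw [h3, if_pos rfl] at this
    exact hm this.symm
  have h4 := h2.trans (HahnSeries.orderTop_le_of_coeff_ne_zero h3)
  exact h (by exact_mod_cast h4)

omit [Module.Free ℤ Λ] [Module.Finite ℤ Λ] in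
lemma mem_range_mapDomainRingHom_subtype {A : AddSubmonoid Λ} {f : AddMonoidAlgebra L Λ}
    (hf : ∀ m, f.coeff m ≠ 0 → m ∈ A) :
    f ∈ (AddMonoidAlgebra.mapDomainRingHom L A.subtype).range := by
  classical
  have h1 : f = ∑ m ∈ f.coeff.support, AddMonoidAlgebra.single m (f.coeff m) := by
    conv_lhs => rw [← AddMonoidAlgebra.sum_coeff_single f]
    rfl
  rw [h1]
  refine sum_mem fun m hm => ?_
  refine ⟨AddMonoidAlgebra.single ⟨m, hf m (Finsupp.mem_support_iff.1 hm)⟩ (f.coeff m), ?_⟩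
  rw [mapDomainRingHom_single]
  rfl

omit [Module.Free ℤ Λ] [Module.Finite ℤ Λ] in
lemma mem_of_coeff_mapDomainRingHom_subtype {A : AddSubmonoid Λ} (x : AddMonoidAlgebra L A) {m : Λ}
    (hm : (AddMonoidAlgebra.mapDomainRingHom L A.subtype x).coeff m ≠ 0) : m ∈ A := by
  induction x using monoidAlgebra_induction with
  | h m' a =>
    rw [mapDomainRingHom_single, AddMonoidAlgebra.coeff_single] at hm
    have : m = m' := by
      by_contra h
      exact hm (Finsupp.single_eq_of_ne h)
    rw [this]
    exact m'.2
  | hadd x y hx hy =>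
    rw [map_add, AddMonoidAlgebra.coeff_add, Finsupp.add_apply] at hm
    by_cases h : (AddMonoidAlgebra.mapDomainRingHom L A.subtype x).coeff m = 0
    · rw [h, zero_add] at hm
      exact hy hm
    · exact hx h

/-- The ring `L[C^∨ ∩ Λ]` is integrally closed in `L[Λ]`. -/
lemma mem_range_of_isIntegralElem {C : RealCone Λ} (hC : IsRationalPolyhedral C)
    {f : AddMonoidAlgebra L Λ}
    (hf : (AddMonoidAlgebra.mapDomainRingHom L (dualMonoid C).subtype).IsIntegralElem f) :
    f ∈ (AddMonoidAlgebra.mapDomainRingHom L (dualMonoid C).subtype).range := by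
  obtain ⟨S, rfl⟩ := hC
  refine mem_range_mapDomainRingHom_subtype fun m hm => mem_dualMonoid_hull.2 fun s hs => ?_
  exact nonneg_of_isIntegral _ s (fun r m hm => mem_dualMonoid_hull.1
    (mem_of_coeff_mapDomainRingHom_subtype r hm) s hs) hf hm

instance isDomain_dualMonoid (C : RealCone Λ) : IsDomain (AddMonoidAlgebra L (dualMonoid C)) :=
  (mapDomainRingHom_injective (k := L) (φ := (dualMonoid C).subtype)
    Subtype.val_injective).isDomain _

lemma isIntegrallyClosed_dualMonoid {C : RealCone Λ} (hC : IsRationalPolyhedral C) :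
    IsIntegrallyClosed (AddMonoidAlgebra L (dualMonoid C)) := by
  set A := AddMonoidAlgebra L (dualMonoid C)
  set B := AddMonoidAlgebra L Λ
  set ψ : A →+* B := AddMonoidAlgebra.mapDomainRingHom L (dualMonoid C).subtype
  have hψ : Function.Injective ψ := mapDomainRingHom_injective Subtype.val_injective
  let K := FractionRing B
  let χ : FractionRing A →+* K := IsFractionRing.lift (A := A) (g := (algebraMap B K).comp ψ)
    ((IsFractionRing.injective B K).comp hψ)
  have hχ : ∀ a : A, χ (algebraMap A _ a) = algebraMap B K (ψ a) := fun a =>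
    IsFractionRing.lift_algebraMap _ a
  refine (isIntegrallyClosed_iff (FractionRing A)).2 fun {x} hx => ?_
  have h1 : IsIntegral B (χ x) := by
    obtain ⟨p, hp, hp0⟩ := hx
    refine ⟨p.map ψ, hp.map ψ, ?_⟩
    have := congrArg χ hp0
    rw [map_zero, Polynomial.hom_eval₂] at this
    rw [Polynomial.eval₂_map, ← this]
    congr 1
    exact RingHom.ext fun a => (hχ a).symm
  obtain ⟨b, hb⟩ := (isIntegrallyClosed_iff K).1 (isIntegrallyClosed_monoidAlgebra (Λ := Λ)) h1
  have h2 : ψ.IsIntegralElem b := by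
    obtain ⟨p, hp, hp0⟩ := hx
    refine ⟨p, hp, IsFractionRing.injective B K ?_⟩
    have := congrArg χ hp0
    rw [map_zero, Polynomial.hom_eval₂, ← hb] at this
    rw [Polynomial.hom_eval₂, map_zero, ← this]
    congr 1
    exact RingHom.ext fun a => (hχ a).symm
  obtain ⟨a, ha⟩ := mem_range_of_isIntegralElem hC h2
  refine ⟨a, χ.injective ?_⟩
  rw [hχ, ← hb]
  exact congrArg _ ha

end Normal

/-! ### Components of diagonalizable groups -/

section Components

variable {k G : Type u} [Field k] [AddCommGroup G]

lemma twistedMonomialHom_single {L P Q : Type u} [Field L] [Algebra k L] [AddCommGroup P]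
    [AddCommGroup Q] (q : P →+ Q) (c : Multiplicative P →* L) (m : P) (a : k) :
    twistedMonomialHom q c (AddMonoidAlgebra.single m a) =
      AddMonoidAlgebra.single (q m) (algebraMap k L a * c (Multiplicative.ofAdd m)) := by
  rw [twistedMonomialHom, AddMonoidAlgebra.lift_single]
  simp [Algebra.smul_def]

/-- The components of `Spec k[G]`, for a finitely generated group `G`: each of them is a torus
`Spec L[G / torsion]`, with `L` finite over `k`. The field `L` is the residue field of a point of
the finite scheme `Spec k[torsion]`, and the embedding of the component depends on a splitting
of `G → G / torsion`. -/
theorem exists_component [Module.Finite ℤ G] {P : Ideal (AddMonoidAlgebra k G)}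
    (hP : P ∈ minimalPrimes (AddMonoidAlgebra k G)) :
    ∃ (L : Type u) (_ : Field L) (_ : Algebra k L) (c : Multiplicative G →* L),
      Module.Finite k L ∧
      Function.Surjective (twistedMonomialHom (k := k)
        (QuotientAddGroup.mk' (AddCommGroup.torsion G)) c) ∧
      RingHom.ker (twistedMonomialHom (k := k)
        (QuotientAddGroup.mk' (AddCommGroup.torsion G)) c) = P ∧
      (IsAddTorsionFree G → Function.Bijective (algebraMap k L) ∧ ∀ g, c g = 1) := by
  classical
  set T := AddCommGroup.torsion G with hT
  set Λ := G ⧸ T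
  let q : G →+ Λ := QuotientAddGroup.mk' T
  have hPp : P.IsPrime := hP.1.1
  have : IsAddTorsionFree Λ := inferInstance
  have : Module.Finite ℤ Λ := Module.Finite.of_surjective q.toIntLinearMap
    (QuotientAddGroup.mk'_surjective T)
  have : Module.Free ℤ Λ := inferInstance
  have : Module.Finite ℤ T :=
    inferInstanceAs (Module.Finite ℤ (AddSubgroup.toIntSubmodule T))
  have : Finite T := by
    refine Module.finite_of_fg_torsion T fun x => ?_
    obtain ⟨n, hn, hx⟩ := isOfFinAddOrder_iff_nsmul_eq_zero.1 x.2
    refine ⟨⟨n, mem_nonZeroDivisors_of_ne_zero (by exact_mod_cast hn.ne')⟩, ?_⟩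
    ext
    simpa using hx
  obtain ⟨s', hs'⟩ := Module.projective_lifting_property q.toIntLinearMap LinearMap.id
    (QuotientAddGroup.mk'_surjective T)
  let s : Λ →+ G := s'.toAddMonoidHom
  have hs : ∀ x, q (s x) = x := fun x => LinearMap.congr_fun hs' x
  let t : G →+ T := (AddMonoidHom.id G - s.comp q).codRestrict T fun g => by
    rw [← QuotientAddGroup.eq_zero_iff]
    change q (g - s (q g)) = 0
    rw [map_sub, hs, sub_self]
  have ht : ∀ g, ((t g : T) : G) = g - s (q g) := fun g => rfl
  have hqT : ∀ x : T, q x = 0 := fun x => (QuotientAddGroup.eq_zero_iff (x : G)).2 x.2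
  have htT : ∀ x : T, t x = x := fun x => Subtype.ext (by rw [ht, hqT, map_zero, sub_zero])
  have hts : ∀ x, t (s x) = 0 := fun x => Subtype.ext (by
    rw [ht, hs, sub_self, ZeroMemClass.coe_zero])
  let ιT : AddMonoidAlgebra k T →+* AddMonoidAlgebra k G :=
    AddMonoidAlgebra.mapDomainRingHom k T.subtype
  have : Module.Finite k (AddMonoidAlgebra k T) := inferInstance
  have : IsArtinianRing (AddMonoidAlgebra k T) := IsArtinianRing.of_finite k _
  let p : Ideal (AddMonoidAlgebra k T) := P.comap ιT
  have hp : p.IsPrime := Ideal.IsPrime.comap _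
  have hpm : p.IsMaximal := IsArtinianRing.isMaximal_of_isPrime p
  let instL : Field (AddMonoidAlgebra k T ⧸ p) := Ideal.Quotient.field p
  let c : Multiplicative G →* (AddMonoidAlgebra k T ⧸ p) :=
    ((Ideal.Quotient.mk p).toMonoidHom.comp (AddMonoidAlgebra.of k T)).comp
      (AddMonoidHom.toMultiplicative t)
  have hc : ∀ g, c (Multiplicative.ofAdd g) =
      Ideal.Quotient.mk p (AddMonoidAlgebra.single (t g) 1) := fun g => rfl
  have hΨT : ∀ x, twistedMonomialHom (k := k) q c (ιT x) =
      AddMonoidAlgebra.single 0 (Ideal.Quotient.mk p x) := by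
    intro x
    induction x using monoidAlgebra_induction with
    | h m a =>
      change twistedMonomialHom q c (AddMonoidAlgebra.mapDomainRingHom k T.subtype _) = _
      rw [mapDomainRingHom_single, twistedMonomialHom_single, hc]
      change AddMonoidAlgebra.single (q m) (algebraMap k _ a * Ideal.Quotient.mk p
        (AddMonoidAlgebra.single (t m) 1)) = _
      rw [hqT, htT, ← Ideal.Quotient.mk_algebraMap, ← map_mul]
      congr 2
      rw [AddMonoidAlgebra.coe_algebraMap, Function.comp_apply, AddMonoidAlgebra.single_mul_single,
        zero_add, mul_one, Algebra.algebraMap_self, RingHom.id_apply]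
    | hadd x y hx hy =>
      rw [map_add, map_add, hx, hy, map_add, AddMonoidAlgebra.single_add]
  have hsurj : Function.Surjective (twistedMonomialHom (k := k) q c) := by
    intro f
    induction f using monoidAlgebra_induction with
    | h m a =>
      obtain ⟨a, rfl⟩ := Ideal.Quotient.mk_surjective a
      refine ⟨ιT a * AddMonoidAlgebra.single (s m) 1, ?_⟩
      rw [map_mul, hΨT, twistedMonomialHom_single, AddMonoidAlgebra.single_mul_single, hc, hts, hs,
        zero_add, map_one, one_mul, ← AddMonoidAlgebra.one_def, map_one, mul_one]
    | hadd x y hx hy =>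
      obtain ⟨x', hx⟩ := hx
      obtain ⟨y', hy⟩ := hy
      exact ⟨x' + y', by rw [map_add, hx, hy]⟩
  refine ⟨AddMonoidAlgebra k T ⧸ p, instL, inferInstance, c, inferInstance, hsurj, ?_, ?_⟩
  · -- `Θ` factors `k[G] → k[G] / P` through `L[Λ]`, so that the kernel is contained in `P`
    let Θ : AddMonoidAlgebra (AddMonoidAlgebra k T ⧸ p) Λ →+* AddMonoidAlgebra k G ⧸ P :=
      AddMonoidAlgebra.liftNCRingHom (Ideal.quotientMap P ιT le_rfl)
        (((Ideal.Quotient.mk P).toMonoidHom.comp (AddMonoidAlgebra.of k G)).comp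
          (AddMonoidHom.toMultiplicative s)) fun _ _ => Commute.all _ _
    have hΘ : ∀ x, Θ (twistedMonomialHom (k := k) q c x) = Ideal.Quotient.mk P x := by
      intro x
      induction x using monoidAlgebra_induction with
      | h m a =>
        rw [twistedMonomialHom_single, hc, ← Ideal.Quotient.mk_algebraMap, ← map_mul]
        refine (AddMonoidAlgebra.liftNC_single _ _ _ _).trans ?_
        change Ideal.quotientMap P ιT le_rfl (Ideal.Quotient.mk p _) *
          Ideal.Quotient.mk P (AddMonoidAlgebra.single (s (q m)) 1) = _
        rw [Ideal.quotientMap_mk, ← map_mul]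
        congr 1
        rw [AddMonoidAlgebra.coe_algebraMap, Function.comp_apply,
          AddMonoidAlgebra.single_mul_single, zero_add, mul_one, Algebra.algebraMap_self,
          RingHom.id_apply]
        change AddMonoidAlgebra.mapDomainRingHom k T.subtype _ * _ = _
        rw [mapDomainRingHom_single, AddMonoidAlgebra.single_mul_single, mul_one]
        congr 1
        change (t m : G) + s (q m) = m
        rw [ht, sub_add_cancel]
      | hadd x y hx hy => rw [map_add, map_add, hx, hy, map_add]
    have hle : RingHom.ker (twistedMonomialHom (k := k) q c) ≤ P := by
      intro x hx
      rw [RingHom.mem_ker] at hx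
      rw [← Ideal.Quotient.eq_zero_iff_mem, ← hΘ, hx, map_zero]
    exact le_antisymm hle (hP.2 ⟨RingHom.ker_isPrime _, bot_le⟩ hle)
  · intro hG
    have h1 : ∀ x : T, x = 0 := by
      intro x
      obtain ⟨n, hn, hx⟩ := isOfFinAddOrder_iff_nsmul_eq_zero.1 x.2
      exact Subtype.ext ((nsmul_eq_zero_iff.1 hx).resolve_right hn.ne')
    refine ⟨⟨(algebraMap k _).injective, fun y => ?_⟩, fun g => ?_⟩
    · obtain ⟨y, rfl⟩ := Ideal.Quotient.mk_surjective y
      induction y using monoidAlgebra_induction with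
      | h m a =>
        refine ⟨a, ?_⟩
        rw [← Ideal.Quotient.mk_algebraMap, h1 m]
        rfl
      | hadd x y hx hy =>
        obtain ⟨x', hx⟩ := hx
        obtain ⟨y', hy⟩ := hy
        exact ⟨x' + y', by rw [map_add, hx, hy, map_add]⟩
    · change Ideal.Quotient.mk p (AddMonoidAlgebra.single (t g.toAdd) 1) = 1
      rw [h1 (t _), ← AddMonoidAlgebra.one_def, map_one]

end Components

/-! ### Charts of relative normalizations -/

section Schemes

lemma isDominant_specMap {R S : CommRingCat.{u}} (ρ : R ⟶ S) (h : Function.Injective ρ.hom) :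
    IsDominant (Spec.map ρ) := by
  refine ⟨?_⟩
  change DenseRange (PrimeSpectrum.comap ρ.hom)
  rw [PrimeSpectrum.denseRange_comap_iff_ker_le_nilRadical,
    (RingHom.injective_iff_ker_eq_bot _).1 h]
  exact bot_le

/-- Morphisms to an affine open subscheme are determined on a dense part of the source. -/
lemma eq_of_isDominant_of_range_subset {W X F : Scheme.{u}} [IsReduced X] (i : W ⟶ X)
    [IsDominant i] {U : F.Opens} (hU : IsAffineOpen U) {a b : X ⟶ F} (ha : Set.range a ⊆ U)
    (hb : Set.range b ⊆ U) (h : i ≫ a = i ≫ b) : a = b := by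
  have : IsAffine U := hU
  rw [← IsOpenImmersion.lift_fac U.ι a (by simpa using ha),
    ← IsOpenImmersion.lift_fac U.ι b (by simpa using hb)]
  congr 1
  refine ext_of_isDominant (ι := i) ?_
  rw [← cancel_mono U.ι, Category.assoc, Category.assoc, IsOpenImmersion.lift_fac,
    IsOpenImmersion.lift_fac, h]

lemma quasiCompact_of_noetherianSpace {X Y : Scheme.{u}} [TopologicalSpace.NoetherianSpace X]
    (f : X ⟶ Y) : QuasiCompact f :=
  ⟨fun _ _ _ => TopologicalSpace.NoetherianSpace.isCompact _⟩

/-- The chart of a relative normalization over an affine open subscheme `U`: if `R` is integral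
over `U` and integrally closed in `S`, then `Spec R` is an open subscheme of the normalization
of `F` in `Spec S`, namely the preimage of `U`. -/
theorem exists_normalization_chart {R S : CommRingCat.{u}} {F : Scheme.{u}} (p : Spec S ⟶ F)
    [QuasiCompact p] [QuasiSeparated p] {U : F.Opens} (hU : IsAffineOpen U) (ρ : R ⟶ S)
    (hρ : Function.Injective ρ.hom) (hρ' : ∀ x, ρ.hom.IsIntegralElem x → x ∈ ρ.hom.range)
    (g : Spec R ⟶ U) [IsIntegralHom g] (hg : Spec.map ρ ≫ g ≫ U.ι = p) :
    ∃ c : Spec R ⟶ p.normalization, IsOpenImmersion c ∧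
      c ≫ p.fromNormalization = g ≫ U.ι ∧ Spec.map ρ ≫ c = p.toNormalization ∧
      Set.range c = p.fromNormalization ⁻¹' U := by
  let V := p.fromNormalization ⁻¹ᵁ U
  have hV : IsAffineOpen V := hU.preimage _
  have hpU : p ⁻¹ᵁ U = ⊤ := by
    refine TopologicalSpace.Opens.ext (Set.eq_univ_of_forall fun x => ?_)
    change p x ∈ U
    rw [← hg, Scheme.Hom.comp_apply, Scheme.Hom.comp_apply]
    exact (g (Spec.map ρ x)).2
  have htop : IsAffineOpen (p ⁻¹ᵁ U) := hpU ▸ isAffineOpen_top _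
  have hVle : p ⁻¹ᵁ U ≤ p.toNormalization ⁻¹ᵁ V := by simp [V, ← Scheme.Hom.comp_preimage]
  have htopiso : IsIso htop.fromSpec := by
    exact isIso_of_isOpenImmersion_of_opensRange_eq_top _ (by rw [htop.opensRange_fromSpec, hpU])
  obtain ⟨κ, hκ⟩ := Spec.map_surjective htop.fromSpec
  have hκiso : IsIso κ := by
    have h1 : IsIso (Scheme.Spec.map κ.op) := by
      change IsIso (Spec.map κ)
      rw [hκ]
      exact htopiso
    have h2 : IsIso κ.op := isIso_of_reflects_iso κ.op Scheme.Spec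
    exact isIso_of_op κ
  obtain ⟨γ, hγ⟩ := Spec.map_surjective (g ≫ hU.isoSpec.hom)
  have hγU : Spec.map γ ≫ hU.fromSpec = g ≫ U.ι := by
    rw [hγ, Category.assoc]
    congr 1
    exact hU.isoSpec_hom_fromSpec
  have hγint : γ.hom.IsIntegral := by
    rw [← IsIntegralHom.SpecMap_iff, hγ]
    infer_instance
  let α₀ := p.toNormalization.appLE V (p ⁻¹ᵁ U) hVle
  have hα₀ : Spec.map α₀ ≫ hV.fromSpec = htop.fromSpec ≫ p.toNormalization :=
    hV.SpecMap_appLE_fromSpec _ htop hVle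
  have happ : p.app U = γ ≫ ρ ≫ κ := by
    apply Spec.map_injective
    rw [← cancel_mono hU.fromSpec, Spec.map_comp, Spec.map_comp, Category.assoc, Category.assoc,
      hγU, hg, hκ]
    rw [← hU.SpecMap_appLE_fromSpec p htop le_rfl, Scheme.Hom.appLE_eq_app]
  have hval := p.normalizationObjIso_hom_val hU
  -- sections over `V` are the elements of `Γ(Spec S, p⁻¹ U)` that are integral over `Γ(F, U)`
  have hα₀inj : Function.Injective α₀.hom := by
    intro a b hab
    change p.toNormalization.appLE V (p ⁻¹ᵁ U) hVle a = p.toNormalization.appLE V (p ⁻¹ᵁ U) hVle b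
      at hab
    rw [← hval] at hab
    exact ((p.normalizationObjIso hU).commRingCatIsoToRingEquiv).injective
      (Subtype.val_injective hab)
  have hα₀range : ∀ z, z ∈ α₀.hom.range ↔ (p.app U).hom.IsIntegralElem z := by
    intro z
    have hα₀' : α₀ = _ := hval.symm
    rw [hα₀']
    constructor
    · rintro ⟨y, rfl⟩
      exact ((p.normalizationObjIso hU).hom y).2
    · intro hz
      refine ⟨(p.normalizationObjIso hU).inv ⟨z, hz⟩, ?_⟩
      rw [CommRingCat.hom_comp, RingHom.comp_apply]
      rw [← CommRingCat.comp_apply (p.normalizationObjIso hU).inv, Iso.inv_hom_id]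
      rfl
  let α := α₀ ≫ inv κ
  have hακ : α ≫ κ = α₀ := by simp [α]
  have hκinj : Function.Injective κ.hom := (asIso κ).commRingCatIsoToRingEquiv.injective
  have hαinj : Function.Injective α.hom := by
    intro a b hab
    refine hα₀inj ?_
    rw [← hακ, CommRingCat.hom_comp, RingHom.comp_apply, hab, RingHom.comp_apply]
  have hrange : α.hom.range = ρ.hom.range := by
    ext x
    have hx1 : x ∈ α.hom.range ↔ κ x ∈ α₀.hom.range := by
      rw [← hακ]
      constructor
      · rintro ⟨y, rfl⟩
        exact ⟨y, rfl⟩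
      · rintro ⟨y, hy⟩
        exact ⟨y, hκinj hy⟩
    rw [hx1, hα₀range, happ]
    constructor
    · rintro ⟨P, hP, hP0⟩
      refine hρ' _ ⟨P.map γ.hom, hP.map _, hκinj ?_⟩
      rw [map_zero, Polynomial.eval₂_map, Polynomial.hom_eval₂]
      exact hP0
    · rintro ⟨r, rfl⟩
      obtain ⟨P, hP, hP0⟩ := hγint r
      refine ⟨P, hP, ?_⟩
      have := congrArg (κ.hom.comp ρ.hom) hP0
      rw [Polynomial.hom_eval₂, map_zero] at this
      exact this
  let ε : R ≃+* Γ(p.normalization, V) :=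
    ((RingEquiv.ofBijective ρ.hom.rangeRestrict
      ⟨fun a b h => hρ (congrArg Subtype.val h), ρ.hom.rangeRestrict_surjective⟩).trans
      (RingEquiv.subringCongr hrange.symm)).trans
      (RingEquiv.ofBijective α.hom.rangeRestrict
        ⟨fun a b h => hαinj (congrArg Subtype.val h), α.hom.rangeRestrict_surjective⟩).symm
  have hε : ∀ r, α (ε r) = ρ r := by
    intro r
    have h1 := (RingEquiv.ofBijective α.hom.rangeRestrict
        ⟨fun a b h => hαinj (congrArg Subtype.val h), α.hom.rangeRestrict_surjective⟩).apply_symm_apply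
        (RingEquiv.subringCongr hrange.symm (ρ.hom.rangeRestrict r))
    exact congrArg Subtype.val h1
  have hε' : CommRingCat.ofHom ε.toRingHom ≫ α = ρ := by
    ext r
    exact hε r
  have hεiso : IsIso (CommRingCat.ofHom ε.toRingHom) := ε.toCommRingCatIso.isIso_hom
  have hαV : Spec.map α ≫ hV.fromSpec = p.toNormalization := by
    rw [← cancel_epi htop.fromSpec, ← hα₀, ← hκ, ← Spec.map_comp_assoc, hακ]
  have hαρ : inv (CommRingCat.ofHom ε.toRingHom) ≫ ρ = α := by
    rw [IsIso.inv_comp_eq, hε']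
  refine ⟨Spec.map (inv (CommRingCat.ofHom ε.toRingHom)) ≫ hV.fromSpec, inferInstance, ?_, ?_, ?_⟩
  · have hρm : Mono ρ := ConcreteCategory.mono_of_injective _ hρ
    rw [Category.assoc, ← hU.SpecMap_appLE_fromSpec p.fromNormalization hV le_rfl, ← hγU,
      ← Spec.map_comp_assoc]
    congr 2
    rw [← cancel_mono ρ]
    apply Spec.map_injective
    rw [← cancel_mono hU.fromSpec]
    simp only [Spec.map_comp, Category.assoc]
    rw [hγU, hg, hU.SpecMap_appLE_fromSpec p.fromNormalization hV le_rfl,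
      ← Spec.map_comp_assoc, hαρ, reassoc_of% hαV]
    exact p.toNormalization_fromNormalization
  · rw [← Spec.map_comp_assoc, hαρ, hαV]
  · rw [Scheme.Hom.comp_base, TopCat.coe_comp, Set.range_comp, Set.range_eq_univ.2, Set.image_univ,
      hV.range_fromSpec]
    · rfl
    · exact (Scheme.homeoOfIso (asIso (Spec.map (inv (CommRingCat.ofHom ε.toRingHom))))).surjective

end Schemes

/-! ### Gluing toric normalizations from integral charts -/

section SpecMap

variable (k : Type u) [Field k] {P Q R : Type u} [AddCommMonoid P] [AddCommMonoid Q] [AddCommMonoid R]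

lemma specMap_comp (φ : P →+ Q) (ψ : Q →+ R) :
    specMap k ψ ≫ specMap k φ = specMap k (ψ.comp φ) := by
  rw [specMap, specMap, specMap, ← Spec.map_comp, ← CommRingCat.ofHom_comp]
  congr 2
  exact (AddMonoidAlgebra.mapDomainRingHom_comp _ _).symm

lemma specMap_id : specMap k (AddMonoidHom.id P) = 𝟙 _ := by
  rw [specMap, AddMonoidAlgebra.mapDomainRingHom_id]
  exact Spec.map_id _

lemma specMap_algebraMap (φ : P →+ Q) :
    specMap k φ ≫ Spec.map (CommRingCat.ofHom (algebraMap k (AddMonoidAlgebra k P))) =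
      Spec.map (CommRingCat.ofHom (algebraMap k (AddMonoidAlgebra k Q))) := by
  rw [specMap, ← Spec.map_comp, ← CommRingCat.ofHom_comp]
  congr 2
  ext x
  simp [AddMonoidAlgebra.coe_algebraMap]

lemma isDominant_specMap_of_injective (φ : P →+ Q) (h : Function.Injective φ) :
    IsDominant (specMap k φ) :=
  isDominant_specMap _ (mapDomainRingHom_injective h)

end SpecMap

section DualMonoidMap

variable {M : Type u} [AddCommGroup M] {σ τ ρ : RealCone M}

/-- The inclusion `σ^∨ ∩ M → τ^∨ ∩ M` for `τ ≤ σ`. -/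
def dualIncl (h : τ ≤ σ) : dualMonoid σ →+ dualMonoid τ :=
  dualMonoidMap (AddMonoidHom.id M) (σ := τ) (τ := σ) fun _ hv => h hv

lemma dualIncl_comp (h : τ ≤ σ) (h' : ρ ≤ τ) :
    (dualIncl h').comp (dualIncl h) = dualIncl (h'.trans h) := rfl

lemma dualIncl_refl : dualIncl (le_refl σ) = AddMonoidHom.id _ := rfl

lemma subtype_comp_dualIncl (h : τ ≤ σ) :
    (dualMonoid τ).subtype.comp (dualIncl h) = (dualMonoid σ).subtype := rfl

variable (L : Type u) [Field L]

lemma isIso_specMap_dualIncl (h : τ ≤ σ) (h' : σ ≤ τ) : IsIso (specMap L (dualIncl h)) := by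
  refine ⟨specMap L (dualIncl h'), ?_, ?_⟩ <;> rw [specMap_comp, dualIncl_comp, dualIncl_refl, specMap_id]

lemma isDominant_specMap_dualMonoid_subtype (σ : RealCone M) :
    IsDominant (specMap L (dualMonoid σ).subtype) :=
  isDominant_specMap_of_injective L _ Subtype.val_injective

end DualMonoidMap

lemma range_isIso_comp {X Y Z : Scheme.{u}} (c : X ⟶ Y) [IsIso c] (f : Y ⟶ Z) :
    Set.range (c ≫ f) = Set.range f := by
  have hc : Function.Surjective c := (Scheme.homeoOfIso (asIso c)).surjective
  rw [Scheme.Hom.comp_base, TopCat.coe_comp, hc.range_comp]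

/-- Normality of the stalks of a scheme can be checked on affine charts. -/
lemma isIntegrallyClosed_stalk {R : CommRingCat.{u}} [IsDomain R] [IsIntegrallyClosed R] {Y : Scheme.{u}}
    (c : Spec R ⟶ Y) [IsOpenImmersion c] (x : Spec R) :
    IsIntegrallyClosed (Y.presheaf.stalk (c x)) := by
  let x' : PrimeSpectrum R := x
  have h1 : IsIntegrallyClosed (Localization.AtPrime x'.asIdeal) :=
    isIntegrallyClosed_of_isLocalization _ x'.asIdeal.primeCompl
      x'.asIdeal.primeCompl_le_nonZeroDivisors
  exact .of_equiv ((Spec.stalkIso R x').commRingCatIsoToRingEquiv.symm.trans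
    (asIso (c.stalkMap x)).commRingCatIsoToRingEquiv.symm)

/-- If an immersion of an integral scheme is the composition of a dominant morphism `t` and `ν`, then
`ν` is birational onto its image. -/
lemma bijective_residueFieldMap_genericPoint {T Y F : Scheme.{u}} [IsIntegral T] [IsIntegral Y]
    (t : T ⟶ Y) [IsDominant t] (ν : Y ⟶ F) [IsImmersion (t ≫ ν)] :
    Function.Bijective (ν.residueFieldMap (genericPoint Y)).hom := by
  have hη : t (genericPoint T) = genericPoint Y := by
    have h1 := (genericPoint_spec T).image t.continuous
    have h2 : closure (t '' Set.univ) = Set.univ := by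
      rw [Set.image_univ]
      exact t.denseRange.closure_range
    exact (h1.eq (by rw [h2]; exact genericPoint_spec Y))
  have hsurj : Function.Surjective ((t ≫ ν).residueFieldMap (genericPoint T)).hom := by
    intro z
    obtain ⟨z, rfl⟩ := IsLocalRing.residue_surjective z
    obtain ⟨w, rfl⟩ := (t ≫ ν).stalkMap_surjective (genericPoint T) z
    exact ⟨IsLocalRing.residue _ w, rfl⟩
  rw [← hη]
  rw [Scheme.residueFieldMap_comp] at hsurj
  refine ⟨RingHom.injective _, fun z => ?_⟩
  obtain ⟨w, hw⟩ := hsurj ((t.residueFieldMap (genericPoint T)).hom z)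
  exact ⟨w, (t.residueFieldMap (genericPoint T)).hom.injective hw⟩

section Gluing

variable {k L : Type u} [Field k] [Field L] [Algebra k L] {Λ : Type u} [AddCommGroup Λ]

/-- Compatibility of charts: if `C b ≤ C a`, then the chart `b` is the restriction of the
chart `a`. -/
lemma dualIncl_comp_eq_of_charts {F : Scheme.{u}} (p : specMonoid L Λ ⟶ F) {I : Type*}
    {C : I → RealCone Λ} {U : I → F.Opens} (hU : ∀ a, IsAffineOpen (U a))
    (g : ∀ a, specMonoid L (dualMonoid (C a)) ⟶ U a)
    (hgp : ∀ a, specMap L (dualMonoid (C a)).subtype ≫ g a ≫ (U a).ι = p)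
    (hinter : ∀ a b, ∃ c, C c = C a ⊓ C b ∧ U c = U a ⊓ U b) [Module.Free ℤ Λ] [Module.Finite ℤ Λ]
    {a b : I} (h : C b ≤ C a) :
    specMap L (dualIncl h) ≫ g a ≫ (U a).ι = g b ≫ (U b).ι := by
  have hrange (a : I) : Set.range (g a ≫ (U a).ι) ⊆ U a := by
    rintro _ ⟨x, rfl⟩
    exact (g a x).2
  have key (a b : I) (h : C b ≤ C a) (hU' : U b ≤ U a) :
      specMap L (dualIncl h) ≫ g a ≫ (U a).ι = g b ≫ (U b).ι := by
    have hd := isDominant_specMap_dualMonoid_subtype L (C b)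
    refine eq_of_isDominant_of_range_subset (specMap L (dualMonoid (C b)).subtype) (hU a) ?_
      ((hrange b).trans hU') ?_
    · rintro _ ⟨x, rfl⟩
      exact (g a (specMap L (dualIncl h) x)).2
    · rw [← Category.assoc, specMap_comp, subtype_comp_dualIncl, hgp, hgp]
  obtain ⟨c, hc, hUc⟩ := hinter a b
  have hca : C c ≤ C a := hc ▸ inf_le_left
  have hcb : C c ≤ C b := hc ▸ inf_le_right
  have hbc : C b ≤ C c := hc ▸ le_inf h le_rfl
  have h1 := congrArg (specMap L (dualIncl hbc) ≫ ·) (key a c hca (hUc ▸ inf_le_left))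
  have h2 := congrArg (specMap L (dualIncl hbc) ≫ ·) (key b c hcb (hUc ▸ inf_le_right))
  simp only [← Category.assoc, specMap_comp, dualIncl_comp, dualIncl_refl, specMap_id,
    Category.id_comp] at h1 h2
  rw [← Category.assoc, h1, h2]

/-- Let `p` be an immersion of the torus `Spec L[Λ]`, with closure covered by affine open subsets
`U a`, each receiving an integral morphism from an affine toric variety which extends `p`. If the
cones of these toric varieties form a fan, compatibly with intersections, then the normalization
of the closure is the toric variety with this fan. -/
theorem exists_toricVariety_isNormalizationOf [Module.Finite k L] [Module.Free ℤ Λ] [Module.Finite ℤ Λ]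
    {Φ : Set (RealCone Λ)} (hΦ : IsFan Φ) {F : Scheme.{u}} (s : F ⟶ Spec (.of k))
    (p : specMonoid L Λ ⟶ F) [IsImmersion p]
    (hp : p ≫ s = Spec.map (CommRingCat.ofHom (algebraMap k (AddMonoidAlgebra L Λ))))
    {I : Type*} {C : I → RealCone Λ} (hC : ∀ a, C a ∈ Φ) (hC' : ∀ σ ∈ Φ, ∃ a, C a = σ)
    {U : I → F.Opens} (hU : ∀ a, IsAffineOpen (U a))
    (g : ∀ a, specMonoid L (dualMonoid (C a)) ⟶ U a) (hg : ∀ a, IsIntegralHom (g a))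
    (hgp : ∀ a, specMap L (dualMonoid (C a)).subtype ≫ g a ≫ (U a).ι = p)
    (hinter : ∀ a b, ∃ c, C c = C a ⊓ C b ∧ U c = U a ⊓ U b)
    (hcov : closure (Set.range p) ⊆ ⋃ a, (U a : Set F)) :
    ∃ (V : ToricVariety L Λ Φ) (ν : V.X ⟶ F), V.torus ≫ ν = p ∧
      IsNormalizationOf ν (closure (Set.range p)) := by
  have hqc : QuasiCompact p := quasiCompact_of_noetherianSpace p
  have hqs : QuasiSeparated p := .of_quasiSeparatedSpace p
  have hchart (a : I) := exists_normalization_chart p (hU a)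
    (CommRingCat.ofHom (AddMonoidAlgebra.mapDomainRingHom L (dualMonoid (C a)).subtype))
    (mapDomainRingHom_injective Subtype.val_injective)
    (fun x hx => mem_range_of_isIntegralElem (hΦ.polyhedral _ (hC a)) hx) (g a) (hgp a)
  choose ct hct1 hct2 hct3 hct4 using hchart
  let Y := p.normalization
  let ν : Y ⟶ F := p.fromNormalization
  let t : specMonoid L Λ ⟶ Y := p.toNormalization
  have htν : t ≫ ν = p := p.toNormalization_fromNormalization
  have hct3' (a : I) : specMap L (dualMonoid (C a)).subtype ≫ ct a = t := hct3 a
  have hcompat {a b : I} (h : C b ≤ C a) : specMap L (dualIncl h) ≫ ct a = ct b := by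
    have hd := isDominant_specMap_dualMonoid_subtype L (C b)
    refine ext_of_isDominant_of_isSeparated ν ?_ (specMap L (dualMonoid (C b)).subtype) ?_
    · rw [Category.assoc, hct2, hct2, dualIncl_comp_eq_of_charts p hU g hgp hinter]
    · rw [← Category.assoc, specMap_comp, subtype_comp_dualIncl, hct3', hct3']
  have hctrange {a b : I} (h : C b = C a) : Set.range (ct a) = Set.range (ct b) := by
    have := isIso_specMap_dualIncl L h.le h.ge
    rw [← hcompat h.le, range_isIso_comp]
  choose α hα using hC'
  let chart (σ : RealCone Λ) (hσ : σ ∈ Φ) : specMonoid L (dualMonoid σ) ⟶ Y :=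
    specMap L (dualIncl (hα σ hσ).ge) ≫ ct (α σ hσ)
  have hchartopen (σ : RealCone Λ) (hσ : σ ∈ Φ) : IsOpenImmersion (chart σ hσ) := by
    have := isIso_specMap_dualIncl L (hα σ hσ).ge (hα σ hσ).le
    infer_instance
  have hchartrange (σ : RealCone Λ) (hσ : σ ∈ Φ) :
      Set.range (chart σ hσ) = Set.range (ct (α σ hσ)) := by
    have := isIso_specMap_dualIncl L (hα σ hσ).ge (hα σ hσ).le
    exact range_isIso_comp _ _
  have hchartt (σ : RealCone Λ) (hσ : σ ∈ Φ) :
      specMap L (dualMonoid σ).subtype ≫ chart σ hσ = t := by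
    rw [← Category.assoc, specMap_comp, subtype_comp_dualIncl, hct3']
  have hνrange : Set.range ν = closure (Set.range p) := by
    have h1 : IsClosed (Set.range ν) := ν.isClosedMap.isClosed_range
    refine subset_antisymm ?_ (closure_minimal ?_ h1)
    · rintro _ ⟨y, rfl⟩
      have h2 : y ∈ closure (Set.range t) := t.denseRange y
      have h3 := image_closure_subset_closure_image ν.continuous ⟨y, h2, rfl⟩
      rwa [← Set.range_comp, ← TopCat.coe_comp, ← Scheme.Hom.comp_base, htν] at h3
    · rw [← htν, Scheme.Hom.comp_base, TopCat.coe_comp]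
      exact Set.range_comp_subset_range _ _
  have hcover (y : Y) : ∃ σ hσ, y ∈ Set.range (chart σ hσ) := by
    obtain ⟨a, ha⟩ := Set.mem_iUnion.1 (hcov (hνrange ▸ Set.mem_range_self (f := ν) y))
    refine ⟨C a, hC a, ?_⟩
    rw [hchartrange, hctrange (hα (C a) (hC a)).symm, hct4]
    exact ha
  -- the structure morphism over `L` exists by the universal property of the normalization, applied
  -- to the integral morphism `F_L → F`
  let e : Spec (.of L) ⟶ Spec (.of k) := Spec.map (CommRingCat.ofHom (algebraMap k L))
  have he : IsIntegralHom e := by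
    rw [IsIntegralHom.SpecMap_iff]
    exact algebraMap_isIntegral_iff.2 inferInstance
  let q : specMonoid L Λ ⟶ pullback s e := pullback.lift p
    (Spec.map (CommRingCat.ofHom (algebraMap L (AddMonoidAlgebra L Λ)))) (by
      rw [hp, ← Spec.map_comp]; rfl)
  have hq : p = q ≫ pullback.fst s e := (pullback.lift_fst _ _ _).symm
  let str : Y ⟶ Spec (.of L) := p.normalizationDesc q (pullback.fst s e) hq ≫ pullback.snd s e
  have hstr : t ≫ str = Spec.map (CommRingCat.ofHom (algebraMap L (AddMonoidAlgebra L Λ))) := by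
    change p.toNormalization ≫ p.normalizationDesc q (pullback.fst s e) hq ≫ pullback.snd s e = _
    rw [Scheme.Hom.toNormalization_normalizationDesc_assoc]
    exact pullback.lift_snd _ _ _
  let V : ToricVariety L Λ Φ :=
    { X := Y
      str := str
      chart := chart
      free := inferInstance
      fg := inferInstance
      isFan := hΦ
      chart_open := hchartopen
      chart_str := fun σ hσ => by
        have hd := isDominant_specMap_dualMonoid_subtype L σ
        refine ext_of_isDominant (ι := specMap L (dualMonoid σ).subtype) ?_
        rw [reassoc_of% hchartt, hstr, specMap_algebraMap]
      chart_face := fun σ hσ τ hτ h => by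
        have h' : τ ≤ σ := h
        have h1 : C (α τ hτ) ≤ C (α σ hσ) := by rwa [hα, hα]
        change specMap L (dualIncl h') ≫ specMap L (dualIncl _) ≫ _ = specMap L (dualIncl _) ≫ _
        rw [← hcompat h1, ← Category.assoc, ← Category.assoc, specMap_comp, specMap_comp,
          dualIncl_comp, dualIncl_comp]
      chart_cover := hcover
      chart_inter := fun σ hσ τ hτ h => by
        obtain ⟨c, hc, hUc⟩ := hinter (α σ hσ) (α τ hτ)
        rw [hα, hα] at hc
        rw [hchartrange, hchartrange, hchartrange, hctrange (hc.trans (hα _ h).symm), hct4, hct4, hct4,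
          hUc]
        rfl }
  refine ⟨V, ν, ?_, ?_⟩
  · change (specMap L _ ≫ chart ⊥ _) ≫ ν = p
    rw [hchartt, htν]
  · have hY : AlgebraicGeometry.IsIntegral Y := inferInstance
    refine ⟨hY, fun y => ?_, inferInstance, hνrange, ?_⟩
    · obtain ⟨σ, hσ, x, rfl⟩ := hcover y
      have := hchartopen σ hσ
      have h1 : IsIntegrallyClosed (AddMonoidAlgebra L (dualMonoid σ)) := 
        isIntegrallyClosed_dualMonoid (hΦ.polyhedral _ hσ)
      exact isIntegrallyClosed_stalk (R := .of (AddMonoidAlgebra L (dualMonoid σ))) (chart σ hσ) x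
    · have : IsImmersion (t ≫ ν) := htν.symm ▸ inferInstance
      have : IsDominant t := inferInstanceAs (IsDominant p.toNormalization)
      exact bijective_residueFieldMap_genericPoint t ν

/-- A toric variety whose fan has a largest cone is the chart of this cone. -/
lemma ToricVariety.isIso_chart {Φ : Set (RealCone Λ)} (V : ToricVariety L Λ Φ) {C : RealCone Λ}
    (hC : C ∈ Φ) (h : ∀ σ ∈ Φ, σ ≤ C) : IsIso (V.chart C hC) := by
  have := V.chart_open C hC
  have : Surjective (V.chart C hC) := by
    refine ⟨fun x => ?_⟩
    obtain ⟨σ, hσ, y, rfl⟩ := V.chart_cover x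
    rw [← V.chart_face C hC σ hσ fun v hv => h σ hσ hv]
    exact ⟨_, (Scheme.Hom.comp_apply _ _ _).symm⟩
  exact isIso_of_isOpenImmersion_of_opensRange_eq_top _ (by
    ext x
    simp)

lemma ToricVariety.subtype_comp_chart {Φ : Set (RealCone Λ)} (V : ToricVariety L Λ Φ) {C : RealCone Λ}
    (hC : C ∈ Φ) : specMap L (dualMonoid C).subtype ≫ V.chart C hC = V.torus := by
  rw [ToricVariety.torus, ← V.chart_face C hC ⊥ V.isFan.bot_mem fun v hv => ?_, ← Category.assoc,
    specMap_comp]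
  · rfl
  · rw [(Submodule.mem_bot ℝ).1 hv]
    exact zero_mem C

lemma IsNormalizationOf.comp_iso {Y' Y F : Scheme.{u}} {ν : Y ⟶ F} {Z : Set F}
    (h : IsNormalizationOf ν Z) (c : Y' ⟶ Y) [IsIso c] : IsNormalizationOf (c ≫ ν) Z := by
  have hY := h.integral
  have := h.integralHom
  have hc := (Scheme.homeoOfIso (asIso c)).surjective
  have hne : Nonempty Y' := ⟨(hc (genericPoint Y)).choose⟩
  have hY' : AlgebraicGeometry.IsIntegral Y' := isIntegral_of_isOpenImmersion c
  refine ⟨hY', fun y => ?_, inferInstance, ?_, ?_⟩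
  · have := h.normal (c y)
    exact .of_equiv (asIso (c.stalkMap y)).commRingCatIsoToRingEquiv
  · rw [range_isIso_comp, h.range_eq]
  · rw [Scheme.residueFieldMap_comp]
    have h1 := h.birational
    rw [← genericPoint_eq_of_isOpenImmersion c] at h1
    have h2 : IsIso (c.residueFieldMap (genericPoint Y')) := inferInstance
    exact ((asIso (c.residueFieldMap (genericPoint Y'))).commRingCatIsoToRingEquiv.bijective).comp h1

end Gluing

/-! ### Torus orbits of a toric variety -/

section FaceHom

variable {k P R : Type u} [Field k] [AddCommMonoid P] [CommRing R] [Algebra k R]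

open Classical in
/-- The ring homomorphism `k[P] → R` that maps `χ^m` to `u m` if `m` lies in the face `A` of the
monoid `P`, and to zero otherwise. -/
noncomputable def faceHom (k : Type u) [Field k] [Algebra k R] (A : P → Prop) (u : P → R) (h0 : A 0)
    (hu0 : u 0 = 1) (hadd : ∀ a b, A (a + b) ↔ A a ∧ A b)
    (hu : ∀ a b, A a → A b → u (a + b) = u a * u b) : AddMonoidAlgebra k P →ₐ[k] R :=
  AddMonoidAlgebra.lift k R P
    { toFun := fun m => if A m.toAdd then u m.toAdd else 0
      map_one' := by rw [toAdd_one, if_pos h0, hu0]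
      map_mul' := fun a b => by
        rw [toAdd_mul]
        by_cases h1 : A a.toAdd <;> by_cases h2 : A b.toAdd <;> simp [hadd, h1, h2, hu] }

open Classical in
lemma faceHom_single (A : P → Prop) (u : P → R) (h0 : A 0) (hu0 : u 0 = 1)
    (hadd : ∀ a b, A (a + b) ↔ A a ∧ A b) (hu : ∀ a b, A a → A b → u (a + b) = u a * u b)
    (m : P) (c : k) :
    faceHom k A u h0 hu0 hadd hu (AddMonoidAlgebra.single m c) =
      if A m then algebraMap k R c * u m else 0 := by
  rw [faceHom, AddMonoidAlgebra.lift_single]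
  by_cases h : A m <;> simp [h, Algebra.smul_def]

open Classical in
lemma orbitRingHom_single {M : Type u} [AddCommGroup M] (κ : RealCone M) (m : dualMonoid κ) (c : k) :
    orbitRingHom k κ (AddMonoidAlgebra.single m c) =
      if h : (m : M) ∈ perp κ then AddMonoidAlgebra.single ⟨m, h⟩ c else 0 := by
  rw [orbitRingHom, AddMonoidAlgebra.lift_single]
  by_cases h : (m : M) ∈ perp κ <;> simp [h]

lemma ringHom_ext_single {S : Type*} [Semiring S] {f g : AddMonoidAlgebra k P →+* S}
    (h : ∀ m c, f (AddMonoidAlgebra.single m c) = g (AddMonoidAlgebra.single m c)) : f = g :=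
  AddMonoidAlgebra.ringHom_ext (fun c => h 0 c) (fun m => h m 1)

end FaceHom

section Vanishing

variable {k : Type u} [Field k] {P Q : Type u} [AddCommMonoid P] [AddCommMonoid Q]

/-- The monomial `χ^m` vanishes at the point `y` of `Spec k[P]`. -/
def VanishesAt (y : specMonoid k P) (m : P) : Prop :=
  (AddMonoidAlgebra.single m (1 : k)) ∈ PrimeSpectrum.asIdeal (R := AddMonoidAlgebra k P) y

lemma vanishesAt_specMap (φ : P →+ Q) (y : specMonoid k Q) (m : P) :
    VanishesAt (specMap k φ y) m ↔ VanishesAt y (φ m) := by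
  change AddMonoidAlgebra.mapDomainRingHom k φ _ ∈ PrimeSpectrum.asIdeal (R := AddMonoidAlgebra k Q) y ↔ _
  rw [mapDomainRingHom_single]
  rfl

lemma not_vanishesAt_zero (y : specMonoid k P) : ¬ VanishesAt y 0 := fun h =>
  (PrimeSpectrum.isPrime (R := AddMonoidAlgebra k P) y).ne_top ((Ideal.eq_top_iff_one _).2 h)

lemma vanishesAt_add (y : specMonoid k P) (a b : P) :
    VanishesAt y (a + b) ↔ VanishesAt y a ∨ VanishesAt y b := by
  have := (PrimeSpectrum.isPrime (R := AddMonoidAlgebra k P) y).mul_mem_iff_mem_or_mem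
    (x := AddMonoidAlgebra.single a (1 : k)) (y := AddMonoidAlgebra.single b 1)
  rwa [AddMonoidAlgebra.single_mul_single, mul_one] at this

lemma not_vanishesAt_of_isAddUnit (y : specMonoid k P) {m : P} (hm : IsAddUnit m) :
    ¬ VanishesAt y m := by
  obtain ⟨n, hn⟩ := hm.exists_neg
  intro h
  exact not_vanishesAt_zero y (hn ▸ (vanishesAt_add y m n).2 (Or.inl h))

lemma vanishesAt_nsmul (y : specMonoid k P) {m : P} (h : ¬ VanishesAt y m) (n : ℕ) :
    ¬ VanishesAt y (n • m) := by
  induction n with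
  | zero => simpa using not_vanishesAt_zero y
  | succ n ih =>
    rw [succ_nsmul, vanishesAt_add]
    tauto

lemma single_mem_of_vanishesAt {y : specMonoid k P} {m : P} (h : VanishesAt y m) (c : k) :
    AddMonoidAlgebra.single m c ∈ PrimeSpectrum.asIdeal (R := AddMonoidAlgebra k P) y := by
  have := Ideal.mul_mem_left _ (AddMonoidAlgebra.single 0 c) h
  rwa [AddMonoidAlgebra.single_mul_single, zero_add, mul_one] at this

variable {M : Type u} [AddCommGroup M] {σ τ κ : RealCone M}

/-- The point `y` of `U_σ` lies in the orbit attached to the cone `κ`, in terms of the monomials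
that vanish at `y`. -/
def InOrbit (κ : RealCone M) {σ : RealCone M} (y : specMonoid k (dualMonoid σ)) : Prop :=
  ∀ m : dualMonoid σ, VanishesAt y m ↔ (m : M) ∉ perp κ

lemma surjective_orbitRingHom (κ : RealCone M) :
    Function.Surjective (orbitRingHom k κ).toRingHom := by
  intro x
  induction x using monoidAlgebra_induction with
  | h m a =>
    refine ⟨AddMonoidAlgebra.single ⟨m, perp_le_dualMonoid m.2⟩ a, ?_⟩
    change orbitRingHom k κ _ = _
    rw [orbitRingHom_single, dif_pos m.2]
  | hadd x y hx hy =>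
    obtain ⟨x', rfl⟩ := hx
    obtain ⟨y', rfl⟩ := hy
    exact ⟨x' + y', map_add _ _ _⟩

/-- The embedding of the orbit attached to `κ` in the chart `U_σ`, for `κ ≤ σ`. -/
noncomputable def orbitInChart (k : Type u) [Field k] (h : κ ≤ σ) :
    AddMonoidAlgebra k (dualMonoid σ) →+* AddMonoidAlgebra k (perp κ) :=
  (orbitRingHom k κ).toRingHom.comp (AddMonoidAlgebra.mapDomainRingHom k (dualIncl h))

open Classical in
lemma orbitInChart_single (h : κ ≤ σ) (m : dualMonoid σ) (c : k) :
    orbitInChart k h (AddMonoidAlgebra.single m c) =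
      if h : (m : M) ∈ perp κ then AddMonoidAlgebra.single ⟨m, h⟩ c else 0 := by
  rw [orbitInChart, RingHom.comp_apply, mapDomainRingHom_single]
  exact orbitRingHom_single _ _ _

lemma coeff_orbitInChart (h : κ ≤ σ) (x : AddMonoidAlgebra k (dualMonoid σ)) (m : perp κ)
    (hm : (m : M) ∈ dualMonoid σ) : (orbitInChart k h x).coeff m = x.coeff ⟨m, hm⟩ := by
  classical
  induction x using monoidAlgebra_induction with
  | h n a =>
    rw [orbitInChart_single]
    by_cases hn : (n : M) ∈ perp κ
    · rw [dif_pos hn, AddMonoidAlgebra.coeff_single, AddMonoidAlgebra.coeff_single,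
        Finsupp.single_apply, Finsupp.single_apply]
      simp only [Subtype.ext_iff]
    · rw [dif_neg hn, AddMonoidAlgebra.coeff_single, Finsupp.single_apply, if_neg]
      · rfl
      · rintro rfl
        exact hn m.2
  | hadd x y hx hy =>
    rw [map_add, AddMonoidAlgebra.coeff_add, AddMonoidAlgebra.coeff_add, Finsupp.add_apply,
      Finsupp.add_apply, hx, hy]

lemma specMap_orbitInChart (h : κ ≤ σ) :
    Spec.map (CommRingCat.ofHom (orbitInChart k h)) =
      Spec.map (CommRingCat.ofHom (orbitRingHom k κ).toRingHom) ≫ specMap k (dualIncl h) := by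
  rw [specMap, ← Spec.map_comp, ← CommRingCat.ofHom_comp]
  rfl

/-- The closed orbit of `U_κ`. -/
lemma mem_range_orbitRingHom_iff (κ : RealCone M) (y : specMonoid k (dualMonoid κ)) :
    y ∈ Set.range (Spec.map (CommRingCat.ofHom (orbitRingHom k κ).toRingHom)) ↔ InOrbit κ y := by
  constructor
  · rintro ⟨z, rfl⟩ m
    change orbitRingHom k κ (AddMonoidAlgebra.single m 1) ∈
      PrimeSpectrum.asIdeal (R := AddMonoidAlgebra k (perp κ)) z ↔ _
    rw [orbitRingHom_single]
    by_cases h : (m : M) ∈ perp κ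
    · simp only [h, dite_true, not_true, iff_false]
      exact not_vanishesAt_of_isAddUnit z (AddGroup.isAddUnit _)
    · simp [h]
  · intro hy
    let i : perp κ →+ dualMonoid κ :=
      { toFun := fun m => ⟨m, perp_le_dualMonoid m.2⟩, map_zero' := rfl, map_add' := fun _ _ => rfl }
    let s := AddMonoidAlgebra.mapDomainRingHom k i
    have hs (x : AddMonoidAlgebra k (dualMonoid κ)) : x - s (orbitRingHom k κ x) ∈
        PrimeSpectrum.asIdeal (R := AddMonoidAlgebra k (dualMonoid κ)) y := by
      induction x using monoidAlgebra_induction with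
      | h m a =>
        rw [orbitRingHom_single]
        by_cases h : (m : M) ∈ perp κ
        · rw [dif_pos h, mapDomainRingHom_single]
          simp [i]
        · rw [dif_neg h, map_zero, sub_zero]
          exact single_mem_of_vanishesAt ((hy m).2 h) a
      | hadd a b ha hb =>
        rw [map_add, map_add, add_sub_add_comm]
        exact add_mem ha hb
    change y ∈ Set.range (PrimeSpectrum.comap (orbitRingHom k κ).toRingHom)
    rw [range_comap_of_surjective _ _ (surjective_orbitRingHom κ)]
    intro x hx
    have h1 := hs x
    have hx' : orbitRingHom k κ x = 0 := hx
    rwa [hx', map_zero, sub_zero] at h1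

/-- The points of `U_σ` that lie in `U_τ`, for a face `τ` of `σ`: there is a monomial `χ^{m₀}` with
`m₀ ∈ σ^∨ ∩ τ^⊥` that does not vanish exactly at these points. -/
lemma mem_range_specMap_dualIncl [Module.Free ℤ M] [Module.Finite ℤ M] (hσ : IsRationalPolyhedral σ)
    (h : τ.IsFaceOf σ) :
    ∃ m₀ : dualMonoid σ, (m₀ : M) ∈ perp τ ∧ (∀ v ∈ σ, v m₀ = 0 → v ∈ τ) ∧
      (∀ m ∈ dualMonoid τ, ∃ N : ℕ, m + N • (m₀ : M) ∈ dualMonoid σ) ∧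
      ∀ y : specMonoid k (dualMonoid σ),
        y ∈ Set.range (specMap k (dualIncl h.le)) ↔ ¬ VanishesAt y m₀ := by
  obtain ⟨m₀, h1, h2, h3, h4⟩ := hσ.exists_add_nsmul_mem_dualMonoid_of_isFaceOf h
  refine ⟨⟨m₀, h1⟩, h2, h3, h4, fun y => ?_⟩
  have hu : IsAddUnit (dualIncl h.le ⟨m₀, h1⟩) :=
    IsAddUnit.of_add_eq_zero ⟨-m₀, perp_le_dualMonoid (neg_mem h2)⟩ (Subtype.ext (add_neg_cancel m₀))
  let := (AddMonoidAlgebra.mapDomainRingHom k (dualIncl h.le)).toAlgebra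
  have hloc : IsLocalization.Away (AddMonoidAlgebra.single (⟨m₀, h1⟩ : dualMonoid σ) (1 : k))
      (AddMonoidAlgebra k (dualMonoid τ)) := by
    refine isLocalization_away_mapDomainRingHom (φ := dualIncl h.le) (fun a b hab => ?_) _ hu
      fun q => ?_
    · exact Subtype.ext (congrArg Subtype.val hab :)
    · obtain ⟨N, hN⟩ := h4 q q.2
      exact ⟨N, ⟨_, hN⟩, rfl⟩
  have := PrimeSpectrum.localization_away_comap_range (AddMonoidAlgebra k (dualMonoid τ))
    (AddMonoidAlgebra.single (⟨m₀, h1⟩ : dualMonoid σ) (1 : k))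
  change y ∈ Set.range (PrimeSpectrum.comap (algebraMap _ (AddMonoidAlgebra k (dualMonoid τ)))) ↔ _
  rw [this]
  rfl

/-- Every point of `U_σ` lies in the orbit of some face of `σ`. -/
lemma exists_inOrbit [Module.Free ℤ M] [Module.Finite ℤ M] (hσ : IsRationalPolyhedral σ)
    (y : specMonoid k (dualMonoid σ)) : ∃ κ : RealCone M, κ.IsFaceOf σ ∧ InOrbit κ y := by
  obtain ⟨κ, hκ, h⟩ := hσ.exists_isFaceOf_of_addSubmonoid
    {m | ∃ h : m ∈ dualMonoid σ, ¬ VanishesAt y ⟨m, h⟩} (fun m hm => hm.1)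
    ⟨zero_mem _, not_vanishesAt_zero y⟩ (fun a ha b hb => by
      have := vanishesAt_add y ⟨a, ha⟩ ⟨b, hb⟩
      constructor
      · rintro ⟨h1, h2⟩
        exact ⟨⟨ha, fun h => h2 (this.2 (Or.inl h))⟩, ⟨hb, fun h => h2 (this.2 (Or.inr h))⟩⟩
      · rintro ⟨⟨_, h1⟩, ⟨_, h2⟩⟩
        exact ⟨add_mem ha hb, fun h => (this.1 h).elim h1 h2⟩)
  refine ⟨κ, hκ, fun m => ?_⟩
  rw [h m m.2]
  simp

/-- A point of the orbit attached to a face `κ` lies in the chart `U_κ`. -/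
lemma InOrbit.exists_eq [Module.Free ℤ M] [Module.Finite ℤ M] (hσ : IsRationalPolyhedral σ)
    (hκ : κ.IsFaceOf σ) {y : specMonoid k (dualMonoid σ)} (hy : InOrbit κ y) :
    ∃ y' : specMonoid k (dualMonoid κ), specMap k (dualIncl hκ.le) y' = y ∧
      InOrbit κ y' := by
  obtain ⟨m₀, h1, -, h3, h4⟩ := mem_range_specMap_dualIncl (k := k) hσ hκ
  obtain ⟨y', rfl⟩ := (h4 y).2 (by rw [hy]; exact not_not.2 h1)
  refine ⟨y', rfl, fun m => ?_⟩
  have hu : ¬ VanishesAt y' (dualIncl hκ.le m₀) := by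
    rw [← vanishesAt_specMap, hy]
    exact not_not.2 h1
  obtain ⟨N, hN⟩ := h3 m m.2
  have h5 := hy ⟨_, hN⟩
  rw [vanishesAt_specMap] at h5
  have h6 : dualIncl hκ.le ⟨_, hN⟩ = m + N • dualIncl hκ.le m₀ := rfl
  rw [h6, vanishesAt_add, or_iff_left (vanishesAt_nsmul y' hu N)] at h5
  rw [h5, not_iff_not]
  exact (perp κ).add_mem_cancel_right (AddSubgroup.nsmul_mem _ h1 N)

end Vanishing

section ToricVariety

variable {k : Type u} [Field k] {M : Type u} [AddCommGroup M] {Δ : Set (RealCone M)}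
  (V : ToricVariety k M Δ)

namespace ToricVariety

lemma injective_chart (σ : RealCone M) (hσ : σ ∈ Δ) : Function.Injective (V.chart σ hσ) := by
  have := V.chart_open σ hσ
  exact (V.chart σ hσ).isOpenEmbedding.injective

lemma dualIncl_chart {σ τ : RealCone M} (hσ : σ ∈ Δ) (hτ : τ ∈ Δ) (h : τ ≤ σ) :
    specMap k (dualIncl h) ≫ V.chart σ hσ = V.chart τ hτ :=
  V.chart_face σ hσ τ hτ fun _ hv => h hv

lemma dualIncl_chart_apply {σ τ : RealCone M} (hσ : σ ∈ Δ) (hτ : τ ∈ Δ) (h : τ ≤ σ)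
    (y : specMonoid k (dualMonoid τ)) :
    V.chart σ hσ (specMap k (dualIncl h) y) = V.chart τ hτ y := by
  rw [← V.dualIncl_chart hσ hτ h, Scheme.Hom.comp_apply]

lemma range_chart_mono {σ τ : RealCone M} (hσ : σ ∈ Δ) (hτ : τ ∈ Δ) (h : τ ≤ σ) :
    Set.range (V.chart τ hτ) ⊆ Set.range (V.chart σ hσ) := by
  rintro _ ⟨y, rfl⟩
  exact ⟨_, V.dualIncl_chart_apply hσ hτ h y⟩

lemma mem_range_orbitMap_of_inOrbit_self {κ : RealCone M} (hκ : κ ∈ Δ)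
    {y : specMonoid k (dualMonoid κ)} (hy : InOrbit κ y) :
    V.chart κ hκ y ∈ Set.range (V.orbitMap κ hκ) := by
  obtain ⟨z, rfl⟩ := (mem_range_orbitRingHom_iff κ y).2 hy
  exact ⟨z, Scheme.Hom.comp_apply _ _ _⟩

lemma mem_range_orbitMap_of_inOrbit {σ κ : RealCone M} (hσ : σ ∈ Δ) (hκ : κ ∈ Δ) (h : κ ≤ σ)
    {y : specMonoid k (dualMonoid σ)} (hy : InOrbit κ y) :
    V.chart σ hσ y ∈ Set.range (V.orbitMap κ hκ) := by
  have := V.free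
  have := V.fg
  obtain ⟨y', rfl, hy'⟩ := hy.exists_eq (V.isFan.polyhedral σ hσ) (V.isFan.isFaceOf hσ hκ h)
  rw [V.dualIncl_chart_apply hσ hκ]
  exact V.mem_range_orbitMap_of_inOrbit_self hκ hy'

lemma exists_inOrbit_of_mem_range_orbitMap {κ : RealCone M} (hκ : κ ∈ Δ) {x : V.X}
    (hx : x ∈ Set.range (V.orbitMap κ hκ)) :
    ∃ y : specMonoid k (dualMonoid κ), V.chart κ hκ y = x ∧ InOrbit κ y := by
  obtain ⟨z, rfl⟩ := hx
  exact ⟨_, (Scheme.Hom.comp_apply _ _ _).symm, (mem_range_orbitRingHom_iff κ _).1 ⟨z, rfl⟩⟩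

/-- If a point of the torus orbit attached to `κ` lies in the chart `U_{κ'}`, then `κ ≤ κ'`. -/
lemma le_of_chart_eq_chart {κ κ' : RealCone M} (hκ : κ ∈ Δ) (hκ' : κ' ∈ Δ)
    {y : specMonoid k (dualMonoid κ)} (hy : InOrbit κ y) {y' : specMonoid k (dualMonoid κ')}
    (h : V.chart κ hκ y = V.chart κ' hκ' y') : κ ≤ κ' := by
  have := V.free
  have := V.fg
  have hρ : κ ⊓ κ' ∈ Δ := V.isFan.face_mem κ hκ _ (V.isFan.inter_face κ hκ κ' hκ')
  obtain ⟨w, hw⟩ := V.chart_inter κ hκ κ' hκ' hρ ⟨⟨y, rfl⟩, ⟨y', h.symm⟩⟩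
  obtain ⟨m₀, h1, h2, -, h4⟩ := mem_range_specMap_dualIncl (k := k) (V.isFan.polyhedral κ hκ)
    (V.isFan.inter_face κ hκ κ' hκ')
  have h5 : specMap k (dualIncl inf_le_left) w = y :=
    V.injective_chart κ hκ (by rw [V.dualIncl_chart_apply hκ hρ, hw])
  have h6 : ¬ VanishesAt y m₀ := (h4 y).1 ⟨w, h5⟩
  rw [hy, not_not] at h6
  exact fun v hv => (h2 v hv (h6 v hv)).2

lemma orbit_unique {κ κ' : RealCone M} (hκ : κ ∈ Δ) (hκ' : κ' ∈ Δ) {x : V.X}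
    (hx : x ∈ Set.range (V.orbitMap κ hκ)) (hx' : x ∈ Set.range (V.orbitMap κ' hκ')) : κ = κ' := by
  obtain ⟨y, rfl, hy⟩ := V.exists_inOrbit_of_mem_range_orbitMap hκ hx
  obtain ⟨y', h, hy'⟩ := V.exists_inOrbit_of_mem_range_orbitMap hκ' hx'
  exact le_antisymm (V.le_of_chart_eq_chart hκ hκ' hy h.symm)
    (V.le_of_chart_eq_chart hκ' hκ hy' h)

/-- If the orbit attached to `κ` meets the chart `U_σ`, then `κ ≤ σ`. -/
lemma inOrbit_of_mem_range_orbitMap {σ κ : RealCone M} (hσ : σ ∈ Δ) (hκ : κ ∈ Δ)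
    {y : specMonoid k (dualMonoid σ)} (hy : V.chart σ hσ y ∈ Set.range (V.orbitMap κ hκ)) :
    κ ≤ σ ∧ InOrbit κ y := by
  have := V.free
  have := V.fg
  obtain ⟨κ', hκ', hy'⟩ := exists_inOrbit (V.isFan.polyhedral σ hσ) y
  have hmem := V.isFan.face_mem σ hσ κ' hκ'
  obtain rfl := V.orbit_unique hκ hmem hy (V.mem_range_orbitMap_of_inOrbit hσ hmem hκ'.le hy')
  exact ⟨hκ'.le, hy'⟩

lemma exists_mem_range_orbitMap (x : V.X) : ∃ κ hκ, x ∈ Set.range (V.orbitMap κ hκ) := by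
  have := V.free
  have := V.fg
  obtain ⟨σ, hσ, y, rfl⟩ := V.chart_cover x
  obtain ⟨κ, hκ, hy⟩ := exists_inOrbit (V.isFan.polyhedral σ hσ) y
  have hmem := V.isFan.face_mem σ hσ κ hκ
  exact ⟨κ, hmem, V.mem_range_orbitMap_of_inOrbit hσ hmem hκ.le hy⟩

instance isImmersion_orbitMap (κ : RealCone M) (hκ : κ ∈ Δ) : IsImmersion (V.orbitMap κ hκ) := by
  have := V.chart_open κ hκ
  have : IsClosedImmersion (Spec.map (CommRingCat.ofHom (orbitRingHom k κ).toRingHom)) :=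
    IsClosedImmersion.spec_of_surjective _ (surjective_orbitRingHom κ)
  rw [orbitMap]
  infer_instance

/-- The orbit attached to `κ`, seen in a chart `U_σ` with `κ ≤ σ`. -/
lemma orbitMap_eq {σ κ : RealCone M} (hσ : σ ∈ Δ) (hκ : κ ∈ Δ) (h : κ ≤ σ) :
    V.orbitMap κ hκ = Spec.map (CommRingCat.ofHom (orbitInChart k h)) ≫ V.chart σ hσ := by
  rw [specMap_orbitInChart, Category.assoc, V.dualIncl_chart hσ hκ, orbitMap]

/-- The closure relation between orbits. -/
lemma orbitMap_mem_closure {κ κ' : RealCone M} (hκ : κ ∈ Δ) (hκ' : κ' ∈ Δ) (h : κ' ≤ κ) :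
    Set.range (V.orbitMap κ hκ) ⊆ closure (Set.range (V.orbitMap κ' hκ')) := by
  intro x hx
  obtain ⟨y, rfl, hy⟩ := V.exists_inOrbit_of_mem_range_orbitMap hκ hx
  have h1 : y ∈ closure (Set.range (Spec.map (CommRingCat.ofHom (orbitInChart k h)))) := by
    change y ∈ closure (Set.range (PrimeSpectrum.comap (orbitInChart k h)))
    rw [PrimeSpectrum.closure_range_comap]
    intro z hz
    have hz' : orbitInChart k h z = 0 := hz
    obtain ⟨w, rfl⟩ := (mem_range_orbitRingHom_iff κ y).2 hy
    change orbitRingHom k κ z ∈ PrimeSpectrum.asIdeal (R := AddMonoidAlgebra k (perp κ)) w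
    have h0 : orbitInChart k le_rfl z = 0 := by
      ext m
      rw [coeff_orbitInChart le_rfl z m (perp_le_dualMonoid m.2),
        ← coeff_orbitInChart h z ⟨m, perp_anti h m.2⟩ (perp_le_dualMonoid m.2), hz']
      rfl
    have h2 : orbitInChart k le_rfl z = orbitRingHom k κ z := by
      rw [orbitInChart, dualIncl_refl, AddMonoidAlgebra.mapDomainRingHom_id]
      rfl
    rw [← h2, h0]
    exact zero_mem _
  rw [V.orbitMap_eq hκ hκ' h, Scheme.Hom.comp_base, TopCat.coe_comp, Set.range_comp]
  exact image_closure_subset_closure_image (V.chart κ hκ).continuous ⟨y, h1, rfl⟩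

/-- If the closure of the orbit attached to `κ'` meets the orbit attached to `κ`, it contains it. -/
lemma range_orbitMap_subset_closure {κ κ' : RealCone M} (hκ : κ ∈ Δ) (hκ' : κ' ∈ Δ) {x : V.X}
    (hx : x ∈ Set.range (V.orbitMap κ hκ)) (hx' : x ∈ closure (Set.range (V.orbitMap κ' hκ'))) :
    Set.range (V.orbitMap κ hκ) ⊆ closure (Set.range (V.orbitMap κ' hκ')) := by
  obtain ⟨y, rfl, hy⟩ := V.exists_inOrbit_of_mem_range_orbitMap hκ hx
  have := V.chart_open κ hκ
  obtain ⟨_, ⟨y', rfl⟩, hy'⟩ := mem_closure_iff.1 hx' _ (V.chart κ hκ).isOpenEmbedding.isOpen_range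
    ⟨y, rfl⟩
  exact V.orbitMap_mem_closure hκ hκ' (V.inOrbit_of_mem_range_orbitMap hκ hκ' hy').1

lemma inOrbit_act_iff {σ κ : RealCone M} (z : specMonoid k (M × dualMonoid σ)) :
    InOrbit κ (specMap k ((dualMonoid σ).subtype.prod (AddMonoidHom.id (dualMonoid σ))) z) ↔
      InOrbit κ (specMap k (AddMonoidHom.inr M (dualMonoid σ)) z) := by
  refine forall_congr' fun m => ?_
  rw [vanishesAt_specMap, vanishesAt_specMap]
  have h1 : ((dualMonoid σ).subtype.prod (AddMonoidHom.id (dualMonoid σ))) m =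
    ((m : M), 0) + AddMonoidHom.inr M (dualMonoid σ) m := by simp
  rw [h1, vanishesAt_add, or_iff_right]
  exact not_vanishesAt_of_isAddUnit z (IsAddUnit.of_add_eq_zero (-(m : M), 0) (by simp))

open TensorProduct in
/-- The torus `Spec k[M]` acts transitively on the closed orbit of `U_κ`. Since the points `x` and `y` need
not be rational, the element of the torus is found on `O_κ × O_κ`: a retraction `r` from `M` to
`κ^⊥` gives a section of `T → O_κ`, which maps `(x, y)` to a lift of `y / x`. -/
lemma exists_act {κ : RealCone M} [Module.Free ℤ M] [Module.Finite ℤ M]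
    {x y : specMonoid k (dualMonoid κ)} (hx : InOrbit κ x) (hy : InOrbit κ y) :
    ∃ z : specMonoid k (M × dualMonoid κ),
      specMap k (AddMonoidHom.inr M (dualMonoid κ)) z = x ∧
      specMap k ((dualMonoid κ).subtype.prod (AddMonoidHom.id (dualMonoid κ))) z = y := by
  obtain ⟨x, rfl⟩ := (mem_range_orbitRingHom_iff κ x).2 hx
  obtain ⟨y, rfl⟩ := (mem_range_orbitRingHom_iff κ y).2 hy
  obtain ⟨r, hr⟩ := exists_retraction_perp κ
  let A := AddMonoidAlgebra k (perp κ)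
  let e := Spec.map (CommRingCat.ofHom (algebraMap k A))
  obtain ⟨w, hw1, hw2⟩ := Scheme.Pullback.exists_preimage_pullback (f := e) (g := e) x y
    (Subsingleton.elim (α := PrimeSpectrum k) _ _)
  let Θ : AddMonoidAlgebra k (M × dualMonoid κ) →ₐ[k] A ⊗[k] A :=
    faceHom k (fun p => (p.2 : M) ∈ perp κ)
      (fun p => AddMonoidAlgebra.single (r p.2 - r p.1) 1 ⊗ₜ AddMonoidAlgebra.single (r p.1) 1)
      (zero_mem _) (by simp only [Prod.fst_zero, Prod.snd_zero, ZeroMemClass.coe_zero, map_zero, sub_zero]; rfl)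
      (fun a b => add_mem_perp_iff le_rfl a.2.2 b.2.2) (fun a b _ _ => by
        rw [Algebra.TensorProduct.tmul_mul_tmul, AddMonoidAlgebra.single_mul_single,
          AddMonoidAlgebra.single_mul_single, mul_one]
        simp only [Prod.fst_add, Prod.snd_add, AddSubmonoid.coe_add, map_add]
        congr 3
        abel)
  have hΘ1 : Θ.toRingHom.comp (AddMonoidAlgebra.mapDomainRingHom k (AddMonoidHom.inr M (dualMonoid κ))) =
      (Algebra.TensorProduct.includeLeftRingHom (R := k) (A := A) (B := A)).comp (orbitRingHom k κ).toRingHom := by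
    refine ringHom_ext_single fun m c => ?_
    rw [RingHom.comp_apply, RingHom.comp_apply, mapDomainRingHom_single]
    change Θ (AddMonoidAlgebra.single _ _) = Algebra.TensorProduct.includeLeftRingHom (orbitRingHom k κ _)
    rw [orbitRingHom_single, faceHom_single]
    by_cases h : (m : M) ∈ perp κ
    · refine (if_pos h).trans ?_
      rw [dif_pos h, ← Algebra.smul_def, TensorProduct.smul_tmul',
        AddMonoidAlgebra.smul_single, smul_eq_mul, mul_one]
      simp only [AddMonoidHom.inr_apply, map_zero, sub_zero]
      rw [show r (m : M) = ⟨m, h⟩ from hr ⟨m, h⟩]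
      rfl
    · simp [h]
  have hΘ2 : Θ.toRingHom.comp (AddMonoidAlgebra.mapDomainRingHom k
      ((dualMonoid κ).subtype.prod (AddMonoidHom.id (dualMonoid κ)))) =
      (Algebra.TensorProduct.includeRight (R := k) (A := A) (B := A)).toRingHom.comp
        (orbitRingHom k κ).toRingHom := by
    refine ringHom_ext_single fun m c => ?_
    rw [RingHom.comp_apply, RingHom.comp_apply, mapDomainRingHom_single]
    change Θ (AddMonoidAlgebra.single _ _) = Algebra.TensorProduct.includeRight (orbitRingHom k κ _)
    rw [orbitRingHom_single, faceHom_single]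
    by_cases h : (m : M) ∈ perp κ
    · refine (if_pos h).trans ?_
      rw [dif_pos h, ← Algebra.smul_def, ← TensorProduct.tmul_smul,
        AddMonoidAlgebra.smul_single, smul_eq_mul, mul_one]
      simp only [AddMonoidHom.prod_apply, AddMonoidHom.id_apply, AddSubmonoid.coe_subtype, sub_self]
      rw [show r (m : M) = ⟨m, h⟩ from hr ⟨m, h⟩]
      rfl
    · simp [h]
  refine ⟨Spec.map (CommRingCat.ofHom Θ.toRingHom) ((pullbackSpecIso k A A).hom w), ?_, ?_⟩
  · rw [← hw1, ← pullbackSpecIso_hom_fst, ← Scheme.Hom.comp_apply, ← Scheme.Hom.comp_apply,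
      ← Scheme.Hom.comp_apply, specMap, Category.assoc, ← Spec.map_comp, ← Spec.map_comp]
    exact congrArg (fun f => ((pullbackSpecIso k A A).hom ≫ Spec.map (CommRingCat.ofHom f)) w) hΘ1
  · rw [← hw2, ← pullbackSpecIso_hom_snd, ← Scheme.Hom.comp_apply, ← Scheme.Hom.comp_apply,
      ← Scheme.Hom.comp_apply, specMap, Category.assoc, ← Spec.map_comp, ← Spec.map_comp]
    exact congrArg (fun f => ((pullbackSpecIso k A A).hom ≫ Spec.map (CommRingCat.ofHom f)) w) hΘ2

/-- The torus orbits are the images of the immersions `orbitMap`. -/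
lemma orbit_eq {κ : RealCone M} (hκ : κ ∈ Δ) {x : V.X} (hx : x ∈ Set.range (V.orbitMap κ hκ)) :
    V.orbit x = Set.range (V.orbitMap κ hκ) := by
  have := V.free
  have := V.fg
  ext y
  constructor
  · rintro ⟨σ, hσ, z, rfl, rfl⟩
    rw [Scheme.Hom.comp_apply] at hx ⊢
    obtain ⟨h1, h2⟩ := V.inOrbit_of_mem_range_orbitMap hσ hκ hx
    exact V.mem_range_orbitMap_of_inOrbit hσ hκ h1 ((inOrbit_act_iff z).2 h2)
  · intro hy
    obtain ⟨x, rfl, hx'⟩ := V.exists_inOrbit_of_mem_range_orbitMap hκ hx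
    obtain ⟨y, rfl, hy'⟩ := V.exists_inOrbit_of_mem_range_orbitMap hκ hy
    obtain ⟨z, rfl, rfl⟩ := exists_act hx' hy'
    exact ⟨κ, hκ, z, Scheme.Hom.comp_apply _ _ _, Scheme.Hom.comp_apply _ _ _⟩

end ToricVariety

section ToricMorphism

variable {MB : Type u} [AddCommGroup MB] {ΔB : Set (RealCone MB)} {V}
  {B : ToricVariety k MB ΔB} {φ : MB →+ M} {f : V.X ⟶ B.X}

lemma specMap_dualMonoidMap_dualIncl {σ : RealCone M} {τ τ' : RealCone MB}
    (h : ∀ v ∈ σ, pull φ v ∈ τ) (h' : τ ≤ τ') :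
    specMap k (dualMonoidMap φ h) ≫ specMap k (dualIncl h') =
      specMap k (dualMonoidMap φ (τ := τ') fun v hv => h' (h v hv)) :=
  specMap_comp _ _ _

/-- A toric morphism is given on charts by the map of character lattices, for any cone of the
target that contains the image of the given cone of the source. -/
lemma IsToricMorphism.chart_comp (hf : IsToricMorphism V B φ f) {σ : RealCone M} (hσ : σ ∈ Δ)
    {τ : RealCone MB} (hτ : τ ∈ ΔB) (h : ∀ v ∈ σ, pull φ v ∈ τ) :
    V.chart σ hσ ≫ f = specMap k (dualMonoidMap φ h) ≫ B.chart τ hτ := by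
  obtain ⟨τ', hτ', h', hf'⟩ := hf σ hσ
  have h'' : ∀ v ∈ σ, pull φ v ∈ τ ⊓ τ' := fun v hv => ⟨h v hv, h' v hv⟩
  have hmem := B.isFan.inf_mem hτ hτ'
  rw [hf', ← specMap_dualMonoidMap_dualIncl h'' inf_le_left,
    ← specMap_dualMonoidMap_dualIncl h'' inf_le_right, Category.assoc, Category.assoc,
    B.dualIncl_chart _ hmem, B.dualIncl_chart _ hmem]

/-- The orbit attached to `κ` is mapped to an orbit, attached to the smallest cone `κB` that
contains the image of `κ`. -/
lemma IsToricMorphism.exists_orbit (hf : IsToricMorphism V B φ f) {κ : RealCone M} (hκ : κ ∈ Δ) :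
    ∃ (κB : RealCone MB) (hκB : κB ∈ ΔB) (h : ∀ v ∈ κ, pull φ v ∈ κB),
      (∀ m ∈ dualMonoid κB, φ m ∈ perp κ → m ∈ perp κB) ∧
      V.orbitMap κ hκ ≫ f = specMap k (perpMap φ h) ≫ B.orbitMap κB hκB := by
  have := V.free
  have := V.fg
  have := B.free
  have := B.fg
  obtain ⟨τ, hτ, hκτ, -⟩ := hf κ hκ
  -- a point of the orbit
  have : Nontrivial (AddMonoidAlgebra k (perp κ)) := inferInstance
  obtain ⟨z⟩ : Nonempty (PrimeSpectrum (AddMonoidAlgebra k (perp κ))) := inferInstance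
  let y := Spec.map (CommRingCat.ofHom (orbitRingHom k κ).toRingHom) z
  have hy : InOrbit κ y := (mem_range_orbitRingHom_iff κ y).1 ⟨z, rfl⟩
  obtain ⟨κB, hface, hw⟩ := exists_inOrbit (B.isFan.polyhedral τ hτ)
    (specMap k (dualMonoidMap φ hκτ) y)
  have hκB := B.isFan.face_mem τ hτ κB hface
  have hiff (m : MB) (hm : m ∈ dualMonoid τ) : φ m ∈ perp κ ↔ m ∈ perp κB := by
    have h1 := hw ⟨m, hm⟩
    rw [vanishesAt_specMap, hy] at h1
    exact not_iff_not.1 h1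
  obtain ⟨m₀, h1, h2, h3, h4⟩ :=
    (B.isFan.polyhedral τ hτ).exists_add_nsmul_mem_dualMonoid_of_isFaceOf hface
  have h : ∀ v ∈ κ, pull φ v ∈ κB := fun v hv => h3 _ (hκτ v hv) ((hiff m₀ h1).2 h2 v hv)
  have hmin : ∀ m ∈ dualMonoid κB, φ m ∈ perp κ → m ∈ perp κB := by
    intro m hm hm'
    obtain ⟨N, hN⟩ := h4 m hm
    refine ((perp κB).add_mem_cancel_right (AddSubgroup.nsmul_mem _ h2 N)).1 ((hiff _ hN).1 ?_)
    rw [map_add, map_nsmul]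
    exact add_mem hm' (AddSubgroup.nsmul_mem _ ((hiff m₀ h1).2 h2) N)
  refine ⟨κB, hκB, h, hmin, ?_⟩
  rw [ToricVariety.orbitMap, ToricVariety.orbitMap, Category.assoc, hf.chart_comp hκ hκB h, ← Category.assoc, ← Category.assoc]
  congr 1
  rw [specMap, specMap, ← Spec.map_comp, ← Spec.map_comp, ← CommRingCat.ofHom_comp,
    ← CommRingCat.ofHom_comp]
  congr 2
  refine ringHom_ext_single fun m c => ?_
  rw [RingHom.comp_apply, RingHom.comp_apply, mapDomainRingHom_single]
  change orbitRingHom k κ _ = AddMonoidAlgebra.mapDomainRingHom k (perpMap φ h) (orbitRingHom k κB _)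
  rw [orbitRingHom_single, orbitRingHom_single]
  by_cases hm : (m : MB) ∈ perp κB
  · have hm' : ((dualMonoidMap φ h m : dualMonoid κ) : M) ∈ perp κ := (perpMap φ h ⟨m, hm⟩).2
    rw [dif_pos hm, dif_pos hm', mapDomainRingHom_single]
    rfl
  · have hm' : ((dualMonoidMap φ h m : dualMonoid κ) : M) ∉ perp κ := fun h' => hm (hmin m m.2 h')
    rw [dif_neg hm, dif_neg hm', map_zero]

end ToricMorphism

end ToricVariety

/-! ### Fiber products of immersed subschemes -/

section WidePullback

variable {ι : Type} {B W : Scheme.{u}} {X V : ι → Scheme.{u}}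

/-- The intersection of the preimages of finitely many immersed subschemes. -/
lemma exists_iterated_pullback (Q : MorphismProperty Scheme.{u}) [Q.IsMultiplicative]
    [Q.IsStableUnderBaseChange] {F : Scheme.{u}} (p : ∀ i, F ⟶ X i) (u : ∀ i, V i ⟶ X i)
    (hu : ∀ i, Q (u i)) (s : Finset ι) :
    ∃ (T : Scheme.{u}) (j : T ⟶ F), Q j ∧
      Set.range j = ⋂ i ∈ s, p i ⁻¹' Set.range (u i) ∧
      (∀ i ∈ s, ∃ t, t ≫ u i = j ≫ p i) ∧
      ∀ (S : Scheme.{u}) (q : S ⟶ F), (∀ i ∈ s, ∃ t, t ≫ u i = q ≫ p i) → ∃ r, r ≫ j = q := by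
  classical
  induction s using Finset.induction_on with
  | empty =>
    refine ⟨F, 𝟙 F, Q.id_mem F, ?_, by simp, fun S q _ => ⟨q, Category.comp_id q⟩⟩
    simp
  | insert a s ha ih =>
    obtain ⟨T, j, hj, hrange, hfac, huniv⟩ := ih
    refine ⟨pullback (j ≫ p a) (u a), pullback.fst _ _ ≫ j,
      Q.comp_mem _ _ (Q.pullback_fst _ _ (hu a)) hj, ?_, fun i hi => ?_, fun S q hq => ?_⟩
    · rw [Scheme.Hom.comp_base, TopCat.coe_comp, Set.range_comp, Scheme.Pullback.range_fst,
        Finset.set_biInter_insert, ← hrange]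
      ext x
      constructor
      · rintro ⟨y, hy, rfl⟩
        refine ⟨?_, y, rfl⟩
        rwa [Set.mem_preimage, Scheme.Hom.comp_apply] at hy
      · rintro ⟨hx, y, rfl⟩
        refine ⟨y, ?_, rfl⟩
        rwa [Set.mem_preimage, Scheme.Hom.comp_apply]
    · rcases Finset.mem_insert.1 hi with rfl | hi
      · exact ⟨pullback.snd _ _, by rw [← pullback.condition, Category.assoc]⟩
      · obtain ⟨t, ht⟩ := hfac i hi
        exact ⟨pullback.fst _ _ ≫ t, by rw [Category.assoc, ht, Category.assoc]⟩
    · obtain ⟨r, rfl⟩ := huniv S q fun i hi => hq i (Finset.mem_insert_of_mem hi)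
      obtain ⟨t, ht⟩ := hq a (Finset.mem_insert_self a s)
      exact ⟨pullback.lift r t (by rw [ht, Category.assoc]), by rw [pullback.lift_fst_assoc]⟩

variable [Finite ι] [Nonempty ι]

lemma widePullback_hom_ext {f : ∀ i, X i ⟶ B} {S : Scheme.{u}} {a b : S ⟶ widePullback B X f}
    (h : ∀ i, a ≫ WidePullback.π f i = b ≫ WidePullback.π f i) : a = b := by
  obtain ⟨i⟩ := ‹Nonempty ι›
  refine WidePullback.hom_ext _ _ _ h ?_
  rw [← WidePullback.π_arrow f i, ← Category.assoc, h i, Category.assoc]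

/-- The fiber product of immersed subschemes `V i ⊆ X i` over a subscheme `W ⊆ B` is the
scheme-theoretic intersection of their preimages in the fiber product of the `X i` over `B`. -/
theorem widePullback_map_of_mono (Q : MorphismProperty Scheme.{u}) [Q.IsMultiplicative]
    [Q.IsStableUnderBaseChange] (hQ : Q ≤ MorphismProperty.monomorphisms _)
    {f : ∀ i, X i ⟶ B} {g : ∀ i, V i ⟶ W} {u : ∀ i, V i ⟶ X i} {v : W ⟶ B} [Mono v]
    (hu : ∀ i, Q (u i)) (w : ∀ i, g i ≫ v = u i ≫ f i)
    (r : widePullback W V g ⟶ widePullback B X f)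
    (hr : ∀ i, r ≫ WidePullback.π f i = WidePullback.π g i ≫ u i) :
    Q r ∧ Set.range r = ⋂ i, WidePullback.π f i ⁻¹' Set.range (u i) ∧
      ∀ (S : Scheme.{u}) (s : S ⟶ widePullback B X f) (t : ∀ i, S ⟶ V i),
        (∀ i, s ≫ WidePullback.π f i = t i ≫ u i) → ∃! q, q ≫ r = s := by
  have := Fintype.ofFinite ι
  obtain ⟨T, j, hj, hrange, hfac, huniv⟩ :=
    exists_iterated_pullback Q (WidePullback.π f) u hu Finset.univ
  have hmono (i : ι) : Mono (u i) := hQ _ (hu i)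
  have hjmono : Mono j := hQ _ hj
  have hrmono : Mono r := by
    refine ⟨fun a b hab => widePullback_hom_ext fun i => ?_⟩
    rw [← cancel_mono (u i), Category.assoc, Category.assoc, ← hr, reassoc_of% hab]
  choose t ht using fun i => hfac i (Finset.mem_univ i)
  obtain ⟨i₀⟩ := ‹Nonempty ι›
  have htg (i : ι) : t i ≫ g i = t i₀ ≫ g i₀ := by
    rw [← cancel_mono v, Category.assoc, Category.assoc, w, w, reassoc_of% (ht i), reassoc_of% (ht i₀),
      WidePullback.π_arrow, WidePullback.π_arrow]
  let a : T ⟶ widePullback W V g := WidePullback.lift (t i₀ ≫ g i₀) t htg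
  have ha : a ≫ r = j := by
    refine widePullback_hom_ext fun i => ?_
    rw [Category.assoc, hr, WidePullback.lift_π_assoc, ht]
  obtain ⟨b, hb⟩ := huniv _ r fun i _ => ⟨WidePullback.π g i, (hr i).symm⟩
  have hiso : IsIso b := ⟨a, by rw [← cancel_mono r, Category.assoc, ha, hb, Category.id_comp],
    by rw [← cancel_mono j, Category.assoc, hb, ha, Category.id_comp]⟩
  refine ⟨?_, ?_, fun S s t' ht' => ?_⟩
  · rw [← hb]
    exact Q.comp_mem _ _ (MorphismProperty.of_isIso Q b) hj
  · rw [← hb, range_isIso_comp, hrange]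
    simp
  · obtain ⟨q, hq⟩ := huniv S s fun i _ => ⟨t' i, (ht' i).symm⟩
    exact ⟨q ≫ a, by simp only [Category.assoc, ha, hq], fun q' hq' => by
      rw [← cancel_mono r, hq', Category.assoc, ha, hq]⟩

instance isAffine_widePullback [IsAffine W] [∀ i, IsAffine (V i)] (g : ∀ i, V i ⟶ W) :
    IsAffine (widePullback W V g) := by
  have : ∀ i, IsAffine ((WidePullbackShape.wideCospan W V g).obj i) := by
    rintro (_ | i)
    · exact ‹IsAffine W›
    · exact ‹∀ i, IsAffine (V i)› i
  exact Scheme.isAffine_of_isLimit _ (limit.isLimit (WidePullbackShape.wideCospan W V g))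

end WidePullback

section FiberGroup

variable {ι : Type} [Finite ι] {M : ι → Type u} {MB : Type u} [∀ i, AddCommGroup (M i)]
  [AddCommGroup MB]

/-- The group algebra of the amalgamated sum is the pushout of the group algebras. -/
lemma exists_monoidAlgebra_fiberGroup_hom [Nonempty ι] (k : Type u) [Field k] (φ : ∀ i, MB →+ M i)
    {R : Type u} [CommRing R] (ψB : AddMonoidAlgebra k MB →+* R) (ψ : ∀ i, AddMonoidAlgebra k (M i) →+* R)
    (h : ∀ i, (ψ i).comp (AddMonoidAlgebra.mapDomainRingHom k (φ i)) = ψB) :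
    ∃ Ψ : AddMonoidAlgebra k (FiberGroup φ) →+* R,
      ∀ i, Ψ.comp (AddMonoidAlgebra.mapDomainRingHom k (fiberSingle φ i)) = ψ i := by
  let u (i : ι) : M i →+ Additive Rˣ := AddMonoidHom.mk' (fun m => Additive.ofMul
    ⟨ψ i (AddMonoidAlgebra.single m 1), ψ i (AddMonoidAlgebra.single (-m) 1), by
      rw [← map_mul, AddMonoidAlgebra.single_mul_single]; simp [← AddMonoidAlgebra.one_def], by
      rw [← map_mul, AddMonoidAlgebra.single_mul_single]; simp [← AddMonoidAlgebra.one_def]⟩)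
    fun a b => by
      rw [← ofMul_mul]
      congr 1
      ext
      change ψ i _ = ψ i _ * ψ i _
      rw [← map_mul, AddMonoidAlgebra.single_mul_single, mul_one]
  obtain ⟨U, hU⟩ := exists_fiberGroup_hom φ u fun i j m => by
    refine Additive.toMul.injective (Units.ext ?_)
    have h1 := congrArg (fun χ => χ (AddMonoidAlgebra.single m 1)) ((h i).trans (h j).symm)
    rw [RingHom.comp_apply, RingHom.comp_apply, mapDomainRingHom_single, mapDomainRingHom_single] at h1
    exact h1
  let χ : Multiplicative (FiberGroup φ) →* R :=
    { toFun := fun g => ((U g.toAdd).toMul : Rˣ)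
      map_one' := by simp
      map_mul' := fun a b => by simp }
  let Ψ : AddMonoidAlgebra k (FiberGroup φ) →+* R :=
    AddMonoidAlgebra.liftNCRingHom (ψB.comp (algebraMap k (AddMonoidAlgebra k MB))) χ
      fun _ _ => Commute.all _ _
  refine ⟨Ψ, fun i => ringHom_ext_single fun m c => ?_⟩
  rw [RingHom.comp_apply, mapDomainRingHom_single]
  have h1 : Ψ (AddMonoidAlgebra.single (fiberSingle φ i m) c) =
      ψB (AddMonoidAlgebra.single 0 c) * χ (Multiplicative.ofAdd (fiberSingle φ i m)) :=
    AddMonoidAlgebra.liftNC_single _ _ _ _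
  have h2 : χ (Multiplicative.ofAdd (fiberSingle φ i m)) = ψ i (AddMonoidAlgebra.single m 1) :=
    congrArg (fun a : Additive Rˣ => ((a.toMul : Rˣ) : R)) (hU i m)
  rw [h1, h2, ← h i, RingHom.comp_apply, mapDomainRingHom_single, ← map_mul,
    AddMonoidAlgebra.single_mul_single, map_zero, zero_add, mul_one]

lemma monoidAlgebra_fiberGroup_hom_ext [Nonempty ι] {k : Type u} [Field k] (φ : ∀ i, MB →+ M i)
    {R : Type*} [Semiring R] {Ψ Θ : AddMonoidAlgebra k (FiberGroup φ) →+* R}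
    (h : ∀ i, Ψ.comp (AddMonoidAlgebra.mapDomainRingHom k (fiberSingle φ i)) =
      Θ.comp (AddMonoidAlgebra.mapDomainRingHom k (fiberSingle φ i))) : Ψ = Θ := by
  have h' (i : ι) (m : M i) (c : k) : Ψ (AddMonoidAlgebra.single (fiberSingle φ i m) c) =
      Θ (AddMonoidAlgebra.single (fiberSingle φ i m) c) := by
    have h1 := congrArg (fun χ => χ (AddMonoidAlgebra.single m c)) (h i)
    rw [RingHom.comp_apply, RingHom.comp_apply, mapDomainRingHom_single] at h1
    exact h1
  refine ringHom_ext_single fun g => ?_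
  induction g using fiberGroup_induction φ with
  | h i m => exact h' i m
  | hadd a b ha hb =>
    intro c
    have h1 : (AddMonoidAlgebra.single (a + b) c : AddMonoidAlgebra k (FiberGroup φ)) =
        AddMonoidAlgebra.single a c * AddMonoidAlgebra.single b 1 := by
      rw [AddMonoidAlgebra.single_mul_single, mul_one]
    rw [h1, map_mul, map_mul, ha, hb]
  | h0 =>
    obtain ⟨i⟩ := ‹Nonempty ι›
    simpa only [map_zero] using h' i 0

/-- The fiber product of the tori with character lattices `M i` is the diagonalizable group scheme
with character group `FiberGroup φ`. -/
theorem isIso_specFiberGroup [Nonempty ι] (k : Type u) [Field k] (φ : ∀ i, MB →+ M i)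
    (e : specMonoid k (FiberGroup φ) ⟶
      widePullback (specMonoid k MB) (fun i => specMonoid k (M i)) (fun i => specMap k (φ i)))
    (he : ∀ i, e ≫ WidePullback.π _ i = specMap k (fiberSingle φ i)) : IsIso e := by
  let E := widePullback (specMonoid k MB) (fun i => specMonoid k (M i)) (fun i => specMap k (φ i))
  obtain ⟨ψB, hψB⟩ := Spec.map_surjective (E.isoSpec.inv ≫ WidePullback.base _)
  choose ψ hψ using fun i => Spec.map_surjective (E.isoSpec.inv ≫ WidePullback.π _ i)
  obtain ⟨Ψ, hΨ⟩ := exists_monoidAlgebra_fiberGroup_hom k φ ψB.hom (fun i => (ψ i).hom) fun i => by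
    have h1 : CommRingCat.ofHom (AddMonoidAlgebra.mapDomainRingHom k (φ i)) ≫ ψ i = ψB := by
      apply Spec.map_injective
      rw [Spec.map_comp, hψ, hψB, Category.assoc]
      congr 1
      exact WidePullback.π_arrow _ i
    exact congrArg CommRingCat.Hom.hom h1
  let b : E ⟶ specMonoid k (FiberGroup φ) := E.isoSpec.hom ≫ Spec.map (CommRingCat.ofHom Ψ)
  have hb (i : ι) : b ≫ specMap k (fiberSingle φ i) = WidePullback.π _ i := by
    rw [Category.assoc, specMap, ← Spec.map_comp, ← CommRingCat.ofHom_comp, hΨ, CommRingCat.ofHom_hom,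
      hψ, Iso.hom_inv_id_assoc]
  refine ⟨b, ?_, ?_⟩
  · obtain ⟨Θ, hΘ⟩ := Spec.map_surjective (e ≫ b)
    have h1 : Θ.hom = RingHom.id _ := by
      refine monoidAlgebra_fiberGroup_hom_ext φ fun i => ?_
      have h2 : CommRingCat.ofHom (AddMonoidAlgebra.mapDomainRingHom k (fiberSingle φ i)) ≫ Θ =
          CommRingCat.ofHom (AddMonoidAlgebra.mapDomainRingHom k (fiberSingle φ i)) := by
        apply Spec.map_injective
        rw [Spec.map_comp, hΘ, Category.assoc]
        exact (congrArg (e ≫ ·) (hb i)).trans (he i)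
      exact congrArg CommRingCat.Hom.hom h2
    rw [← hΘ, ← CommRingCat.ofHom_hom Θ, h1]
    exact Spec.map_id _
  · refine widePullback_hom_ext fun i => ?_
    rw [Category.assoc, he, hb, Category.id_comp]

end FiberGroup

/-! ### Torus orbits of the fiber product and their components -/

/-- The components of the closure of the image of a Noetherian scheme are the closures of the images
of its components. -/
lemma exists_irreducibleComponents_closure_image {T F : Type*} [TopologicalSpace T] [TopologicalSpace F]
    [TopologicalSpace.NoetherianSpace T] {j : T → F} (hj : Continuous j) {Z : Set F}
    (hZ : Maximal (fun W => IsIrreducible W ∧ W ⊆ closure (Set.range j)) Z) :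
    ∃ C ∈ irreducibleComponents T, Z = closure (j '' C) := by
  have hfin : (irreducibleComponents T).Finite := TopologicalSpace.NoetherianSpace.finite_irreducibleComponents
  have h1 : closure (Set.range j) = ⋃ C ∈ irreducibleComponents T, closure (j '' C) := by
    rw [← hfin.closure_biUnion, ← Set.image_iUnion₂, ← Set.sUnion_eq_biUnion, sUnion_irreducibleComponents,
      Set.image_univ]
  have h2 := hZ.prop.2
  rw [h1] at h2
  obtain ⟨C, hC, hZC⟩ : ∃ C ∈ irreducibleComponents T, Z ⊆ closure (j '' C) := by
    have h3 := (isIrreducible_iff_sUnion_isClosed.1 hZ.prop.1)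
      (hfin.image fun C => closure (j '' C)).toFinset (fun W hW => by
        obtain ⟨C, -, rfl⟩ := (Set.Finite.mem_toFinset _).1 hW
        exact isClosed_closure) (by
        simpa [Set.sUnion_image] using h2)
    obtain ⟨W, hW, hZW⟩ := h3
    obtain ⟨C, hC, rfl⟩ := (Set.Finite.mem_toFinset _).1 hW
    exact ⟨C, hC, hZW⟩
  have hCirr : IsIrreducible (closure (j '' C)) := (hC.prop.image j hj.continuousOn).closure
  exact ⟨C, hC, subset_antisymm hZC (hZ.le_of_ge
    ⟨hCirr, closure_mono (Set.image_subset_range j C)⟩ hZC)⟩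

section OrbitFamilies

variable {k : Type u} [Field k] {ι : Type} [Finite ι] {M : ι → Type u} {MB : Type u}
  [∀ i, AddCommGroup (M i)] [AddCommGroup MB] {Δ : ∀ i, Set (RealCone (M i))} {ΔB : Set (RealCone MB)}
  (X : ∀ i, ToricVariety k (M i) (Δ i)) (B : ToricVariety k MB ΔB) {φ : ∀ i, MB →+ M i}
  (f : ∀ i, (X i).X ⟶ B.X)

/-- The orbits attached to the cones `κ i` are mapped by the `f i` to the orbit attached to `κB`:
this means that `κB` is the smallest cone of its fan that contains the image of `κ i`. -/
structure OrbitFamily.IsCompatible (D : OrbitFamily φ Δ ΔB) : Prop where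
  mem_perp : ∀ i, ∀ m ∈ dualMonoid D.κB, φ i m ∈ perp (D.κ i) → m ∈ perp D.κB
  orbitMap_comp : ∀ i, (X i).orbitMap (D.κ i) (D.mem i) ≫ f i =
    specMap k (D.map i) ≫ B.orbitMap D.κB D.memB

variable {X B f}

/-- The orbits of the `X i` that contain the projections of a point `x` of the fiber product are
mapped to the same orbit of `B`. -/
lemma exists_orbitFamily (hf : ∀ i, IsToricMorphism (X i) B (φ i) (f i)) (x : FiberProduct X B f) :
    ∃ D : OrbitFamily φ Δ ΔB, D.IsCompatible X B f ∧
      (∀ i, WidePullback.π f i x ∈ Set.range ((X i).orbitMap (D.κ i) (D.mem i))) ∧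
      WidePullback.base f x ∈ Set.range (B.orbitMap D.κB D.memB) := by
  choose κ hκ hx using fun i => (X i).exists_mem_range_orbitMap (WidePullback.π f i x)
  obtain ⟨κB, hκB, hxB⟩ := B.exists_mem_range_orbitMap (WidePullback.base f x)
  have key (i : ι) : ∃ h : ∀ v ∈ κ i, pull (φ i) v ∈ κB,
      (∀ m ∈ dualMonoid κB, φ i m ∈ perp (κ i) → m ∈ perp κB) ∧
      (X i).orbitMap (κ i) (hκ i) ≫ f i = specMap k (perpMap (φ i) h) ≫ B.orbitMap κB hκB := by
    obtain ⟨κ', hκ', h, h1, h2⟩ := (hf i).exists_orbit (hκ i)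
    have h3 : WidePullback.base f x ∈ Set.range (B.orbitMap κ' hκ') := by
      obtain ⟨y, hy⟩ := hx i
      rw [← WidePullback.π_arrow f i, Scheme.Hom.comp_apply, ← hy, ← Scheme.Hom.comp_apply, h2,
        Scheme.Hom.comp_apply]
      exact ⟨_, rfl⟩
    obtain rfl := B.orbit_unique hκB hκ' hxB h3
    exact ⟨h, h1, h2⟩
  choose h h1 h2 using key
  exact ⟨⟨κ, hκ, κB, hκB, h⟩, ⟨h1, h2⟩, hx, hxB⟩

namespace OrbitFamily

variable {D : OrbitFamily φ Δ ΔB}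

/-- The subset of the fiber product attached to a family of orbits. -/
def stratum (D : OrbitFamily φ Δ ΔB) (X : ∀ i, ToricVariety k (M i) (Δ i)) (B : ToricVariety k MB ΔB)
    (f : ∀ i, (X i).X ⟶ B.X) : Set (FiberProduct X B f) :=
  ⋂ i, (WidePullback.π f i) ⁻¹' Set.range ((X i).orbitMap (D.κ i) (D.mem i))

lemma fiberOrbit_eq_stratum {x : FiberProduct X B f}
    (hx : ∀ i, WidePullback.π f i x ∈ Set.range ((X i).orbitMap (D.κ i) (D.mem i))) :
    fiberOrbit X B f x = D.stratum X B f := by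
  ext y
  rw [stratum, Set.mem_iInter]
  refine forall_congr' fun i => ?_
  rw [(X i).orbit_eq (D.mem i) (hx i)]
  rfl

variable [Nonempty ι]

/-- The fiber product of the orbits is the scheme-theoretic intersection of `F` with their
product. -/
lemma IsCompatible.orbitToFiber (hD : D.IsCompatible X B f) :
    IsImmersion (D.orbitToFiber hD.orbitMap_comp) ∧
      Set.range (D.orbitToFiber hD.orbitMap_comp) = D.stratum X B f ∧
      ∀ (S : Scheme.{u}) (s : S ⟶ FiberProduct X B f) (t : ∀ i, S ⟶ specMonoid k (perp (D.κ i))),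
        (∀ i, s ≫ WidePullback.π f i = t i ≫ (X i).orbitMap (D.κ i) (D.mem i)) →
        ∃! r, r ≫ D.orbitToFiber hD.orbitMap_comp = s :=
  widePullback_map_of_mono @IsImmersion (fun _ _ g (_ : IsImmersion g) => inferInstanceAs (Mono g))
    (v := B.orbitMap D.κB D.memB) (fun i => (X i).isImmersion_orbitMap _ _)
    (fun i => (hD.orbitMap_comp i).symm) _ (fun _ => WidePullback.lift_π _ _ _ _ _)

/-- The fiber product of the orbits is `Spec k[G]`, where `G` is the amalgamated sum of the
character lattices. -/
lemma IsCompatible.exists_immersion_of_fiberGroup (hD : D.IsCompatible X B f) :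
    ∃ j : specMonoid k (FiberGroup D.map) ⟶ FiberProduct X B f, IsImmersion j ∧
      Set.range j = D.stratum X B f ∧
      ∀ i, j ≫ WidePullback.π f i =
        specMap k (fiberSingle D.map i) ≫ (X i).orbitMap (D.κ i) (D.mem i) := by
  obtain ⟨h1, h2, -⟩ := hD.orbitToFiber
  obtain ⟨i₀⟩ := ‹Nonempty ι›
  have hcomp (i : ι) : specMap k (fiberSingle D.map i) ≫ specMap k (D.map i) =
      specMap k (fiberSingle D.map i₀) ≫ specMap k (D.map i₀) := by
    rw [specMap_comp, specMap_comp]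
    congr 1
    ext m
    exact fiberSingle_comp D.map i i₀ m
  let e : specMonoid k (FiberGroup D.map) ⟶ widePullback (specMonoid k (perp D.κB))
      (fun i => specMonoid k (perp (D.κ i))) (fun i => specMap k (D.map i)) :=
    WidePullback.lift (specMap k (fiberSingle D.map i₀) ≫ specMap k (D.map i₀))
      (fun i => specMap k (fiberSingle D.map i)) hcomp
  have he (i : ι) : e ≫ WidePullback.π _ i = specMap k (fiberSingle D.map i) :=
    WidePullback.lift_π _ _ _ _ _
  have : Nonempty ι := ⟨i₀⟩
  have hiso := isIso_specFiberGroup k D.map e he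
  refine ⟨e ≫ D.orbitToFiber hD.orbitMap_comp, inferInstance, ?_, fun i => ?_⟩
  · rw [range_isIso_comp, h2]
  · rw [Category.assoc, OrbitFamily.orbitToFiber, WidePullback.lift_π, ← he i, Category.assoc]

lemma IsCompatible.isIrreducible_stratum (hD : D.IsCompatible X B f)
    (h : IsAddTorsionFree (FiberGroup D.map)) :
    IsIrreducible (D.stratum X B f) := by
  obtain ⟨j, -, h2, -⟩ := hD.exists_immersion_of_fiberGroup
  have (i : ι) : Module.Finite ℤ (M i) := (X i).fg
  have : Module.IsTorsionFree ℤ (FiberGroup D.map) := inferInstance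
  have : Module.Free ℤ (FiberGroup D.map) := inferInstance
  have : IrreducibleSpace (PrimeSpectrum (AddMonoidAlgebra k (FiberGroup D.map))) := inferInstance
  rw [← h2, ← Set.image_univ]
  exact (IrreducibleSpace.isIrreducible_univ (PrimeSpectrum _)).image _ j.continuous.continuousOn

/-- The restriction of the constants `c` to the `i`-th lattice. -/
noncomputable def constants (D : OrbitFamily φ Δ ΔB) {L : Type*} [Monoid L]
    (c : Multiplicative (FiberGroup D.map) →* L) (i : ι) : Multiplicative (perp (D.κ i)) →* L :=
  c.comp (AddMonoidHom.toMultiplicative (fiberSingle D.map i))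

/-- The components of the closure of a torus orbit are the closures of immersed tori over finite
extensions of `k`. -/
theorem IsCompatible.exists_torus (hD : D.IsCompatible X B f) {Z : Set (FiberProduct X B f)}
    (hZ : Maximal (fun W => IsIrreducible W ∧ W ⊆ closure (D.stratum X B f)) Z) :
    ∃ (L : Type u) (_ : Field L) (_ : Algebra k L) (c : Multiplicative (FiberGroup D.map) →* L)
      (p : specMonoid L D.Lattice ⟶ FiberProduct X B f),
      Module.Finite k L ∧ IsImmersion p ∧ closure (Set.range p) = Z ∧
      Set.range p = Z ∩ D.stratum X B f ∧
      (∀ i, p ≫ WidePullback.π f i = Spec.map (CommRingCat.ofHom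
          (twistedMonomialHom (k := k) (fiberIncl D.map i) (D.constants c i)).toRingHom) ≫
        (X i).orbitMap (D.κ i) (D.mem i)) ∧
      (IsAddTorsionFree (FiberGroup D.map) → Function.Bijective (algebraMap k L) ∧ ∀ g, c g = 1) := by
  have (i : ι) : Module.Finite ℤ (M i) := (X i).fg
  obtain ⟨j, hj, hjrange, hjπ⟩ := hD.exists_immersion_of_fiberGroup
  rw [← hjrange] at hZ ⊢
  let A := AddMonoidAlgebra k (FiberGroup D.map)
  have : IsNoetherianRing A := isNoetherianRing_monoidAlgebra
  have : TopologicalSpace.NoetherianSpace (specMonoid k (FiberGroup D.map)) :=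
    inferInstanceAs (TopologicalSpace.NoetherianSpace (PrimeSpectrum A))
  obtain ⟨C, hC, rfl⟩ := exists_irreducibleComponents_closure_image j.continuous hZ
  obtain ⟨P, hP, rfl⟩ : ∃ P ∈ minimalPrimes A, C = PrimeSpectrum.zeroLocus (P : Set A) := by
    have h1 : C ∈ irreducibleComponents (PrimeSpectrum A) := hC
    rw [← PrimeSpectrum.zeroLocus_minimalPrimes] at h1
    obtain ⟨P, hP, rfl⟩ := h1
    exact ⟨P, hP, rfl⟩
  obtain ⟨L, hL, hkL, c, hfin, hsurj, hker, htf⟩ := exists_component hP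
  let t : specMonoid L D.Lattice ⟶ specMonoid k (FiberGroup D.map) :=
    Spec.map (CommRingCat.ofHom (twistedMonomialHom (k := k)
        (QuotientAddGroup.mk' (AddCommGroup.torsion (FiberGroup D.map))) c).toRingHom)
  have ht : IsClosedImmersion t := IsClosedImmersion.spec_of_surjective _ hsurj
  have htrange : Set.range t = PrimeSpectrum.zeroLocus (P : Set A) := by
    rw [← hker]
    exact range_comap_of_surjective _ _ hsurj
  have hrange : Set.range (t ≫ j) = j '' PrimeSpectrum.zeroLocus (P : Set A) := by
    rw [Scheme.Hom.comp_base, TopCat.coe_comp, Set.range_comp, htrange]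
  refine ⟨L, hL, hkL, c, t ≫ j, hfin, inferInstance, by rw [hrange], ?_, fun i => ?_, htf⟩
  · rw [hrange]
    refine subset_antisymm (Set.subset_inter subset_closure (Set.image_subset_range _ _)) ?_
    rintro _ ⟨hx, y, rfl⟩
    refine ⟨y, ?_, rfl⟩
    have h1 := (j.isEmbedding.isInducing.closure_eq_preimage_closure_image
      (PrimeSpectrum.zeroLocus (P : Set A))).symm.subset hx
    exact (PrimeSpectrum.isClosed_zeroLocus (P : Set A)).closure_eq.subset h1
  · rw [Category.assoc, hjπ, ← Category.assoc]
    congr 1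
    rw [specMap, ← Spec.map_comp, ← CommRingCat.ofHom_comp]
    congr 2
    refine ringHom_ext_single fun m a => ?_
    rw [RingHom.comp_apply, mapDomainRingHom_single]
    exact (twistedMonomialHom_single _ _ _ _).trans
      (twistedMonomialHom_single (fiberIncl D.map i) (D.constants c i) m a).symm

end OrbitFamily

end OrbitFamilies

/-! ### Charts of the normalized closure of a torus orbit -/

namespace OrbitFamily

variable {k : Type u} [Field k] {ι : Type} {M : ι → Type u} {MB : Type u}
  [∀ i, AddCommGroup (M i)] [AddCommGroup MB] {Δ : ∀ i, Set (RealCone (M i))} {ΔB : Set (RealCone MB)}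
  {X : ∀ i, ToricVariety k (M i) (Δ i)} {B : ToricVariety k MB ΔB} {φ : ∀ i, MB →+ M i}
  {f : ∀ i, (X i).X ⟶ B.X}

/-- Cones `σ i ∈ Δ i` that contain the cones `κ i` and map to a cone `τ ∈ ΔB`. They give an affine
open subscheme of the fiber product, the fiber product of the charts `U_{σ i}` over `U_τ`. -/
structure ChartIndex (D : OrbitFamily φ Δ ΔB) where
  σ : ∀ i, RealCone (M i)
  mem : ∀ i, σ i ∈ Δ i
  le : ∀ i, D.κ i ≤ σ i
  τ : RealCone MB
  memB : τ ∈ ΔB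
  maps : ∀ i, ∀ v ∈ σ i, pull (φ i) v ∈ τ

section Cones

variable {D : OrbitFamily φ Δ ΔB}

/-- The cone `κB` is contained in each cone of its fan that contains the image of some `κ i`. -/
lemma IsCompatible.le_of_maps (hD : D.IsCompatible X B f) {τ : RealCone MB} (hτ : τ ∈ ΔB) (i : ι)
    (h : ∀ v ∈ D.κ i, pull (φ i) v ∈ τ) : D.κB ≤ τ := by
  have := B.free
  have := B.fg
  obtain ⟨m₀, h1, h2, h3⟩ := (B.isFan.polyhedral _ D.memB).exists_exposing
    (B.isFan.inter_face _ D.memB τ hτ)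
  have h4 : m₀ ∈ perp D.κB := hD.mem_perp i m₀ h1 fun v hv => h2 _ ⟨D.maps i v hv, h v hv⟩
  exact fun v hv => (h3 v hv (h4 v hv)).2

lemma IsCompatible.κB_le [Nonempty ι] (hD : D.IsCompatible X B f) (a : D.ChartIndex) : D.κB ≤ a.τ := by
  obtain ⟨i⟩ := ‹Nonempty ι›
  exact hD.le_of_maps a.memB i fun v hv => a.maps i v (a.le i hv)

lemma IsCompatible.map_mem_perp_iff [Nonempty ι] (hD : D.IsCompatible X B f) (a : D.ChartIndex) {m : MB}
    (hm : m ∈ dualMonoid a.τ) (i : ι) : φ i m ∈ perp (D.κ i) ↔ m ∈ perp D.κB :=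
  ⟨hD.mem_perp i m (dualMonoid_mono (hD.κB_le a) hm), fun h v hv => h _ (D.maps i v hv)⟩

lemma pull_mem_asymptoticCone {i : ι} {σ : RealCone (M i)} {τ : RealCone MB}
    (h : ∀ v ∈ σ, pull (φ i) v ∈ τ) {u : perp (D.κ i) →+ ℝ} (hu : u ∈ asymptoticCone σ (D.κ i)) :
    pull (D.map i) u ∈ asymptoticCone τ D.κB := by
  obtain ⟨v, hv, rfl⟩ := hu
  exact ⟨pull (φ i) v, h v hv, rfl⟩

lemma IsCompatible.cone_mem_fan [Nonempty ι] (hD : D.IsCompatible X B f) (a : D.ChartIndex) :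
    D.cone a.σ ∈ D.fan :=
  ⟨fun i => asymptoticCone (a.σ i) (D.κ i), fun i => ⟨a.σ i, a.mem i, a.le i, rfl⟩,
    ⟨asymptoticCone a.τ D.κB, ⟨a.τ, a.memB, hD.κB_le a, rfl⟩,
    fun i _ hu => pull_mem_asymptoticCone (a.maps i) hu⟩, rfl⟩

/-- The cones of the fiber product of the fans of asymptotic cones are the fiber products of the
asymptotic cones of cones `σ i` that map to a common cone `τ ∈ ΔB`. -/
lemma IsCompatible.exists_chartIndex (hD : D.IsCompatible X B f)
    (hf : ∀ i, IsToricMorphism (X i) B (φ i) (f i)) {C : RealCone D.Lattice} (hC : C ∈ D.fan) :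
    ∃ a : D.ChartIndex, D.cone a.σ = C := by
  have := B.free
  have := B.fg
  obtain ⟨C', hC', ⟨_, ⟨τ, hτ, hκτ, rfl⟩, hmaps⟩, rfl⟩ := hC
  choose σ hσ hκσ hC' using hC'
  refine ⟨⟨σ, hσ, hκσ, τ, hτ, fun i v hv => ?_⟩, ?_⟩
  · obtain ⟨τ', hτ', h', -⟩ := hf i (σ i) (hσ i)
    have hκτ' := hD.le_of_maps hτ' i fun v hv => h' v (hκσ i hv)
    have h1 := hmaps i (pull (perp (D.κ i)).subtype v) (by rw [hC']; exact ⟨v, hv, rfl⟩)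
    obtain ⟨w, hw, hw'⟩ := mem_asymptoticCone.1 h1
    obtain ⟨a, ha, b, hb, hab⟩ := (B.isFan.polyhedral _ D.memB).exists_sub_eq
      (v := pull (φ i) v - w) fun m hm => by
        rw [AddMonoidHom.sub_apply, hw' ⟨m, hm⟩]
        exact sub_self _
    have h2 : pull (φ i) v + b = w + a := by
      rw [sub_eq_sub_iff_add_eq_add] at hab
      rw [hab, add_comm]
    have h3 : pull (φ i) v + b ∈ τ' ⊓ τ :=
      ⟨add_mem (h' v hv) (hκτ' hb), by rw [h2]; exact add_mem hw (hκτ ha)⟩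
    exact ((B.isFan.inter_face τ' hτ' τ hτ).mem_of_add_mem_left (h' v hv) (hκτ' hb) h3).2
  · exact congrArg (fiberCone D.map) (funext fun i => (hC' i).symm)

lemma isFan_fan [Finite ι] (X : ∀ i, ToricVariety k (M i) (Δ i)) (B : ToricVariety k MB ΔB) : IsFan D.fan := by
  have (i : ι) : Module.Finite ℤ (M i) := (X i).fg
  have (i : ι) : Module.Free ℤ (M i) := (X i).free
  have := B.free
  have := B.fg
  exact isFan_fiberFan (fun i => (X i).isFan.asymptoticFan (D.mem i))
    (B.isFan.asymptoticFan D.memB).bot_mem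

/-- The intersection of two charts. -/
def ChartIndex.inf (X : ∀ i, ToricVariety k (M i) (Δ i)) (B : ToricVariety k MB ΔB)
    (a b : D.ChartIndex) : D.ChartIndex where
  σ i := a.σ i ⊓ b.σ i
  mem i := (X i).isFan.inf_mem (a.mem i) (b.mem i)
  le i := le_inf (a.le i) (b.le i)
  τ := a.τ ⊓ b.τ
  memB := B.isFan.inf_mem a.memB b.memB
  maps i v hv := ⟨a.maps i v hv.1, b.maps i v hv.2⟩

lemma cone_inf (X : ∀ i, ToricVariety k (M i) (Δ i)) (B : ToricVariety k MB ΔB)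
    (a b : D.ChartIndex) : D.cone (a.inf X B b).σ = D.cone a.σ ⊓ D.cone b.σ := by
  have (i : ι) : Module.Finite ℤ (M i) := (X i).fg
  have (i : ι) : Module.Free ℤ (M i) := (X i).free
  refine Eq.trans ?_ (fiberCone_inf _ _).symm
  exact congrArg (fiberCone D.map) (funext fun i => (asymptoticCone_inf
    ((X i).isFan.polyhedral _ (D.mem i)) (a.le i) (b.le i)).symm)

end Cones

section OpenCharts

variable [Finite ι] {D : OrbitFamily φ Δ ΔB} (hf : ∀ i, IsToricMorphism (X i) B (φ i) (f i))
  (a : D.ChartIndex)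

/-- The affine open subscheme of the fiber product attached to the cones `σ i` and `τ`. -/
noncomputable def ChartIndex.toFiber :
    widePullback (specMonoid k (dualMonoid a.τ)) (fun i => specMonoid k (dualMonoid (a.σ i)))
      (fun i => specMap k (dualMonoidMap (φ i) (a.maps i))) ⟶ FiberProduct X B f :=
  WidePullback.lift (WidePullback.base _ ≫ B.chart a.τ a.memB)
    (fun i => WidePullback.π _ i ≫ (X i).chart (a.σ i) (a.mem i))
    (fun i => by rw [Category.assoc, (hf i).chart_comp _ a.memB (a.maps i), WidePullback.π_arrow_assoc])

lemma ChartIndex.toFiber_π (i : ι) : a.toFiber hf ≫ WidePullback.π f i =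
    WidePullback.π _ i ≫ (X i).chart (a.σ i) (a.mem i) := WidePullback.lift_π _ _ _ _ _

lemma ChartIndex.isOpenImmersion_toFiber [Nonempty ι] : IsOpenImmersion (a.toFiber hf) ∧
    Set.range (a.toFiber hf) =
      ⋂ i, WidePullback.π f i ⁻¹' Set.range ((X i).chart (a.σ i) (a.mem i)) := by
  have := B.chart_open a.τ a.memB
  obtain ⟨h1, h2, -⟩ := widePullback_map_of_mono @IsOpenImmersion
    (fun _ _ g (_ : IsOpenImmersion g) => inferInstanceAs (Mono g)) (v := B.chart a.τ a.memB)
    (fun i => (X i).chart_open (a.σ i) (a.mem i))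
    (fun i => ((hf i).chart_comp (a.mem i) a.memB (a.maps i)).symm) (a.toFiber hf) (a.toFiber_π hf)
  exact ⟨h1, h2⟩

end OpenCharts

section RingHoms

variable {L : Type u} [Field L] [Algebra k L] {D : OrbitFamily φ Δ ΔB}
  (c : Multiplicative (FiberGroup D.map) →* L)

lemma fiberIncl_mem_dualMonoid_cone (σ : ∀ i, RealCone (M i)) {i : ι} {m : perp (D.κ i)}
    (hm : (m : M i) ∈ dualMonoid (σ i)) : fiberIncl D.map i m ∈ dualMonoid (D.cone σ) := by
  intro w hw
  exact mem_dualMonoid_asymptoticCone.2 hm _ (mem_fiberCone.1 hw i)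

open Classical in
/-- The ring homomorphism `k[σ_i^∨ ∩ M_i] → L[C^∨ ∩ Λ]` which is dual to the projection from
the affine toric variety with cone `C`, the fiber product of the asymptotic cones of the `σ i`. It
maps `χ^m` to `c(m) χ^m` if `m ∈ κ_i^⊥`, and to zero otherwise. -/
noncomputable def chartHom (σ : ∀ i, RealCone (M i)) (hσ : ∀ i, D.κ i ≤ σ i) (i : ι) :
    AddMonoidAlgebra k (dualMonoid (σ i)) →ₐ[k] AddMonoidAlgebra L (dualMonoid (D.cone σ)) :=
  faceHom k (fun m => (m : M i) ∈ perp (D.κ i))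
    (fun m => if h : (m : M i) ∈ perp (D.κ i) then
      AddMonoidAlgebra.single ⟨fiberIncl D.map i ⟨m, h⟩, fiberIncl_mem_dualMonoid_cone σ m.2⟩
        (D.constants c i (Multiplicative.ofAdd ⟨m, h⟩)) else 0)
    (zero_mem _) (by
      refine (dif_pos (zero_mem (perp (D.κ i)))).trans ?_
      rw [AddMonoidAlgebra.one_def]
      congr 1
      · exact Subtype.ext (map_zero (fiberIncl D.map i))
      · exact map_one (D.constants c i))
    (fun a b => add_mem_perp_iff (hσ i) a.2 b.2) (fun a b ha hb => by
      rw [dif_pos ha, dif_pos hb, AddMonoidAlgebra.single_mul_single]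
      refine (dif_pos (add_mem ha hb)).trans ?_
      congr 1
      · exact Subtype.ext (map_add (fiberIncl D.map i) ⟨a, ha⟩ ⟨b, hb⟩)
      · exact map_mul (D.constants c i) (Multiplicative.ofAdd ⟨a, ha⟩) (Multiplicative.ofAdd ⟨b, hb⟩))

lemma chartHom_single_of_mem (σ : ∀ i, RealCone (M i)) (hσ : ∀ i, D.κ i ≤ σ i) (i : ι)
    (m : dualMonoid (σ i)) (h : (m : M i) ∈ perp (D.κ i)) (x : k) :
    chartHom c σ hσ i (AddMonoidAlgebra.single m x) =
      AddMonoidAlgebra.single ⟨fiberIncl D.map i ⟨m, h⟩, fiberIncl_mem_dualMonoid_cone σ m.2⟩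
        (algebraMap k L x * D.constants c i (Multiplicative.ofAdd ⟨m, h⟩)) := by
  rw [chartHom, faceHom_single, if_pos h, dif_pos h, ← Algebra.smul_def, AddMonoidAlgebra.smul_single,
    Algebra.smul_def]

lemma chartHom_single_of_notMem (σ : ∀ i, RealCone (M i)) (hσ : ∀ i, D.κ i ≤ σ i) (i : ι)
    (m : dualMonoid (σ i)) (h : (m : M i) ∉ perp (D.κ i)) (x : k) :
    chartHom c σ hσ i (AddMonoidAlgebra.single m x) = 0 := by
  rw [chartHom, faceHom_single, if_neg h]

/-- On the dense torus, `chartHom` is the embedding of the torus in the orbit attached to `κ i`. -/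
lemma subtype_comp_chartHom (σ : ∀ i, RealCone (M i)) (hσ : ∀ i, D.κ i ≤ σ i) (i : ι) :
    (AddMonoidAlgebra.mapDomainRingHom L (dualMonoid (D.cone σ)).subtype).comp
      (chartHom c σ hσ i).toRingHom =
    (twistedMonomialHom (k := k) (fiberIncl D.map i) (D.constants c i)).toRingHom.comp
      (orbitInChart k (hσ i)) := by
  refine ringHom_ext_single fun m x => ?_
  rw [RingHom.comp_apply, RingHom.comp_apply, orbitInChart_single]
  change AddMonoidAlgebra.mapDomainRingHom L _ (chartHom c σ hσ i _) = twistedMonomialHom _ _ _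
  by_cases h : (m : M i) ∈ perp (D.κ i)
  · rw [chartHom_single_of_mem c σ hσ i m h, dif_pos h, mapDomainRingHom_single, twistedMonomialHom_single]
    rfl
  · rw [chartHom_single_of_notMem c σ hσ i m h, dif_neg h, map_zero, map_zero]

lemma IsCompatible.chartHom_comp [Nonempty ι] (hD : D.IsCompatible X B f) (a : D.ChartIndex) (i j : ι) :
    (chartHom c a.σ a.le i).toRingHom.comp
      (AddMonoidAlgebra.mapDomainRingHom k (dualMonoidMap (φ i) (a.maps i))) =
    (chartHom c a.σ a.le j).toRingHom.comp
      (AddMonoidAlgebra.mapDomainRingHom k (dualMonoidMap (φ j) (a.maps j))) := by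
  refine ringHom_ext_single fun m x => ?_
  rw [RingHom.comp_apply, RingHom.comp_apply, mapDomainRingHom_single, mapDomainRingHom_single]
  change chartHom c a.σ a.le i _ = chartHom c a.σ a.le j _
  have h1 := hD.map_mem_perp_iff a m.2
  by_cases h : (m : MB) ∈ perp D.κB
  · rw [chartHom_single_of_mem c a.σ a.le i _ ((h1 i).2 h),
      chartHom_single_of_mem c a.σ a.le j _ ((h1 j).2 h)]
    congr 1
    · exact Subtype.ext (fiberIncl_comp D.map i j ⟨m, h⟩)
    · congr 1
      exact congrArg (fun g => c (Multiplicative.ofAdd g)) (fiberSingle_comp D.map i j ⟨m, h⟩)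
  · rw [chartHom_single_of_notMem c a.σ a.le i _ (mt (h1 i).1 h),
      chartHom_single_of_notMem c a.σ a.le j _ (mt (h1 j).1 h)]

/-- The coordinate ring of the affine toric variety with cone `D.cone σ` is integral over each ring
that receives the coordinate rings of the `U_{σ i}`: a power of each monomial is, up to a constant, a
product of images of monomials, and the constants are integral over `k`. -/
lemma isIntegral_of_comp_eq_chartHom [Module.Finite k L] [Finite ι] [Nonempty ι] {σ : ∀ i, RealCone (M i)}
    (hσ : ∀ i, D.κ i ≤ σ i) (hpoly : ∀ i, IsRationalPolyhedral (σ i)) {W : Type u} [CommRing W]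
    [∀ i, Module.Free ℤ (M i)] [∀ i, Module.Finite ℤ (M i)]
    (w : W →+* AddMonoidAlgebra L (dualMonoid (D.cone σ)))
    (β : ∀ i, AddMonoidAlgebra k (dualMonoid (σ i)) →+* W)
    (h : ∀ i, w.comp (β i) = (chartHom (k := k) c σ hσ i).toRingHom) : w.IsIntegral := by
  obtain ⟨i₀⟩ := ‹Nonempty ι›
  have hmem (i : ι) (x : AddMonoidAlgebra k (dualMonoid (σ i))) : w.IsIntegralElem (chartHom c σ hσ i x) := by
    rw [show chartHom c σ hσ i x = w (β i x) from (RingHom.congr_fun (h i) x).symm]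
    exact RingHom.isIntegralElem_map (f := w)
  have hL (x : L) : w.IsIntegralElem (AddMonoidAlgebra.single 0 x) := by
    have hx : IsIntegral k x := Algebra.IsIntegral.isIntegral x
    obtain ⟨P, hP, hP0⟩ := hx
    refine ⟨P.map ((β i₀).comp (algebraMap k _)), hP.map _, ?_⟩
    rw [Polynomial.eval₂_map, ← RingHom.comp_assoc, h]
    have h1 : (chartHom (k := k) c σ hσ i₀).toRingHom.comp (algebraMap k _) =
      (algebraMap L (AddMonoidAlgebra L (dualMonoid (D.cone σ)))).comp (algebraMap k L) := by
      exact RingHom.ext fun x => (chartHom (k := k) c σ hσ i₀).commutes x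
    have h2 := congrArg (algebraMap L (AddMonoidAlgebra L (dualMonoid (D.cone σ)))) hP0
    rw [Polynomial.hom_eval₂, map_zero] at h2
    rw [h1]
    exact h2
  have hχ (m : dualMonoid (D.cone σ)) : w.IsIntegralElem (AddMonoidAlgebra.single m 1) := by
    obtain ⟨n, hn, hcl⟩ := exists_nsmul_mem_closure_of_mem_dualMonoid_fiberCone
      (fun i => (hpoly i).map (perp (D.κ i)).subtype) m.2
    have key : ∀ x ∈ AddSubmonoid.closure {x | ∃ i, ∃ a ∈ dualMonoid (asymptoticCone (σ i) (D.κ i)),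
        x = fiberIncl D.map i a}, ∃ hx : x ∈ dualMonoid (D.cone σ),
          w.IsIntegralElem (AddMonoidAlgebra.single ⟨x, hx⟩ 1) := by
      intro x hx
      induction hx using AddSubmonoid.closure_induction with
      | mem x hx =>
        obtain ⟨i, a, ha, rfl⟩ := hx
        have ha' := mem_dualMonoid_asymptoticCone.1 ha
        refine ⟨fiberIncl_mem_dualMonoid_cone σ ha', ?_⟩
        have h1 := chartHom_single_of_mem c σ hσ i ⟨a, ha'⟩ a.2 (1 : k)
        have hc : D.constants c i (Multiplicative.ofAdd a) ≠ 0 :=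
          ((Group.isUnit (Multiplicative.ofAdd a)).map (D.constants c i)).ne_zero
        have h2 : (AddMonoidAlgebra.single ⟨fiberIncl D.map i a, fiberIncl_mem_dualMonoid_cone σ ha'⟩ 1 :
            AddMonoidAlgebra L (dualMonoid (D.cone σ))) =
            AddMonoidAlgebra.single 0 (D.constants c i (Multiplicative.ofAdd a))⁻¹ *
              chartHom c σ hσ i (AddMonoidAlgebra.single ⟨a, ha'⟩ (1 : k)) := by
          rw [h1, map_one, one_mul, AddMonoidAlgebra.single_mul_single, zero_add]
          congr 1
          exact (inv_mul_cancel₀ hc).symm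
        rw [h2]
        exact (hL _).mul _ (hmem i _)
      | zero => exact ⟨zero_mem _, hL 1⟩
      | add x y _ _ hx hy =>
        obtain ⟨hx, hx'⟩ := hx
        obtain ⟨hy, hy'⟩ := hy
        refine ⟨add_mem hx hy, ?_⟩
        have := hx'.mul _ hy'
        rwa [AddMonoidAlgebra.single_mul_single, mul_one] at this
    obtain ⟨h1, h2⟩ := key _ hcl
    let := w.toAlgebra
    have h3 : (AddMonoidAlgebra.single m 1 : AddMonoidAlgebra L (dualMonoid (D.cone σ))) ^ n =
        AddMonoidAlgebra.single ⟨_, h1⟩ 1 := by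
      rw [AddMonoidAlgebra.single_pow, one_pow]
      rfl
    refine IsIntegral.of_pow (R := W) hn ?_
    rw [h3]
    exact h2
  intro z
  induction z using monoidAlgebra_induction with
  | h m x =>
    have h1 : (AddMonoidAlgebra.single m x : AddMonoidAlgebra L (dualMonoid (D.cone σ))) =
        AddMonoidAlgebra.single 0 x * AddMonoidAlgebra.single m 1 := by
      rw [AddMonoidAlgebra.single_mul_single, zero_add, mul_one]
    rw [h1]
    exact (hL x).mul _ (hχ m)
  | hadd a b ha hb => exact ha.add _ hb

end RingHoms

end OrbitFamily

/-! ### The normalized closure of a torus orbit is toric -/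

namespace OrbitFamily

variable {k : Type u} [Field k] {ι : Type} [Finite ι] [Nonempty ι] {M : ι → Type u} {MB : Type u}
  [∀ i, AddCommGroup (M i)] [AddCommGroup MB] {Δ : ∀ i, Set (RealCone (M i))} {ΔB : Set (RealCone MB)}
  {X : ∀ i, ToricVariety k (M i) (Δ i)} {B : ToricVariety k MB ΔB} {φ : ∀ i, MB →+ M i}
  {f : ∀ i, (X i).X ⟶ B.X} {D : OrbitFamily φ Δ ΔB}

section Chart

variable {L : Type u} [Field L] [Algebra k L] [Module.Finite k L]
  (c : Multiplicative (FiberGroup D.map) →* L)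

/-- The integral morphism from an affine toric variety to the chart `a` of the fiber product. -/
lemma IsCompatible.exists_integral_chart (hD : D.IsCompatible X B f) (a : D.ChartIndex) :
    ∃ e : specMonoid L (dualMonoid (D.cone a.σ)) ⟶
        widePullback (specMonoid k (dualMonoid a.τ)) (fun i => specMonoid k (dualMonoid (a.σ i)))
          (fun i => specMap k (dualMonoidMap (φ i) (a.maps i))),
      IsIntegralHom e ∧ ∀ i, e ≫ WidePullback.π _ i =
        Spec.map (CommRingCat.ofHom (chartHom (k := k) c a.σ a.le i).toRingHom) := by
  have (i : ι) : Module.Finite ℤ (M i) := (X i).fg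
  have (i : ι) : Module.Free ℤ (M i) := (X i).free
  let h (i : ι) := Spec.map (CommRingCat.ofHom (chartHom (k := k) c a.σ a.le i).toRingHom)
  obtain ⟨i₀⟩ := ‹Nonempty ι›
  have hcomp (i : ι) : h i ≫ specMap k (dualMonoidMap (φ i) (a.maps i)) =
      h i₀ ≫ specMap k (dualMonoidMap (φ i₀) (a.maps i₀)) := by
    rw [specMap, specMap, ← Spec.map_comp, ← Spec.map_comp, ← CommRingCat.ofHom_comp,
      ← CommRingCat.ofHom_comp]
    have : Nonempty ι := ⟨i₀⟩
    rw [hD.chartHom_comp c a i i₀]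
  let E := widePullback (specMonoid k (dualMonoid a.τ)) (fun i => specMonoid k (dualMonoid (a.σ i)))
          (fun i => specMap k (dualMonoidMap (φ i) (a.maps i)))
  let e : specMonoid L (dualMonoid (D.cone a.σ)) ⟶ E := WidePullback.lift _ h hcomp
  have he (i : ι) : e ≫ WidePullback.π _ i = h i := WidePullback.lift_π _ _ _ _ _
  have hE : IsAffine E := by
    have : Nonempty ι := ⟨i₀⟩
    exact isAffine_widePullback _
  refine ⟨e, ?_, he⟩
  obtain ⟨w, hw⟩ := Spec.map_surjective (e ≫ E.isoSpec.hom)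
  choose β hβ using fun i => Spec.map_surjective (E.isoSpec.inv ≫ WidePullback.π _ i)
  have hint : w.hom.IsIntegral := by
    have : Nonempty ι := ⟨i₀⟩
    refine isIntegral_of_comp_eq_chartHom c a.le (fun i => (X i).isFan.polyhedral _ (a.mem i)) w.hom
      (fun i => (β i).hom) fun i => ?_
    have h1 : β i ≫ w = CommRingCat.ofHom (chartHom (k := k) c a.σ a.le i).toRingHom := by
      apply Spec.map_injective
      rw [Spec.map_comp, hw, hβ, Category.assoc, Iso.hom_inv_id_assoc, he]
    exact congrArg CommRingCat.Hom.hom h1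
  have h2 : IsIntegralHom (Spec.map w) := IsIntegralHom.SpecMap_iff.2 hint
  have h3 : e = Spec.map w ≫ E.isoSpec.inv := by rw [hw, Category.assoc, Iso.hom_inv_id, Category.comp_id]
  rw [h3]
  infer_instance

end Chart

/-- The normalization of a component of the closure of a torus orbit is the toric variety whose fan is
the fiber product of the fans of asymptotic cones. -/
theorem IsCompatible.exists_toricNormalization (hD : D.IsCompatible X B f)
    (hf : ∀ i, IsToricMorphism (X i) B (φ i) (f i)) {Z : Set (FiberProduct X B f)}
    (hZ : Maximal (fun W => IsIrreducible W ∧ W ⊆ closure (D.stratum X B f)) Z) :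
    D.HasToricNormalization Z := by
  have (i : ι) : Module.Finite ℤ (M i) := (X i).fg
  have (i : ι) : Module.Free ℤ (M i) := (X i).free
  obtain ⟨L, hL, hkL, c, p, hfin, hp, hpZ, hprange, hpπ, htf⟩ := hD.exists_torus hZ
  have hopen (a : D.ChartIndex) := a.isOpenImmersion_toFiber hf
  have hopen' (a : D.ChartIndex) := (hopen a).1
  let U (a : D.ChartIndex) : (FiberProduct X B f).Opens := (a.toFiber hf).opensRange
  have hUcoe (a : D.ChartIndex) : (U a : Set (FiberProduct X B f)) =
      ⋂ i, WidePullback.π f i ⁻¹' Set.range ((X i).chart (a.σ i) (a.mem i)) := (hopen a).2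
  choose e he heπ using fun a => hD.exists_integral_chart c a
  let g (a : D.ChartIndex) : specMonoid L (dualMonoid (D.cone a.σ)) ⟶ U a :=
    e a ≫ (a.toFiber hf).isoOpensRange.hom
  have hg (a : D.ChartIndex) : g a ≫ (U a).ι = e a ≫ a.toFiber hf := by
    rw [Category.assoc, Scheme.Hom.isoOpensRange_hom_ι]
  obtain ⟨i₀⟩ := ‹Nonempty ι›
  have : Nonempty ι := ⟨i₀⟩
  have hstr (κ : RealCone (M i₀)) (hκ : κ ∈ Δ i₀) : (X i₀).orbitMap κ hκ ≫ (X i₀).str =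
      Spec.map (CommRingCat.ofHom (algebraMap k (AddMonoidAlgebra k (perp κ)))) := by
    rw [ToricVariety.orbitMap, Category.assoc, (X i₀).chart_str, ← Spec.map_comp,
      ← CommRingCat.ofHom_comp]
    exact congrArg (fun r => Spec.map (CommRingCat.ofHom r))
      (RingHom.ext fun x => (orbitRingHom k κ).commutes x)
  obtain ⟨V, ν, hV, hν⟩ := exists_toricVariety_isNormalizationOf (isFan_fan X B)
    (WidePullback.π f i₀ ≫ (X i₀).str) p (by
      rw [← Category.assoc, hpπ, Category.assoc, hstr, ← Spec.map_comp, ← CommRingCat.ofHom_comp]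
      congr 2
      refine RingHom.ext fun x => ?_
      exact (twistedMonomialHom (k := k) (fiberIncl D.map i₀) (D.constants c i₀)).commutes x)
    (fun a => hD.cone_mem_fan a) (fun σ hσ => hD.exists_chartIndex hf hσ)
    (U := U) (fun a => isAffineOpen_opensRange _) g (fun a => inferInstance) (fun a => by
      refine widePullback_hom_ext fun i => ?_
      rw [hg, Category.assoc, Category.assoc, a.toFiber_π, reassoc_of% (heπ a i), hpπ,
        (X i).orbitMap_eq (a.mem i) (D.mem i) (a.le i), specMap, ← Category.assoc, ← Category.assoc,
        ← Spec.map_comp, ← Spec.map_comp, ← CommRingCat.ofHom_comp, ← CommRingCat.ofHom_comp,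
        subtype_comp_chartHom])
    (fun a b => ⟨a.inf X B b, cone_inf X B a b, by
      refine TopologicalSpace.Opens.ext ?_
      rw [TopologicalSpace.Opens.coe_inf, hUcoe, hUcoe, hUcoe, ← Set.iInter_inter_distrib]
      refine Set.iInter_congr fun i => ?_
      rw [← Set.preimage_inter]
      congr 1
      refine subset_antisymm (Set.subset_inter ?_ ?_) ?_
      · exact (X i).range_chart_mono (a.mem i) _ inf_le_left
      · exact (X i).range_chart_mono (b.mem i) _ inf_le_right
      · exact (X i).chart_inter _ _ _ _ _⟩)
    (by
      intro y hy
      -- a point `y` of the closure lies in the chart given by the cones of its own orbit; this chart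
      -- meets the torus, so that these cones contain the `κ i`
      obtain ⟨D', hD', hy', -⟩ := exists_orbitFamily hf y
      have hmem : y ∈ ⋂ i, WidePullback.π f i ⁻¹' Set.range ((X i).chart (D'.κ i) (D'.mem i)) := by
        refine Set.mem_iInter.2 fun i => ?_
        obtain ⟨z, hz, -⟩ := (X i).exists_inOrbit_of_mem_range_orbitMap _ (hy' i)
        exact ⟨z, hz⟩
      have hopen : IsOpen (⋂ i, WidePullback.π f i ⁻¹' Set.range ((X i).chart (D'.κ i) (D'.mem i))) := by
        refine isOpen_iInter_of_finite fun i => ?_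
        have := (X i).chart_open (D'.κ i) (D'.mem i)
        exact ((X i).chart (D'.κ i) (D'.mem i)).isOpenEmbedding.isOpen_range.preimage
          (WidePullback.π f i).continuous
      obtain ⟨z, hz1, hz2⟩ := mem_closure_iff.1 hy _ hopen hmem
      have hle (i : ι) : D.κ i ≤ D'.κ i := by
        obtain ⟨w, hw⟩ := Set.mem_iInter.1 hz1 i
        have h1 := Set.mem_iInter.1 (hprange.subset hz2).2 i
        rw [Set.mem_preimage, ← hw] at h1
        exact ((X i).inOrbit_of_mem_range_orbitMap _ _ h1).1
      let a : D.ChartIndex := ⟨D'.κ, D'.mem, hle, D'.κB, D'.memB, D'.maps⟩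
      refine Set.mem_iUnion.2 ⟨a, ?_⟩
      rw [hUcoe]
      exact hmem)
  refine ⟨L, hL, hkL, V, ν, hfin, hpZ ▸ hν, hV.symm ▸ hp, ?_, D.constants c, fun i => ?_, fun h => ?_⟩
  · rw [hV]
    exact hprange
  · rw [← Category.assoc, hV, hpπ]
  · exact ⟨(htf h).1, fun i m => (htf h).2 _⟩

end OrbitFamily

/-! ### Extended cones and the affine case -/

open Classical in
lemma originAtInfinity_add_toExtended_apply {M : Type u} [AddCommGroup M] {σ κ : RealCone M} (h : κ ≤ σ)
    {v : M →+ ℝ} (hv : v ∈ σ) (m : dualMonoid σ) :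
    (originAtInfinity h + toExtended σ v hv) m =
      if (m : M) ∈ perp κ then ENNReal.ofReal (v m) else ⊤ := by
  rw [AddMonoidHom.add_apply]
  change (if (m : M) ∈ perp κ then (0 : ℝ≥0∞) else ⊤) + ENNReal.ofReal (v m) = _
  split_ifs
  · exact zero_add _
  · exact top_add _

/-- The part of `κ^⊥` in `σ^∨` generates `κ^⊥` as a group. -/
lemma perp_hom_ext {M : Type u} [AddCommGroup M] [Module.Free ℤ M] [Module.Finite ℤ M] {A : Type*}
    [AddGroup A] {σ κ : RealCone M} (hσ : IsRationalPolyhedral σ) (h : κ.IsFaceOf σ)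
    {g g' : perp κ →+ A} (hg : ∀ m : perp κ, (m : M) ∈ dualMonoid σ → g m = g' m) : g = g' := by
  obtain ⟨m₀, h1, h2, -, h4⟩ := hσ.exists_add_nsmul_mem_dualMonoid_of_isFaceOf h
  refine DFunLike.ext _ _ fun m => ?_
  obtain ⟨N, hN⟩ := h4 m (perp_le_dualMonoid m.2)
  have h5 := hg (m + N • ⟨m₀, h2⟩) hN
  rw [map_add, map_add, hg (N • ⟨m₀, h2⟩) (nsmul_mem h1 N)] at h5
  exact add_right_cancel h5

namespace OrbitFamily

variable {k : Type u} [Field k] {ι : Type} [Nonempty ι] {M : ι → Type u} {MB : Type u}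
  [∀ i, AddCommGroup (M i)] [AddCommGroup MB] {Δ : ∀ i, Set (RealCone (M i))} {ΔB : Set (RealCone MB)}
  {X : ∀ i, ToricVariety k (M i) (Δ i)} {B : ToricVariety k MB ΔB} {φ : ∀ i, MB →+ M i}
  {f : ∀ i, (X i).X ⟶ B.X} {D : OrbitFamily φ Δ ΔB}

/-- The points of the fiber product of the asymptotic cones are finite parts of points of the fiber
product of the cones `∞_{κ i} + σ i`. -/
lemma IsCompatible.exists_isFinitePart (hD : D.IsCompatible X B f) (a : D.ChartIndex)
    {w : D.Lattice →+ ℝ} (hw : w ∈ D.cone a.σ) :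
    ∃ p ∈ D.extendedFiberProduct a.maps a.le (hD.κB_le a), D.IsFinitePart w p := by
  classical
  choose v hv hvw using fun i => mem_asymptoticCone.1 (mem_fiberCone.1 hw i)
  obtain ⟨i₀⟩ := ‹Nonempty ι›
  have : Nonempty ι := ⟨i₀⟩
  refine ⟨fun i => originAtInfinity (a.le i) + toExtended (a.σ i) (v i) (hv i),
    ⟨fun i => ⟨v i, hv i, rfl⟩, originAtInfinity (hD.κB_le a) +
      toExtended a.τ (pull (φ i₀) (v i₀)) (a.maps i₀ _ (hv i₀)), ⟨_, _, rfl⟩, fun i => ?_⟩, fun i m => ?_⟩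
  · refine DFunLike.ext _ _ fun m => ?_
    have h1 := hD.map_mem_perp_iff a m.2
    refine (originAtInfinity_add_toExtended_apply _ _ _).trans
      (Eq.trans ?_ (originAtInfinity_add_toExtended_apply _ _ _).symm)
    by_cases h : (m : MB) ∈ perp D.κB
    · refine (if_pos ((h1 i).2 h)).trans (Eq.trans ?_ (if_pos h).symm)
      congr 1
      have h2 := hvw i (D.map i ⟨m, h⟩)
      have h3 := hvw i₀ (D.map i₀ ⟨m, h⟩)
      exact h2.trans ((congrArg w (fiberIncl_comp D.map i i₀ ⟨m, h⟩)).trans h3.symm)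
    · exact (if_neg (mt (h1 i).1 h)).trans (if_neg h).symm
  · refine (originAtInfinity_add_toExtended_apply _ _ _).trans ?_
    by_cases h : (m : M i) ∈ perp (D.κ i)
    · rw [if_pos h, dif_pos h]
      exact congrArg ENNReal.ofReal (hvw i ⟨m, h⟩)
    · rw [if_neg h, dif_neg h]

variable [Finite ι]

/-- A point of the fiber product of the cones `∞_{κ i} + σ i` has a unique finite part. -/
lemma IsCompatible.existsUnique_isFinitePart (hD : D.IsCompatible X B f) (a : D.ChartIndex)
    {p : ∀ i, ExtendedCone (a.σ i)} (hp : p ∈ D.extendedFiberProduct a.maps a.le (hD.κB_le a)) :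
    ∃! w, w ∈ D.cone a.σ ∧ D.IsFinitePart w p := by
  classical
  have (i : ι) : Module.Finite ℤ (M i) := (X i).fg
  have (i : ι) : Module.Free ℤ (M i) := (X i).free
  have := B.free
  have := B.fg
  obtain ⟨hp, q, ⟨vB, hvB, rfl⟩, hq⟩ := hp
  choose v hv hpv using hp
  have hpi (i : ι) (m : dualMonoid (a.σ i)) :
      p i m = if (m : M i) ∈ perp (D.κ i) then ENNReal.ofReal (v i m) else ⊤ := by
    rw [hpv]
    exact originAtInfinity_add_toExtended_apply _ _ _
  have hvB' (i : ι) : ((v i).comp (perp (D.κ i)).subtype).comp (D.map i) =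
      vB.comp (perp D.κB).subtype := by
    refine perp_hom_ext (B.isFan.polyhedral _ a.memB) (B.isFan.isFaceOf a.memB D.memB (hD.κB_le a))
      fun m hm => ?_
    have h1 : p i (dualMonoidMap (φ i) (a.maps i) ⟨m, hm⟩) = _ := DFunLike.congr_fun (hq i) ⟨m, hm⟩
    rw [originAtInfinity_add_toExtended_apply, if_pos m.2, hpi] at h1
    replace h1 := (if_pos ((hD.map_mem_perp_iff a hm i).2 m.2)).symm.trans h1
    exact (ENNReal.ofReal_eq_ofReal_iff (hm _ (a.maps i _ (hv i))) (hm _ hvB)).1 h1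
  obtain ⟨w, hw⟩ := exists_fiberLattice_hom D.map (fun i => (v i).comp (perp (D.κ i)).subtype)
    fun i j m => (DFunLike.congr_fun (hvB' i) m).trans (DFunLike.congr_fun (hvB' j) m).symm
  have hwC : w ∈ D.cone a.σ :=
    mem_fiberCone.2 fun i => mem_asymptoticCone.2 ⟨v i, hv i, fun m => (hw i m).symm⟩
  have hwp : D.IsFinitePart w p := by
    intro i m
    rw [hpi]
    by_cases h : (m : M i) ∈ perp (D.κ i)
    · rw [if_pos h, dif_pos h]
      exact congrArg ENNReal.ofReal (hw i ⟨m, h⟩).symm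
    · rw [if_neg h, dif_neg h]
  refine ⟨w, ⟨hwC, hwp⟩, fun w' ⟨hwC', hwp'⟩ => ?_⟩
  refine fiberLattice_hom_ext D.map fun i => ?_
  refine DFunLike.congr_fun (perp_hom_ext (g := w'.comp (fiberIncl D.map i)) (g' := w.comp (fiberIncl D.map i))
    ((X i).isFan.polyhedral _ (a.mem i)) ((X i).isFan.isFaceOf (a.mem i) (D.mem i) (a.le i)) fun m hm => ?_)
  have h1 := hwp' i ⟨m, hm⟩
  have h2 := hwp i ⟨m, hm⟩
  rw [dif_pos m.2] at h1 h2
  have h3 := fiberIncl_mem_dualMonoid_cone (D := D) a.σ hm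
  exact (ENNReal.ofReal_eq_ofReal_iff (h3 _ hwC') (h3 _ hwC)).1 (h1.symm.trans h2)

omit [Nonempty ι] in
/-- A toric variety whose fan has a largest cone is affine. -/
lemma HasToricNormalization.affine {Z : Set (FiberProduct X B f)} (hZ : D.HasToricNormalization Z)
    {C : RealCone D.Lattice} (hC : C ∈ D.fan) (hmax : ∀ C' ∈ D.fan, C' ≤ C) :
    D.HasAffineToricNormalization Z C := by
  obtain ⟨L, hL, hkL, V, ν, h⟩ := hZ
  have := V.isIso_chart hC hmax
  have h1 : specMap L (dualMonoid C).subtype ≫ V.chart C hC ≫ ν = V.torus ≫ ν := by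
    rw [← Category.assoc, V.subtype_comp_chart]
  refine ⟨L, hL, hkL, V.chart C hC ≫ ν, h.finite, h.normalization.comp_iso _, ?_, ?_, ?_⟩
  · rw [h1]
    exact h.immersion
  · rw [h1]
    exact h.range_torus
  · obtain ⟨c, hc, hc'⟩ := h.monomial
    refine ⟨c, fun i => ?_, hc'⟩
    rw [← hc i, ← Category.assoc V.torus, ← h1]
    simp only [Category.assoc]

omit [Nonempty ι] [Finite ι] in
/-- If the `X i` and `B` are affine, then their cones give the largest chart. -/
lemma IsCompatible.exists_chartIndex_of_affine (hD : D.IsCompatible X B f)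
    (hf : ∀ i, IsToricMorphism (X i) B (φ i) (f i)) {σ : ∀ i, RealCone (M i)} {σB : RealCone MB}
    (hσ : ∀ i, Δ i = faces (σ i)) (hσB : ΔB = faces σB) :
    ∃ a : D.ChartIndex, a.σ = σ ∧ a.τ = σB ∧ ∀ C ∈ D.fan, C ≤ D.cone a.σ := by
  have hmem (i : ι) : σ i ∈ Δ i := by
    rw [hσ]
    exact PointedCone.IsFaceOf.refl _
  have hmemB : σB ∈ ΔB := by
    rw [hσB]
    exact PointedCone.IsFaceOf.refl _
  have hle (i : ι) (τ : RealCone (M i)) (h : τ ∈ Δ i) : τ ≤ σ i := by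
    rw [hσ] at h
    exact h.le
  refine ⟨⟨σ, hmem, fun i => hle i _ (D.mem i), σB, hmemB, fun i v hv => ?_⟩, rfl, rfl, fun C hC => ?_⟩
  · obtain ⟨τ, hτ, h, -⟩ := hf i (σ i) (hmem i)
    rw [hσB] at hτ
    exact hτ.le (h v hv)
  · obtain ⟨a, rfl⟩ := hD.exists_chartIndex hf hC
    intro w hw
    exact mem_fiberCone.2 fun i =>
      asymptoticCone_mono (hle i _ (a.mem i)) (mem_fiberCone.1 hw i)

end OrbitFamily

/-! ### Closures of orbits -/

section Closures

variable {k : Type u} [Field k] {M : Type u} [AddCommGroup M] {Δ : Set (RealCone M)}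

/-- The smallest closure of an orbit that contains the image of an irreducible closed set is the closure
of the orbit of the image of its generic point. -/
lemma ToricVariety.isLeast_closure_orbit (V : ToricVariety k M Δ) {F : Scheme.{u}} (π : F ⟶ V.X)
    {η : F} {κ : RealCone M} {hκ : κ ∈ Δ} (h : π η ∈ Set.range (V.orbitMap κ hκ)) :
    IsLeast {C | (∃ y, C = closure (V.orbit y)) ∧ π '' closure {η} ⊆ C}
      (closure (Set.range (V.orbitMap κ hκ))) := by
  refine ⟨⟨⟨π η, by rw [V.orbit_eq hκ h]⟩, ?_⟩, ?_⟩
  · refine (image_closure_subset_closure_image π.continuous).trans (closure_mono ?_)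
    rw [Set.image_singleton]
    exact Set.singleton_subset_iff.2 h
  · rintro C ⟨⟨y, rfl⟩, hC⟩
    obtain ⟨κ', hκ', hy⟩ := V.exists_mem_range_orbitMap y
    rw [V.orbit_eq hκ' hy] at hC ⊢
    exact closure_minimal (V.range_orbitMap_subset_closure hκ hκ' h
      (hC ⟨η, subset_closure rfl, rfl⟩)) isClosed_closure

end Closures

end ToricFiber

theorem theoremC {k : Type u} [Field k] {ι : Type} [Finite ι] [Nonempty ι]
    {M : ι → Type u} {MB : Type u} [∀ i, AddCommGroup (M i)] [AddCommGroup MB]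
    {Δ : ∀ i, Set (RealCone (M i))} {ΔB : Set (RealCone MB)}
    (X : ∀ i, ToricVariety k (M i) (Δ i)) (B : ToricVariety k MB ΔB)
    (φ : ∀ i, MB →+ M i) (f : ∀ i, (X i).X ⟶ B.X)
    (hf : ∀ i, IsToricMorphism (X i) B (φ i) (f i)) :
    -- the torus orbits of the fiber product and their normalized closures
    (∀ x : FiberProduct X B f, ∃ D : OrbitFamily φ Δ ΔB,
      -- the orbit of `x` is the fiber product of orbits over an orbit
      (∀ i, Set.range ((X i).orbitMap (D.κ i) (D.mem i)) =
        (X i).orbit ((WidePullback.π f i) x)) ∧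
      Set.range (B.orbitMap D.κB D.memB) = B.orbit ((WidePullback.base f) x) ∧
      (∃ h : ∀ i, (X i).orbitMap (D.κ i) (D.mem i) ≫ f i =
          specMap k (D.map i) ≫ B.orbitMap D.κB D.memB,
        IsImmersion (D.orbitToFiber h) ∧
        Set.range (D.orbitToFiber h) = fiberOrbit X B f x ∧
        ∀ (S : Scheme.{u}) (s : S ⟶ FiberProduct X B f)
          (t : ∀ i, S ⟶ specMonoid k (perp (D.κ i))),
          (∀ i, s ≫ WidePullback.π f i = t i ≫ (X i).orbitMap (D.κ i) (D.mem i)) →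
          ∃! r, r ≫ D.orbitToFiber h = s) ∧
      (IsAddTorsionFree (FiberGroup D.map) → IsIrreducible (fiberOrbit X B f x)) ∧
      -- the normalized closure is toric, with fan the fiber product of the fans of asymptotic cones
      (∀ Z : Set (FiberProduct X B f),
        Maximal (fun W => IsIrreducible W ∧ W ⊆ closure (fiberOrbit X B f x)) Z →
        D.HasToricNormalization Z) ∧
      -- the affine case: its cone is the fiber product of the asymptotic cones
      (∀ (σ : ∀ i, RealCone (M i)) (σB : RealCone MB), (∀ i, Δ i = faces (σ i)) → ΔB = faces σB →
        (∀ Z : Set (FiberProduct X B f),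
          Maximal (fun W => IsIrreducible W ∧ W ⊆ closure (fiberOrbit X B f x)) Z →
          D.HasAffineToricNormalization Z (D.cone σ)) ∧
        ∃ (hσ : ∀ i, ∀ v ∈ σ i, pull (φ i) v ∈ σB) (hκ : ∀ i, D.κ i ≤ σ i) (hκB : D.κB ≤ σB),
          (∀ w ∈ D.cone σ, ∃ p ∈ D.extendedFiberProduct hσ hκ hκB, D.IsFinitePart w p) ∧
          (∀ p ∈ D.extendedFiberProduct hσ hκ hκB, ∃! w, w ∈ D.cone σ ∧ D.IsFinitePart w p))) ∧
    -- the irreducible components of the fiber product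
    (∀ Z ∈ irreducibleComponents (FiberProduct X B f), ∃ D : OrbitFamily φ Δ ΔB,
      IsLeast {C | (∃ y, C = closure (B.orbit y)) ∧ (WidePullback.base f) '' Z ⊆ C}
        (closure (Set.range (B.orbitMap D.κB D.memB))) ∧
      (∀ i, IsLeast {C | (∃ y, C = closure ((X i).orbit y)) ∧ (WidePullback.π f i) '' Z ⊆ C}
        (closure (Set.range ((X i).orbitMap (D.κ i) (D.mem i))))) ∧
      IsFan (asymptoticFan ΔB D.κB) ∧
      (∀ i, IsFan (asymptoticFan (Δ i) (D.κ i))) ∧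
      D.HasToricNormalization Z) := by
  refine ⟨fun x => ?_, fun Z hZ => ?_⟩
  · obtain ⟨D, hD, hx, hxB⟩ := exists_orbitFamily hf x
    refine ⟨D, fun i => ((X i).orbit_eq (D.mem i) (hx i)).symm, (B.orbit_eq D.memB hxB).symm, ?_⟩
    rw [OrbitFamily.fiberOrbit_eq_stratum hx]
    refine ⟨⟨hD.orbitMap_comp, hD.orbitToFiber⟩, hD.isIrreducible_stratum,
      fun Z hZ => hD.exists_toricNormalization hf hZ, fun σ σB hσ hσB => ?_⟩
    obtain ⟨a, rfl, rfl, ha⟩ := hD.exists_chartIndex_of_affine hf hσ hσB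
    exact ⟨fun Z hZ => (hD.exists_toricNormalization hf hZ).affine (hD.cone_mem_fan a) ha,
      a.maps, a.le, hD.κB_le a, fun w hw => hD.exists_isFinitePart a hw,
      fun p hp => hD.existsUnique_isFinitePart a hp⟩
  · have (i : ι) : Module.Finite ℤ (M i) := (X i).fg
    have (i : ι) : Module.Free ℤ (M i) := (X i).free
    have := B.free
    have := B.fg
    have hirr : IsIrreducible Z := hZ.1
    have hclosed : IsClosed Z := isClosed_of_mem_irreducibleComponents Z hZ
    obtain ⟨η, hη⟩ := QuasiSober.sober hirr hclosed
    obtain ⟨D, hD, hx, hxB⟩ := exists_orbitFamily hf η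
    have hηZ : closure {η} = Z := hη
    have hη' : η ∈ D.stratum X B f := Set.mem_iInter.2 hx
    refine ⟨D, ?_, fun i => ?_, B.isFan.asymptoticFan D.memB,
      fun i => (X i).isFan.asymptoticFan (D.mem i), hD.exists_toricNormalization hf
        ⟨⟨hirr, ?_⟩, fun W hW hZW => hZ.2 hW.1 hZW⟩⟩
    · rw [← hηZ]
      exact B.isLeast_closure_orbit _ hxB
    · rw [← hηZ]
      exact (X i).isLeast_closure_orbit _ (hx i)
    · rw [← hηZ]
      exact closure_mono (Set.singleton_subset_iff.2 hη')
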